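/- Let $1<\alpha\le 2$, $T\ge 1$, $N\ge 0$. Write $z^{<\beta>}=|z|^{\beta-1}\overline z$ for $z\in\mathbb C$ and apply this power coordinatewise to vectors. For jointly symmetric $\alpha$-stable (S$\alpha$S) complex random variables $X,Y$ let $[X,Y]_\alpha=\int (x_1+ix_2)(y_1+iy_2)^{<\alpha-1>}\,d\Gamma(x_1,x_2,y_1,y_2)$ be the covariation, where $\Gamma$ is a symmetric finite measure on the unit sphere of $\mathbb R^4$ that represents the characteristic function of $(\operatorname{Re}X,\operatorname{Im}X,\operatorname{Re}Y,\operatorname{Im}Y)$ in the form $\exp(-\int|\langle t,x\rangle|^\alpha d\Gamma(x))$, and let $\|X\|_\alpha=[X,X]_\alpha^{1/\alpha}$. Let $\{\xi(n)\}_{n\in\mathbb Z}$ be a periodically harmonizable S$\alpha$S sequence with period $T$: it is S$\alpha$S, and the blocked sequence $\vec\xi(n)=\{\xi(nT+k)\}_{k=0}^{T-1}$ is harmonizable, $\vec\xi(n)=\int_{-\pi}^{\pi}e^{in\theta}\,d\vec Z(\theta)$, where $\vec Z$ is a $T$-dimensional S$\alpha$S process with independent increments on $[-\pi,\pi]$ with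 a finite matrix-valued spectral measure $\mu$, that is, $$[\vec a^{\top}(\vec Z(t)-\vec Z(s)),\ \vec b^{\top}(\vec Z(t)-\vec Z(s))]_\alpha=\vec a^{\top}\mu((s,t])\,\vec b^{<\alpha-1>}\qquad(\vec a,\vec b\in\mathbb C^T,\ -\pi\le s\le t\le\pi),$$ and $[\xi(nT+k),\xi(mT+l)]_\alpha=\int_{-\pi}^{\pi} e^{i(n-m)\theta}\,d\mu_{kl}(\theta)$. Suppose that $\mu$ is absolutely continuous with density $f(\theta)$, that $f(\theta)$ is positive definite for almost every $\theta$, and that $\int_{-\pi}^{\pi}\operatorname{Tr}[f(\theta)^{-1/(\alpha-1)}]\,d\theta<\infty$. Let $L^\alpha(f)$ be the space of measurable $h:(-\pi,\pi]\to\mathbb C^T$ with $\int h^\top f h^{<\alpha-1>}d\theta<\infty$ (the $\alpha$-th power of the norm), and let $\int h^\top d\vec Z$ be the limit in probability of the integrals of step functions that converge to $h$ in $L^\alpha(f)$. Let $\vec a(j)=\{a_k(j)\}_{k=0}^{T-1}\in\mathbb C^T$, $j=0,\dots,N$, and $$A_N\vec\xi=\sum_{j=0}^N\sum_{k=0}^{T-1}a_k(j)\,\xi(jT+k),\qquad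 A_N(e^{i\theta})=\sum_{j=0}^N\vec a(j)e^{ij\theta}.$$ Let $H^N(\xi)$ be the $\|\cdot\|_\alpha$-closed linear span of the observed values $\xi(m)$, $m\in\mathbb Z\setminus\{0,\dots,T(N+1)-1\}$. An optimal linear estimate of $A_N\vec\xi$ is an element of $H^N(\xi)$ at minimal $\|\cdot\|_\alpha$-distance from $A_N\vec\xi$. For $\vec c(0),\dots,\vec c(N)\in\mathbb C^T$ put $$C_N(e^{i\theta})=\sum_{j=0}^N\vec c(j)e^{-ij\theta},\qquad h(\theta)=A_N(e^{i\theta})-\left(f^{-1}(\theta)C_N(e^{i\theta})\right)^{<\frac1{\alpha-1}>}.$$ Then the system $$\int_{-\pi}^{\pi}e^{-i\theta k}\left[A_N(e^{i\theta})-\left(f^{-1}(\theta)C_N(e^{i\theta})\right)^{<\frac1{\alpha-1}>}\right]d\theta=0,\qquad k=0,\dots,N,$$ has exactly one solution $\vec c(0),\dots,\vec c(N)$. For this solution $h$ lies in the closed subspace of $L^\alpha(f)$ generated by the functions $e^{ij\theta}\delta_k$, $j\in\mathbb Z\setminus\{0,\dots,N\}$, where $\delta_k$ are the coordinate vectors of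 $\mathbb C^T$. The optimal linear estimate of $A_N\vec\xi$ exists, is almost surely unique, and equals $$\hat A_N\vec\xi=\int_{-\pi}^{\pi}h(\theta)^{\top}\,d\vec Z(\theta),$$ and its error is $$\|A_N\vec\xi-\hat A_N\vec\xi\|_\alpha^\alpha=\int_{-\pi}^{\pi}\left[\left(f^{-1}C_N\right)^{<\frac1{\alpha-1}>}\right]^{\top}f(\theta)\left[\left(f^{-1}C_N\right)^{<\frac1{\alpha-1}>}\right]^{<\alpha-1>}d\theta,$$ which for $T=1$ is $\int_{-\pi}^{\pi}\left|\left(f^{-1}C_N\right)^{<\frac1{\alpha-1}>}\right|^{\alpha}f(\theta)\,d\theta$. -/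

import Mathlib

open MeasureTheory ProbabilityTheory Filter Topology
open scoped Matrix ENNReal ComplexOrder

noncomputable section

namespace StableInterp

variable {Ω : Type*} [MeasurableSpace Ω]

/-! ### Symmetric stable random variables, covariation -/

/-- The signed conjugate power `z^{<β>} = |z|^{β-1} * conj z`. -/
def spow (z : ℂ) (β : ℝ) : ℂ := ((‖z‖ ^ (β - 1) : ℝ) : ℂ) * (starRingEnd ℂ) z

/-- Coordinatewise signed conjugate power of a complex vector. -/
def vpow {ι : Type*} (v : ι → ℂ) (β : ℝ) : ι → ℂ := fun k => spow (v k) β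

/-- `Γ` is a spectral measure of the real random vector `X`: a finite symmetric measure carried by
the Euclidean unit sphere with
`E exp(i ∑ t_k X_k) = exp(-∫ |∑ t_k x_k|^α dΓ(x))` for all real `t`. -/
structure IsSpectralMeasure {ι : Type*} [Fintype ι] (α : ℝ) (P : Measure Ω) (X : ι → Ω → ℝ)
    (Γ : Measure (EuclideanSpace ℝ ι)) : Prop where
  finite : IsFiniteMeasure Γ
  sphere : Γ (Metric.sphere (0 : EuclideanSpace ℝ ι) 1)ᶜ = 0
  symm : Γ.map (fun x => -x) = Γ
  charFun : ∀ t : ι → ℝ,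
    ∫ ω, Complex.exp (Complex.I * ((∑ k, t k * X k ω : ℝ) : ℂ)) ∂P
      = Complex.exp (-((∫ x, |∑ k, t k * x k| ^ α ∂Γ : ℝ) : ℂ))

/-- The real random variables `X k` are jointly symmetric `α`-stable. -/
def JointlySaS {ι : Type*} [Fintype ι] (α : ℝ) (P : Measure Ω) (X : ι → Ω → ℝ) : Prop :=
  (∀ k, AEMeasurable (X k) P) ∧ ∃ Γ, IsSpectralMeasure α P X Γ

/-- The complex random variables `X k` are jointly symmetric `α`-stable: their real and imaginary
parts are. -/
def CJointlySaS {ι : Type*} [Fintype ι] (α : ℝ) (P : Measure Ω) (X : ι → Ω → ℂ) : Prop :=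
  JointlySaS α P (Sum.elim (fun k ω => (X k ω).re) (fun k ω => (X k ω).im))

/-- A complex symmetric `α`-stable random variable. -/
def IsSaS (α : ℝ) (P : Measure Ω) (X : Ω → ℂ) : Prop :=
  CJointlySaS α P (fun _ : Unit => X)

/-- The real vector `(Re X, Im X, Re Y, Im Y)`. -/
def realQuad (X Y : Ω → ℂ) : Fin 4 → Ω → ℝ :=
  ![fun ω => (X ω).re, fun ω => (X ω).im, fun ω => (Y ω).re, fun ω => (Y ω).im]

open Classical in
/-- The covariation `[X, Y]_α = ∫ (x₁ + i x₂) (y₁ + i y₂)^{<α-1>} dΓ(x₁, x₂, y₁, y₂)`, where `Γ` is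
a spectral measure of `(Re X, Im X, Re Y, Im Y)`. (For `1 < α ≤ 2` the value is determined by the
joint law of `X` and `Y`; in particular for `α = 2`, where `Γ` itself is not.) -/
def covariation (α : ℝ) (P : Measure Ω) (X Y : Ω → ℂ) : ℂ :=
  if h : JointlySaS α P (realQuad X Y) then
    ∫ x, (⟨x 0, x 1⟩ : ℂ) * spow ⟨x 2, x 3⟩ (α - 1) ∂(Classical.choose h.2)
  else 0

/-- `‖X‖_α = [X, X]_α^{1/α}`. -/
def saNorm (α : ℝ) (P : Measure Ω) (X : Ω → ℂ) : ℝ :=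
  (covariation α P X X).re ^ (1 / α)

/-- A complex-valued family (sequence or process) is symmetric `α`-stable: its finite subfamilies
are jointly symmetric `α`-stable. -/
def IsSaSFamily {I : Type*} (α : ℝ) (P : Measure Ω) (X : I → Ω → ℂ) : Prop :=
  ∀ s : Finset I, CJointlySaS α P (fun i : s => X i)

/-! ### Processes with independent increments and their spectral densities -/

/-- The vector process `Z` on `[-π, π]` has independent increments. -/
def IndepIncrements {T : ℕ} (P : Measure Ω) (Z : ℝ → Ω → Fin T → ℂ) : Prop :=
  ∀ (n : ℕ) (t : Fin (n + 1) → ℝ), Monotone t → (∀ i, t i ∈ Set.Icc (-Real.pi) Real.pi) →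
    iIndepFun (fun (i : Fin n) ω => Z (t i.succ) ω - Z (t i.castSucc) ω) P

/-- `Z` is a `T`-dimensional symmetric `α`-stable process on `[-π, π]` with independent increments,
whose matrix-valued spectral measure is finite and absolutely continuous with density `f`, i.e.
`[aᵀ (Z(t) - Z(s)), bᵀ (Z(t) - Z(s))]_α = aᵀ (∫_s^t f) b^{<α-1>}`. -/
structure HasSpectralDensity {T : ℕ} (α : ℝ) (P : Measure Ω) (Z : ℝ → Ω → Fin T → ℂ)
    (f : ℝ → Matrix (Fin T) (Fin T) ℂ) : Prop where
  stable : IsSaSFamily α P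
    (fun (p : Set.Icc (-Real.pi) Real.pi × Fin T) ω => Z p.1 ω p.2)
  indep : IndepIncrements P Z
  integrable : ∀ k l, IntegrableOn (fun θ => f θ k l) (Set.Ioc (-Real.pi) Real.pi)
  spectral : ∀ s t : ℝ, -Real.pi ≤ s → s ≤ t → t ≤ Real.pi → ∀ a b : Fin T → ℂ,
    covariation α P (fun ω => a ⬝ᵥ (Z t ω - Z s ω)) (fun ω => b ⬝ᵥ (Z t ω - Z s ω))
      = a ⬝ᵥ ((Matrix.of fun k l => ∫ θ in Set.Ioc s t, f θ k l) *ᵥ vpow b (α - 1))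

/-! ### The space `L^α(f)` and stochastic integrals -/

/-- The integral `∫ hᵀ f h^{<α-1>} dθ` over `(-π, π]`, the `α`-th power of the norm in `L^α(f)`. -/
def lalpha {T : ℕ} (α : ℝ) (f : ℝ → Matrix (Fin T) (Fin T) ℂ) (h : ℝ → Fin T → ℂ) : ℝ≥0∞ :=
  ∫⁻ θ in Set.Ioc (-Real.pi) Real.pi,
    ENNReal.ofReal (h θ ⬝ᵥ (f θ *ᵥ vpow (h θ) (α - 1))).re

/-- `h` belongs to `L^α(f)`. -/
def MemLalpha {T : ℕ} (α : ℝ) (f : ℝ → Matrix (Fin T) (Fin T) ℂ) (h : ℝ → Fin T → ℂ) : Prop :=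
  AEStronglyMeasurable h (volume.restrict (Set.Ioc (-Real.pi) Real.pi)) ∧ lalpha α f h < ∞

/-- A vector-valued step function: the value `v i` on `(t_i, t_{i+1}] ⊆ (-π, π]`. -/
structure StepFun (T : ℕ) where
  n : ℕ
  t : Fin (n + 1) → ℝ
  mono : Monotone t
  mem : ∀ i, t i ∈ Set.Icc (-Real.pi) Real.pi
  v : Fin n → Fin T → ℂ

/-- The step function as a function. -/
def StepFun.toFun {T : ℕ} (φ : StepFun T) (θ : ℝ) : Fin T → ℂ :=
  ∑ i : Fin φ.n, (Set.Ioc (φ.t i.castSucc) (φ.t i.succ)).indicator (fun _ => φ.v i) θ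

/-- `∫ φᵀ dZ = ∑ v_iᵀ (Z(t_{i+1}) - Z(t_i))` for a step function. -/
def StepFun.integral {T : ℕ} (φ : StepFun T) (Z : ℝ → Ω → Fin T → ℂ) (ω : Ω) : ℂ :=
  ∑ i : Fin φ.n, φ.v i ⬝ᵥ (Z (φ.t i.succ) ω - Z (φ.t i.castSucc) ω)

/-- `X` is (a version of) the stochastic integral `∫ hᵀ dZ`, `h ∈ L^α(f)`: the limit in probability
of the integrals of step functions that converge to `h` in `L^α(f)`. -/
def IsStochIntegral {T : ℕ} (α : ℝ) (P : Measure Ω) (Z : ℝ → Ω → Fin T → ℂ)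
    (f : ℝ → Matrix (Fin T) (Fin T) ℂ) (h : ℝ → Fin T → ℂ) (X : Ω → ℂ) : Prop :=
  MemLalpha α f h ∧ ∃ φ : ℕ → StepFun T,
    Tendsto (fun m => lalpha α f (fun θ => h θ - (φ m).toFun θ)) atTop (𝓝 0) ∧
    TendstoInMeasure P (fun m ω => (φ m).integral Z ω) atTop X

/-! ### Harmonizable and periodically harmonizable sequences -/

/-- The character `e^{i n θ}`. -/
def ex (n : ℤ) (θ : ℝ) : ℂ := Complex.exp (Complex.I * (n : ℂ) * (θ : ℂ))

/-- `X` is a `T`-dimensional harmonizable symmetric `α`-stable sequence represented by the process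
`Z`, with absolutely continuous spectral measure of density `f`. -/
structure IsHarmonizable {T : ℕ} (α : ℝ) (P : Measure Ω) (X : ℤ → Fin T → Ω → ℂ)
    (Z : ℝ → Ω → Fin T → ℂ) (f : ℝ → Matrix (Fin T) (Fin T) ℂ) : Prop where
  stable : IsSaSFamily α P (fun p : ℤ × Fin T => X p.1 p.2)
  process : HasSpectralDensity α P Z f
  repr : ∀ n k, IsStochIntegral α P Z f (fun θ => Pi.single k (ex n θ)) (X n k)
  cov : ∀ n m k l, covariation α P (X n k) (X m l)
    = ∫ θ in Set.Ioc (-Real.pi) Real.pi, ex (n - m) θ * f θ k l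

/-- The blocked sequence `{ξ(nT + k)}`, `k = 0, …, T-1`. -/
def block (T : ℕ) (ξ : ℤ → Ω → ℂ) (n : ℤ) (k : Fin T) : Ω → ℂ := ξ (n * T + (k : ℕ))

/-- `ξ` is a periodically harmonizable symmetric `α`-stable sequence with period `T`: the blocked
sequence is harmonizable (here represented by `Z`, with spectral density `f`). -/
def IsPeriodicallyHarmonizable (α : ℝ) (T : ℕ) (P : Measure Ω) (ξ : ℤ → Ω → ℂ)
    (Z : ℝ → Ω → Fin T → ℂ) (f : ℝ → Matrix (Fin T) (Fin T) ℂ) : Prop :=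
  IsSaSFamily α P ξ ∧ IsHarmonizable α P (block T ξ) Z f

/-- The minimality condition `∫ Tr [f(θ)^{-1/(α-1)}] dθ < ∞`; the power is that of a positive
definite matrix. -/
def Minimality {T : ℕ} (α : ℝ) (f : ℝ → Matrix (Fin T) (Fin T) ℂ) : Prop :=
  (∀ᵐ θ ∂(volume.restrict (Set.Ioc (-Real.pi) Real.pi)), (f θ).PosDef) ∧
  IntegrableOn (fun θ => (cfc (fun x : ℝ => x ^ (-1 / (α - 1))) (f θ)).trace)
    (Set.Ioc (-Real.pi) Real.pi)

/-! ### The interpolation problem -/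

/-- The functional `∑_{j=0}^N ∑_{k=0}^{T-1} a_k(j) ξ(jT + k)`. -/
def functional {T N : ℕ} (a : Fin (N + 1) → Fin T → ℂ) (ξ : ℤ → Ω → ℂ) (ω : Ω) : ℂ :=
  ∑ j : Fin (N + 1), ∑ k : Fin T, a j k * ξ (((j : ℕ) : ℤ) * T + (k : ℕ)) ω

/-- `H^N(ξ)`: the closure in `‖·‖_α` of the linear span of `ξ(m)`,
`m ∈ ℤ \ {0, …, T(N+1) - 1}`. -/
def observed (α : ℝ) (T N : ℕ) (P : Measure Ω) (ξ : ℤ → Ω → ℂ) : Set (Ω → ℂ) :=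
  {η | ∀ ε > 0, ∃ ζ ∈ Submodule.span ℂ (ξ '' (Set.Ico 0 ((T : ℤ) * (N + 1)))ᶜ),
    IsSaS α P (η - ζ) ∧ saNorm α P (η - ζ) < ε}

/-- `Y` is an optimal linear estimate of `A` from the observations: an element of `H^N(ξ)` at
minimal `‖·‖_α`-distance from `A`. -/
def IsOptimal (α : ℝ) (T N : ℕ) (P : Measure Ω) (ξ : ℤ → Ω → ℂ) (A Y : Ω → ℂ) : Prop :=
  Y ∈ observed α T N P ξ ∧
    ∀ η ∈ observed α T N P ξ, saNorm α P (A - Y) ≤ saNorm α P (A - η)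

/-- `A_N(e^{iθ}) = ∑_{j=0}^N a(j) e^{ijθ}`. -/
def polyA {T N : ℕ} (a : Fin (N + 1) → Fin T → ℂ) (θ : ℝ) : Fin T → ℂ :=
  ∑ j : Fin (N + 1), ex ((j : ℕ) : ℤ) θ • a j

/-- `C_N(e^{iθ}) = ∑_{j=0}^N c(j) e^{-ijθ}`. -/
def polyC {T N : ℕ} (c : Fin (N + 1) → Fin T → ℂ) (θ : ℝ) : Fin T → ℂ :=
  ∑ j : Fin (N + 1), ex (-((j : ℕ) : ℤ)) θ • c j

/-- `(f^{-1}(θ) C_N(e^{iθ}))^{<1/(α-1)>}`. -/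
def errChar {T N : ℕ} (α : ℝ) (f : ℝ → Matrix (Fin T) (Fin T) ℂ)
    (c : Fin (N + 1) → Fin T → ℂ) (θ : ℝ) : Fin T → ℂ :=
  vpow ((f θ)⁻¹ *ᵥ polyC c θ) (1 / (α - 1))

/-- The function `h = A_N(e^{iθ}) - (f^{-1}(θ) C_N(e^{iθ}))^{<1/(α-1)>}`. -/
def specChar {T N : ℕ} (α : ℝ) (f : ℝ → Matrix (Fin T) (Fin T) ℂ)
    (a c : Fin (N + 1) → Fin T → ℂ) (θ : ℝ) : Fin T → ℂ :=
  polyA a θ - errChar α f c θ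

/-- The system `∫ e^{-iθk} h(θ) dθ = 0`, `k = 0, …, N`, in the unknowns `c(0), …, c(N)`. -/
def SolvesSystem {T N : ℕ} (α : ℝ) (f : ℝ → Matrix (Fin T) (Fin T) ℂ)
    (a c : Fin (N + 1) → Fin T → ℂ) : Prop :=
  ∀ (k : Fin (N + 1)) (l : Fin T),
    IntegrableOn (fun θ => ex (-((k : ℕ) : ℤ)) θ * specChar α f a c θ l)
      (Set.Ioc (-Real.pi) Real.pi) ∧
    ∫ θ in Set.Ioc (-Real.pi) Real.pi, ex (-((k : ℕ) : ℤ)) θ * specChar α f a c θ l = 0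

/-- `L_N^α(f)`: the closed subspace of `L^α(f)` generated by the functions `e^{ijθ} δ_k`,
`j ∈ ℤ \ {0, …, N}`. -/
def MemLN {T : ℕ} (α : ℝ) (N : ℕ) (f : ℝ → Matrix (Fin T) (Fin T) ℂ)
    (h : ℝ → Fin T → ℂ) : Prop :=
  MemLalpha α f h ∧ ∀ ε : ℝ≥0∞, 0 < ε →
    ∃ p ∈ Submodule.span ℂ {q : ℝ → Fin T → ℂ | ∃ j : ℤ, ∃ k : Fin T,
        j ∉ Set.Ico 0 ((N : ℤ) + 1) ∧ q = fun θ => Pi.single k (ex j θ)},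
      lalpha α f (h - p) < ε

end StableInterp

end

noncomputable section

namespace StableInterp

/-! ### The signed conjugate power -/

/-! The stochastic integral turns interpolation into best approximation in $L^\alpha(f)$, and the
system is the Euler equation of that approximation problem.

Isometry. The mass of the spectral measure of a complex S$\alpha$S variable on the unit circle, its
scale (`HasScale`), equals $\|X\|_\alpha^\alpha$ and depends only on the law of $X$: the average of
$|\langle z,t\rangle|^\alpha$ over $|t|=1$ is the same constant for every $z$ on the circle. Scales
of independent variables add, so integrals of step functions have scale $\int h^\top f
h^{<\alpha-1>}$, and this passes to limits (`IsStochIntegral.hasScale`). For stable variables small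
scale and smallness in probability are equivalent, each uniformly controlling the other. Hence the
integrals of functions in $L_N^\alpha(f)$ are, up to versions, exactly the elements of $H^N(\xi)$
(`exists_mem_observed`, `exists_memLN`).

Geometry of $L^\alpha(f)$. One needs $u^\top f(\theta)v^{<\alpha-1>}$ to be, in linear coordinates,
the covariation form of $\ell^\alpha$ (`IsAlphaForm`). For $\alpha=2$ this is a factorization of a
positive definite matrix. For $\alpha<2$ positive definiteness alone would not give it; but the
covariation formula for all vectors forces $f$ to be diagonal almost everywhere
(`HasSpectralDensity.specMass_eq_zero`). The reason is that $\|X_k+\varepsilon X_l\|_\alpha^\alpha$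
is Lipschitz in $\varepsilon\in[0,1]$, whereas an off-diagonal mass would contribute a term of order
$\varepsilon^{\alpha-1}$. In the coordinates of $\ell^\alpha$, Minkowski, Hölder, uniform convexity
and the Bregman inequality
$\alpha\operatorname{Re}(u\,v^{<\alpha-1>})\le|u|^\alpha+(\alpha-1)|v|^\alpha$ are scalar facts that
are summed and integrated.

Existence. Minimality and Hölder embed $L^\alpha(f)$ continuously into $L^1$; this gives
completeness by Fatou along a subsequence, and continuity of Fourier coefficients. Uniform convexity
then yields a best approximation $h$ of $A_N$ in $L_N^\alpha(f)$ and its uniqueness. The error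
$e=A_N-h$ satisfies $\int p^\top f e^{<\alpha-1>}=0$ for all exponentials $p$ with frequency outside
$\{0,\dots,N\}$, so $f e^{<\alpha-1>}$ is a polynomial $C_N$ and $e=(f^{-1}C_N)^{<1/(\alpha-1)>}$.
Since $h$ lies in $L_N^\alpha(f)$, its coefficients $0,\dots,N$ vanish: this is the system.

Uniqueness (`IsDensity.solvesSystem_unique`). For two solutions with errors $e,e'$, the integral of
$(e-e')^\top(C_N-C_N')$ vanishes by the system, while its real part is pointwise nonnegative and
zero only where $e=e'$, by the Bregman inequality used twice. No membership in $L^\alpha(f)$ is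
needed here, so every solution of the system is the one given by the best approximation. -/

lemma norm_spow {β : ℝ} (hβ : 0 < β) (z : ℂ) : ‖spow z β‖ = ‖z‖ ^ β := by
  rcases eq_or_ne z 0 with rfl | hz
  · simp [spow, Real.zero_rpow hβ.ne']
  · have h : 0 < ‖z‖ := norm_pos_iff.mpr hz
    rw [spow, norm_mul, Complex.norm_real, Real.norm_of_nonneg (by positivity), RCLike.norm_conj]
    nth_rewrite 2 [← Real.rpow_one ‖z‖]
    rw [← Real.rpow_add h]
    simp

lemma spow_zero {β : ℝ} : spow 0 β = 0 := by simp [spow]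

lemma mul_spow_self {α : ℝ} (hα : 1 < α) (z : ℂ) :
    z * spow z (α - 1) = ((‖z‖ ^ α : ℝ) : ℂ) := by
  rcases eq_or_ne z 0 with rfl | hz
  · simp [Real.zero_rpow (by linarith : α ≠ 0)]
  · have h : 0 < ‖z‖ := norm_pos_iff.mpr hz
    have h2 : z * (starRingEnd ℂ) z = ((‖z‖ ^ (2 : ℝ) : ℝ) : ℂ) := by
      rw [Complex.mul_conj, Complex.normSq_eq_norm_sq]; norm_cast
    rw [spow, mul_left_comm, h2, ← Complex.ofReal_mul, ← Real.rpow_add h]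
    congr 2; ring

lemma spow_spow {β γ : ℝ} (hβ : 0 < β) (h : β * γ = 1) (z : ℂ) : spow (spow z β) γ = z := by
  rcases eq_or_ne z 0 with rfl | hz
  · simp [spow_zero]
  · have hz' : 0 < ‖z‖ := norm_pos_iff.mpr hz
    rw [spow, norm_spow hβ, spow, map_mul, Complex.conj_ofReal, Complex.conj_conj, ← mul_assoc,
      ← Complex.ofReal_mul, ← Real.rpow_mul hz'.le, ← Real.rpow_add hz']
    rw [show β * (γ - 1) + (β - 1) = 0 by linarith]
    simp

lemma spow_real_mul {β r : ℝ} (hr : 0 < r) (z : ℂ) :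
    spow (r * z) β = ((r ^ β : ℝ) : ℂ) * spow z β := by
  rw [spow, spow, norm_mul, Complex.norm_real, Real.norm_of_nonneg hr.le,
    Real.mul_rpow hr.le (norm_nonneg _), map_mul, Complex.conj_ofReal, Complex.ofReal_mul]
  have : ((r ^ β : ℝ) : ℂ) = ((r ^ (β - 1) : ℝ) : ℂ) * r := by
    rw [← Complex.ofReal_mul]
    congr 1
    nth_rewrite 3 [← Real.rpow_one r]
    rw [← Real.rpow_add hr]; simp
  rw [this]; ring

lemma continuous_spow {β : ℝ} (hβ : 0 < β) : Continuous (fun z => spow z β) := by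
  rw [continuous_iff_continuousAt]
  intro z
  rcases eq_or_ne z 0 with rfl | hz
  · rw [ContinuousAt, spow_zero, tendsto_zero_iff_norm_tendsto_zero]
    simp_rw [norm_spow hβ]
    have : Continuous fun z : ℂ => ‖z‖ ^ β := continuous_norm.rpow_const fun _ => Or.inr hβ.le
    simpa [Real.zero_rpow hβ.ne'] using this.tendsto 0
  · unfold spow
    refine ContinuousAt.mul ?_ (Complex.continuous_conj.continuousAt)
    refine Complex.continuous_ofReal.continuousAt.comp ?_
    exact continuous_norm.continuousAt.rpow_const (Or.inl (norm_ne_zero_iff.mpr hz))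

lemma continuous_vpow {ι : Type*} {β : ℝ} (hβ : 0 < β) :
    Continuous (fun v : ι → ℂ => vpow v β) :=
  continuous_pi fun k => (continuous_spow hβ).comp (continuous_apply k)

lemma vpow_vpow {ι : Type*} {β γ : ℝ} (hβ : 0 < β) (h : β * γ = 1) (v : ι → ℂ) :
    vpow (vpow v β) γ = v := funext fun _ => spow_spow hβ h _

/-! ### Pointwise convexity inequalities for `|z|^α` -/

lemma re_mul_spow_le {α : ℝ} (hα : 1 < α) (u v : ℂ) :
    (u * spow v (α - 1)).re ≤ ‖u‖ * ‖v‖ ^ (α - 1) :=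
  (Complex.re_le_norm _).trans (by rw [norm_mul, norm_spow (by linarith)])

/-- The Bregman distance of `|·|^α` is nonnegative. -/
lemma alpha_mul_re_le {α : ℝ} (hα : 1 < α) (u v : ℂ) :
    α * (u * spow v (α - 1)).re ≤ ‖u‖ ^ α + (α - 1) * ‖v‖ ^ α := by
  have hpq : α.HolderConjugate (α / (α - 1)) := by
    rw [Real.holderConjugate_iff]; refine ⟨hα, ?_⟩
    field_simp [(by linarith : α - 1 ≠ 0)]; ring
  have h := Real.young_inequality_of_nonneg (norm_nonneg u)
    (Real.rpow_nonneg (norm_nonneg v) (α - 1)) hpq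
  rw [← Real.rpow_mul (norm_nonneg v), mul_div_cancel₀ _ (by linarith : α - 1 ≠ 0)] at h
  have h2 := re_mul_spow_le hα u v
  have h3 : α * (‖u‖ * ‖v‖ ^ (α - 1)) ≤ α * (‖u‖ ^ α / α + ‖v‖ ^ α / (α / (α - 1))) :=
    mul_le_mul_of_nonneg_left h (by linarith)
  have h4 : α * (‖u‖ ^ α / α + ‖v‖ ^ α / (α / (α - 1))) = ‖u‖ ^ α + (α - 1) * ‖v‖ ^ α := by
    field_simp [(by linarith : α ≠ 0), (by linarith : α - 1 ≠ 0)]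
  nlinarith [h2, h3, h4]

/-- Equality case of the Bregman inequality. Strict Bernoulli for the ratio $|u|/|v|$ forces equal
moduli; then the real part of $u\bar v$ is maximal, which forces equal arguments. -/
lemma eq_of_alpha_mul_re_eq {α : ℝ} (hα : 1 < α) {u v : ℂ}
    (h : α * (u * spow v (α - 1)).re = ‖u‖ ^ α + (α - 1) * ‖v‖ ^ α) : u = v := by
  rcases eq_or_ne v 0 with rfl | hv
  · simp only [spow_zero, mul_zero, Complex.zero_re, norm_zero,
      Real.zero_rpow (by linarith : α ≠ 0), add_zero] at h
    exact norm_eq_zero.mp (((Real.rpow_eq_zero (norm_nonneg u) (by linarith)).mp h.symm))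
  · have hv' : 0 < ‖v‖ := norm_pos_iff.mpr hv
    have h2 := re_mul_spow_le hα u v
    have hnorm : ‖u‖ = ‖v‖ := by
      by_contra hne
      have hs : ‖u‖ / ‖v‖ - 1 ≠ 0 := fun h0 => hne (by field_simp at h0; linarith)
      have hb := one_add_mul_self_lt_rpow_one_add (s := ‖u‖ / ‖v‖ - 1)
        (by have : 0 ≤ ‖u‖ / ‖v‖ := by positivity
            linarith) hs hα
      rw [add_sub_cancel, Real.div_rpow (norm_nonneg _) hv'.le, lt_div_iff₀ (by positivity)] at hb
      have e : ‖v‖ ^ α = ‖v‖ * ‖v‖ ^ (α - 1) := by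
        nth_rewrite 2 [← Real.rpow_one ‖v‖]; rw [← Real.rpow_add hv']; simp
      have e2 : (1 + α * (‖u‖ / ‖v‖ - 1)) * ‖v‖ ^ α
          = α * (‖u‖ * ‖v‖ ^ (α - 1)) - (α - 1) * ‖v‖ ^ α := by
        rw [e]; field_simp; ring
      nlinarith
    have e : spow v (α - 1) = ((‖v‖ ^ (α - 2) : ℝ) : ℂ) * (starRingEnd ℂ) v := by
      rw [spow]; ring_nf
    have e3 : ‖v‖ ^ α = ‖v‖ ^ (α - 2) * ‖v‖ ^ 2 := by
      rw [← Real.rpow_natCast, ← Real.rpow_add hv']; simp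
    rw [hnorm, e, mul_left_comm, Complex.re_ofReal_mul, e3] at h
    have hp : 0 < ‖v‖ ^ (α - 2) := by positivity
    have h5 : (u * (starRingEnd ℂ) v).re = ‖v‖ ^ 2 := by
      have : α * ‖v‖ ^ (α - 2) ≠ 0 := by positivity
      apply mul_left_cancel₀ this; linarith
    have h6 : ‖u - v‖ ^ 2 = 0 := by
      rw [← Complex.normSq_eq_norm_sq, Complex.normSq_sub, h5, Complex.normSq_eq_norm_sq,
        Complex.normSq_eq_norm_sq, hnorm]; ring
    exact sub_eq_zero.mp (norm_eq_zero.mp (pow_eq_zero_iff (two_ne_zero) |>.mp h6))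

/-- Uniform convexity of `|·|^α` on `ℂ`, in a form that integrates. -/
lemma exists_norm_sub_rpow_le {α : ℝ} (hα : 1 < α) {δ : ℝ} (hδ : 0 < δ) :
    ∃ K : ℝ, 0 ≤ K ∧ ∀ a b : ℂ, ‖a - b‖ ^ α ≤
      K * ((‖a‖ ^ α + ‖b‖ ^ α) / 2 - ‖(a + b) / 2‖ ^ α) + δ * (‖a‖ ^ α + ‖b‖ ^ α) := by
  have hα0 : 0 < α := by linarith
  set gap : ℂ × ℂ → ℝ := fun p => (‖p.1‖ ^ α + ‖p.2‖ ^ α) / 2 - ‖(p.1 + p.2) / 2‖ ^ α with hgap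
  have hcn : ∀ g : ℂ × ℂ → ℂ, Continuous g → Continuous fun p => ‖g p‖ ^ α := fun g hg =>
    hg.norm.rpow_const fun _ => Or.inr hα0.le
  have hgc : Continuous gap :=
    (((hcn _ continuous_fst).add (hcn _ continuous_snd)).div_const 2).sub
      (hcn _ ((continuous_fst.add continuous_snd).div_const 2))
  -- Add the Bregman inequalities of $a$ and $b$ against their midpoint $m$: since $a+b=2m$, the
  -- left sides total $2\alpha|m|^\alpha$. A zero gap makes both inequalities equalities.
  have hbreg : ∀ a b : ℂ, 0 ≤ gap (a, b) ∧ (gap (a, b) = 0 → a = b) := by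
    intro a b
    set m := (a + b) / 2 with hm
    have h1 := alpha_mul_re_le hα a m
    have h2 := alpha_mul_re_le hα b m
    have h3 : (a * spow m (α - 1)).re + (b * spow m (α - 1)).re = 2 * ‖m‖ ^ α := by
      rw [← Complex.add_re, ← add_mul, show a + b = 2 * m by rw [hm]; ring, mul_assoc,
        mul_spow_self hα]
      simp [-Complex.ofReal_ofNat, Complex.ofReal_re]
    have h3' : α * (a * spow m (α - 1)).re + α * (b * spow m (α - 1)).re = α * (2 * ‖m‖ ^ α) := by
      rw [← mul_add, h3]
    refine ⟨by simp only [hgap, ← hm]; linarith, fun h => ?_⟩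
    simp only [hgap, ← hm] at h
    have ha := eq_of_alpha_mul_re_eq hα (u := a) (v := m) (by linarith)
    have hb := eq_of_alpha_mul_re_eq hα (u := b) (v := m) (by linarith)
    rw [ha, hb]
  -- By homogeneity only normalized pairs matter, and only those for which the $\delta$ term alone
  -- does not suffice. On this compact set the gap has a positive minimum `g` and $|a-b|^\alpha\le
  -- 2^\alpha$, whence the constant $2^\alpha/g$.
  set S : Set (ℂ × ℂ) := {p | ‖p.1‖ ^ α + ‖p.2‖ ^ α = 1 ∧ δ ≤ ‖p.1 - p.2‖ ^ α} with hS
  have hScl : IsClosed S :=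
    (isClosed_eq ((hcn _ continuous_fst).add (hcn _ continuous_snd)) continuous_const).inter
      (isClosed_le continuous_const (hcn _ (continuous_fst.sub continuous_snd)))
  have hScomp : IsCompact S := by
    refine Metric.isCompact_of_isClosed_isBounded hScl
      ((Metric.isBounded_closedBall (x := (0 : ℂ × ℂ)) (r := 1)).subset ?_)
    rintro ⟨a, b⟩ ⟨h1, -⟩
    have ha : 0 ≤ ‖a‖ ^ α := by positivity
    have hb : 0 ≤ ‖b‖ ^ α := by positivity
    simp only at h1
    rw [mem_closedBall_zero_iff, Prod.norm_def, max_le_iff]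
    constructor
    · by_contra! hc
      have := Real.one_lt_rpow hc hα0
      simp only at this; linarith
    · by_contra! hc
      have := Real.one_lt_rpow hc hα0
      simp only at this; linarith
  -- a positive lower bound of the gap on the compact set
  obtain ⟨g, hg, hgS⟩ : ∃ g : ℝ, 0 < g ∧ ∀ p ∈ S, g ≤ gap p := by
    rcases S.eq_empty_or_nonempty with he | hne
    · exact ⟨1, one_pos, by simp [he]⟩
    · obtain ⟨p, hp, hmin⟩ := hScomp.exists_isMinOn hne hgc.continuousOn
      refine ⟨gap p, lt_of_le_of_ne (hbreg p.1 p.2).1 fun h0 => ?_, fun q hq => hmin hq⟩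
      have := (hbreg p.1 p.2).2 h0.symm
      have h2 := hp.2
      rw [this, sub_self, norm_zero, Real.zero_rpow hα0.ne'] at h2
      linarith
  have hbound : ∀ p ∈ S, ‖p.1 - p.2‖ ^ α ≤ 2 ^ α := by
    rintro ⟨a, b⟩ ⟨h1, -⟩
    refine Real.rpow_le_rpow (norm_nonneg _) ?_ hα0.le
    have ha : 0 ≤ ‖a‖ ^ α := by positivity
    have hb : 0 ≤ ‖b‖ ^ α := by positivity
    simp only at h1
    have ha1 : ‖a‖ ≤ 1 := by
      by_contra! hc
      have := Real.one_lt_rpow hc hα0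
      linarith
    have hb1 : ‖b‖ ≤ 1 := by
      by_contra! hc
      have := Real.one_lt_rpow hc hα0
      linarith
    exact (norm_sub_le _ _).trans (by linarith)
  refine ⟨2 ^ α / g, by positivity, fun a b => ?_⟩
  set r : ℝ := ‖a‖ ^ α + ‖b‖ ^ α with hr
  have hr0 : 0 ≤ r := by positivity
  rcases hr0.eq_or_lt with h0 | hrpos
  · have ha : ‖a‖ ^ α = 0 := by
      have : 0 ≤ ‖a‖ ^ α := by positivity
      have : 0 ≤ ‖b‖ ^ α := by positivity
      linarith
    have hb : ‖b‖ ^ α = 0 := by linarith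
    have ha' := norm_eq_zero.mp ((Real.rpow_eq_zero (norm_nonneg _) hα0.ne').mp ha)
    have hb' := norm_eq_zero.mp ((Real.rpow_eq_zero (norm_nonneg _) hα0.ne').mp hb)
    simp [hr, ha', hb', Real.zero_rpow hα0.ne']
  · by_cases hc : ‖a - b‖ ^ α ≤ δ * r
    · have := mul_nonneg (by positivity : 0 ≤ 2 ^ α / g) (hbreg a b).1
      simp only [hgap] at this
      linarith
    · push Not at hc
      -- rescale to the compact set
      set s : ℝ := r ^ (-1 / α) with hs
      have hs0 : 0 < s := by positivity
      have hsα : s ^ α = r⁻¹ := by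
        rw [hs, ← Real.rpow_mul hr0, div_mul_cancel₀ _ hα0.ne', Real.rpow_neg_one]
      have hsc : ∀ z : ℂ, ‖(s : ℂ) * z‖ ^ α = r⁻¹ * ‖z‖ ^ α := fun z => by
        rw [norm_mul, Complex.norm_real, Real.norm_of_nonneg hs0.le,
          Real.mul_rpow hs0.le (norm_nonneg _), hsα]
      have hmem : ((s : ℂ) * a, (s : ℂ) * b) ∈ S := by
        refine ⟨?_, ?_⟩
        · simp only [hsc, ← mul_add, ← hr]; exact inv_mul_cancel₀ hrpos.ne'
        · simp only [← mul_sub, hsc]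
          rw [← div_eq_inv_mul, le_div_iff₀ hrpos]; exact hc.le
      have h1 := hgS _ hmem
      have h2 := hbound _ hmem
      have h3 : gap ((s : ℂ) * a, (s : ℂ) * b) = r⁻¹ * gap (a, b) := by
        simp only [hgap, ← mul_add, mul_div_assoc, hsc]
        ring
      simp only [← mul_sub, hsc] at h2
      rw [h3] at h1
      have h4 : 2 ^ α ≤ 2 ^ α / g * (r⁻¹ * gap (a, b)) := by
        rw [div_mul_eq_mul_div, le_div_iff₀ hg]
        exact mul_le_mul_of_nonneg_left h1 (by positivity)
      have h5 : r⁻¹ * ‖a - b‖ ^ α ≤ r⁻¹ * (2 ^ α / g * gap (a, b)) := by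
        refine (h2.trans h4).trans_eq (by ring)
      have h6 := le_of_mul_le_mul_left h5 (by positivity)
      have h7 : 0 ≤ δ * r := by positivity
      simp only [hgap] at h6
      linarith

end StableInterp
end

noncomputable section

namespace StableInterp

variable {T : ℕ}

/-! ### Matrices whose form `u ⬝ F v^{<α-1>}` is an `ℓ^α` form in suitable coordinates -/

/-- The form `(u, v) ↦ uᵀ F v^{<α-1>}`. -/
def form (α : ℝ) (F : Matrix (Fin T) (Fin T) ℂ) (u v : Fin T → ℂ) : ℂ :=
  u ⬝ᵥ (F *ᵥ vpow v (α - 1))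

/-- The `α`-th power `Re (vᵀ F v^{<α-1>})` of the norm of a vector. -/
def modular (α : ℝ) (F : Matrix (Fin T) (Fin T) ℂ) (v : Fin T → ℂ) : ℝ := (form α F v v).re

/-- The real number `Tr F^{-1/(α-1)}`. -/
def traceInv (α : ℝ) (F : Matrix (Fin T) (Fin T) ℂ) : ℝ :=
  (cfc (fun x : ℝ => x ^ (-1 / (α - 1))) F).trace.re

/-- In the coordinates `W v`, the form of `F` is the covariation form of `ℓ^α`; the inverse `V` of
`W` is controlled by `Tr F^{-1/(α-1)}`. -/
def IsAlphaForm (α : ℝ) (F : Matrix (Fin T) (Fin T) ℂ) : Prop :=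
  ∃ W V : Matrix (Fin T) (Fin T) ℂ, V * W = 1 ∧
    (∀ v, F *ᵥ vpow v (α - 1) = Wᵀ *ᵥ vpow (W *ᵥ v) (α - 1)) ∧
    ∑ l, ∑ k, ‖V l k‖ ^ (α / (α - 1)) ≤ traceInv α F

lemma form_eq_sum {α : ℝ} {F W : Matrix (Fin T) (Fin T) ℂ}
    (h : ∀ v, F *ᵥ vpow v (α - 1) = Wᵀ *ᵥ vpow (W *ᵥ v) (α - 1)) (u v : Fin T → ℂ) :
    form α F u v = ∑ k, (W *ᵥ u) k * spow ((W *ᵥ v) k) (α - 1) := by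
  rw [form, h, Matrix.mulVec_transpose, dotProduct_comm, ← Matrix.dotProduct_mulVec,
    dotProduct_comm]
  rfl

lemma form_self_eq {α : ℝ} (hα : 1 < α) {F W : Matrix (Fin T) (Fin T) ℂ}
    (h : ∀ v, F *ᵥ vpow v (α - 1) = Wᵀ *ᵥ vpow (W *ᵥ v) (α - 1)) (v : Fin T → ℂ) :
    form α F v v = ((∑ k, ‖(W *ᵥ v) k‖ ^ α : ℝ) : ℂ) := by
  rw [form_eq_sum h, Complex.ofReal_sum]
  exact Finset.sum_congr rfl fun k _ => mul_spow_self hα _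

lemma modular_eq {α : ℝ} (hα : 1 < α) {F W : Matrix (Fin T) (Fin T) ℂ}
    (h : ∀ v, F *ᵥ vpow v (α - 1) = Wᵀ *ᵥ vpow (W *ᵥ v) (α - 1)) (v : Fin T → ℂ) :
    modular α F v = ∑ k, ‖(W *ᵥ v) k‖ ^ α := by
  rw [modular, form_self_eq hα h, Complex.ofReal_re]

lemma mulVec_injective {W V : Matrix (Fin T) (Fin T) ℂ} (h : V * W = 1) {u v : Fin T → ℂ}
    (huv : ∀ k, (W *ᵥ u) k = (W *ᵥ v) k) : u = v := by
  have := congrArg (V *ᵥ ·) (funext huv)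
  simpa [Matrix.mulVec_mulVec, h] using this

/-! ### Minkowski, Young and Bregman inequalities for a single matrix. -/

namespace IsAlphaForm

variable {α : ℝ} {F : Matrix (Fin T) (Fin T) ℂ}

lemma form_self (hF : IsAlphaForm α F) (hα : 1 < α) (v : Fin T → ℂ) :
    form α F v v = (modular α F v : ℂ) := by
  obtain ⟨W, V, -, h, -⟩ := hF
  rw [form_self_eq hα h, modular_eq hα h]

lemma modular_nonneg (hF : IsAlphaForm α F) (hα : 1 < α) (v : Fin T → ℂ) : 0 ≤ modular α F v := by
  obtain ⟨W, V, -, h, -⟩ := hF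
  rw [modular_eq hα h]; positivity

lemma traceInv_nonneg (hF : IsAlphaForm α F) : 0 ≤ traceInv α F := by
  obtain ⟨W, V, -, -, h⟩ := hF
  exact le_trans (by positivity) h

lemma modular_smul (hF : IsAlphaForm α F) (hα : 1 < α) (c : ℂ) (v : Fin T → ℂ) :
    modular α F (c • v) = ‖c‖ ^ α * modular α F v := by
  obtain ⟨W, V, -, h, -⟩ := hF
  rw [modular_eq hα h, modular_eq hα h, Finset.mul_sum]
  refine Finset.sum_congr rfl fun k _ => ?_
  rw [Matrix.mulVec_smul, Pi.smul_apply, smul_eq_mul, norm_mul,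
    Real.mul_rpow (norm_nonneg _) (norm_nonneg _)]

lemma modular_add_rpow_le (hF : IsAlphaForm α F) (hα : 1 < α) (u v : Fin T → ℂ) :
    modular α F (u + v) ^ (1 / α) ≤ modular α F u ^ (1 / α) + modular α F v ^ (1 / α) := by
  obtain ⟨W, V, -, h, -⟩ := hF
  rw [modular_eq hα h, modular_eq hα h, modular_eq hα h]
  have h1 := Real.Lp_add_le (Finset.univ : Finset (Fin T)) (fun k => ‖(W *ᵥ u) k‖)
    (fun k => ‖(W *ᵥ v) k‖) hα.le
  simp only [abs_norm] at h1
  refine le_trans (Real.rpow_le_rpow (by positivity) (Finset.sum_le_sum fun k _ => ?_)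
    (by positivity)) h1
  rw [abs_of_nonneg (by positivity), Matrix.mulVec_add, Pi.add_apply]
  exact Real.rpow_le_rpow (norm_nonneg _) (norm_add_le _ _) (by linarith)

/-- In each coordinate $xy^{\alpha-1}\le\max(x,y)^\alpha$. This crude bound is what makes the form
of two elements of $L^\alpha(f)$ integrable. -/
lemma norm_form_le (hF : IsAlphaForm α F) (hα : 1 < α) (u v : Fin T → ℂ) :
    ‖form α F u v‖ ≤ modular α F u + modular α F v := by
  obtain ⟨W, V, -, h, -⟩ := hF
  rw [modular_eq hα h, modular_eq hα h, form_eq_sum h, ← Finset.sum_add_distrib]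
  refine norm_sum_le_of_le _ fun k _ => ?_
  rw [norm_mul, norm_spow (by linarith)]
  generalize ‖(W *ᵥ u) k‖ = x, (norm_nonneg ((W *ᵥ u) k)) = hx
  generalize ‖(W *ᵥ v) k‖ = y, (norm_nonneg ((W *ᵥ v) k)) = hy
  have key : ∀ z : ℝ, 0 ≤ z → z * z ^ (α - 1) = z ^ α := fun z hz => by
    rcases hz.eq_or_lt with rfl | hz
    · simp [Real.zero_rpow (by linarith : α ≠ 0)]
    · nth_rewrite 1 [← Real.rpow_one z]; rw [← Real.rpow_add hz]; simp
  have hx' : 0 ≤ x ^ α := Real.rpow_nonneg hx _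
  have hy' : 0 ≤ y ^ α := Real.rpow_nonneg hy _
  rcases le_total x y with hxy | hxy
  · have := mul_le_mul_of_nonneg_right hxy (Real.rpow_nonneg hy (α - 1))
    rw [key y hy] at this; linarith
  · have := mul_le_mul_of_nonneg_left (Real.rpow_le_rpow hy hxy (by linarith : 0 ≤ α - 1)) hx
    rw [key x hx] at this; linarith

lemma alpha_mul_re_form_le (hF : IsAlphaForm α F) (hα : 1 < α) (u v : Fin T → ℂ) :
    α * (form α F u v).re ≤ modular α F u + (α - 1) * modular α F v := by
  obtain ⟨W, V, -, h, -⟩ := hF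
  rw [modular_eq hα h, modular_eq hα h, form_eq_sum h, Complex.re_sum, Finset.mul_sum,
    Finset.mul_sum, ← Finset.sum_add_distrib]
  exact Finset.sum_le_sum fun k _ => alpha_mul_re_le hα _ _

lemma eq_of_alpha_mul_re_form_eq (hF : IsAlphaForm α F) (hα : 1 < α) {u v : Fin T → ℂ}
    (huv : α * (form α F u v).re = modular α F u + (α - 1) * modular α F v) : u = v := by
  obtain ⟨W, V, hV, h, -⟩ := hF
  rw [modular_eq hα h, modular_eq hα h, form_eq_sum h, Complex.re_sum, Finset.mul_sum,
    Finset.mul_sum, ← Finset.sum_add_distrib] at huv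
  have := (Finset.sum_eq_sum_iff_of_le fun k _ => alpha_mul_re_le hα ((W *ᵥ u) k) ((W *ᵥ v) k)).mp
    huv
  exact mulVec_injective hV fun k => eq_of_alpha_mul_re_eq hα (this k (Finset.mem_univ k))

/-- Young's inequality with conjugate exponents $\alpha/(\alpha-1)$ and $\alpha$, applied to
$v=V(Wv)$. This is where $\operatorname{Tr}F^{-1/(\alpha-1)}$ enters; after integration it embeds
$L^\alpha(f)$ into $L^1$. -/
lemma norm_apply_le (hF : IsAlphaForm α F) (hα : 1 < α) {ε : ℝ} (hε : 0 < ε) (v : Fin T → ℂ)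
    (l : Fin T) : ‖v l‖ ≤ ε * traceInv α F + ε ^ (1 - α) * modular α F v := by
  have key : ∀ w : Fin T → ℂ, ‖w l‖ ≤ traceInv α F + modular α F w := by
    intro w
    obtain ⟨W, V, hV, h, htr⟩ := hF
    rw [modular_eq hα h]
    have hpq : (α / (α - 1)).HolderConjugate α := by
      refine Real.HolderConjugate.symm ?_
      rw [Real.holderConjugate_iff]; refine ⟨hα, ?_⟩
      field_simp [(by linarith : α - 1 ≠ 0)]; ring
    have hw : w l = ∑ k, V l k * (W *ᵥ w) k := by
      have : w = V *ᵥ (W *ᵥ w) := by rw [Matrix.mulVec_mulVec, hV, Matrix.one_mulVec]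
      exact congrFun this l
    have h1 : ‖w l‖ ≤ ∑ k, (‖V l k‖ ^ (α / (α - 1)) + ‖(W *ᵥ w) k‖ ^ α) := by
      rw [hw]
      refine norm_sum_le_of_le _ fun k _ => ?_
      rw [norm_mul]
      refine (Real.young_inequality_of_nonneg (norm_nonneg _) (norm_nonneg _) hpq).trans ?_
      exact add_le_add (div_le_self (by positivity) hpq.lt.le) (div_le_self (by positivity) hα.le)
    rw [Finset.sum_add_distrib] at h1
    have h2 : ∑ k, ‖V l k‖ ^ (α / (α - 1)) ≤ ∑ l, ∑ k, ‖V l k‖ ^ (α / (α - 1)) :=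
      Finset.single_le_sum (f := fun l => ∑ k, ‖V l k‖ ^ (α / (α - 1)))
        (fun l _ => by positivity) (Finset.mem_univ l)
    linarith
  -- Rescaling $v$ by $\varepsilon^{-1}$ makes the coefficient of the trace arbitrarily small, at
  -- the price of $\varepsilon^{1-\alpha}$ on the norm term.
  have h1 := key (((ε⁻¹ : ℝ) : ℂ) • v)
  rw [hF.modular_smul hα, Pi.smul_apply, smul_eq_mul, norm_mul, Complex.norm_real,
    Real.norm_of_nonneg (by positivity)] at h1
  have h2 := mul_le_mul_of_nonneg_left h1 hε.le
  rw [mul_inv_cancel_left₀ hε.ne', mul_add, ← mul_assoc ε (ε⁻¹ ^ α)] at h2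
  have h3 : ε * ε⁻¹ ^ α = ε ^ (1 - α) := by
    rw [Real.inv_rpow hε.le, Real.rpow_sub hε, Real.rpow_one, div_eq_mul_inv]
  rwa [h3] at h2

end IsAlphaForm

/-- Uniform convexity of the norms of matrices `F`, uniformly in `F`. -/
lemma exists_modular_sub_le {α : ℝ} (hα : 1 < α) {δ : ℝ} (hδ : 0 < δ) :
    ∃ K : ℝ, 0 ≤ K ∧ ∀ (F : Matrix (Fin T) (Fin T) ℂ), IsAlphaForm α F → ∀ a b : Fin T → ℂ,
      modular α F (a - b) + K * modular α F ((1 / 2 : ℂ) • (a + b)) ≤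
        (K / 2 + δ) * (modular α F a + modular α F b) := by
  obtain ⟨K, hK, h⟩ := exists_norm_sub_rpow_le hα hδ
  refine ⟨K, hK, fun F hF a b => ?_⟩
  obtain ⟨W, V, -, hW, -⟩ := hF
  rw [modular_eq hα hW, modular_eq hα hW, modular_eq hα hW, modular_eq hα hW, Finset.mul_sum,
    ← Finset.sum_add_distrib, ← Finset.sum_add_distrib, Finset.mul_sum]
  refine Finset.sum_le_sum fun k _ => ?_
  have := h ((W *ᵥ a) k) ((W *ᵥ b) k)
  rw [Matrix.mulVec_sub, Matrix.mulVec_smul, Matrix.mulVec_add, Pi.sub_apply, Pi.smul_apply,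
    Pi.add_apply, smul_eq_mul, show (1 / 2 : ℂ) * ((W *ᵥ a) k + (W *ᵥ b) k)
      = ((W *ᵥ a) k + (W *ᵥ b) k) / 2 by ring]
  linarith

/-! ### Positive definite matrices -/

lemma trace_cfc_eq {F : Matrix (Fin T) (Fin T) ℂ} (hF : F.IsHermitian) (g : ℝ → ℝ) :
    (cfc g F).trace = ∑ i, (g (hF.eigenvalues i) : ℂ) := by
  rw [hF.cfc_eq, Matrix.IsHermitian.cfc, Unitary.conjStarAlgAut_apply, Matrix.trace_mul_cycle,
    Unitary.coe_star_mul_self, one_mul, Matrix.trace_diagonal]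
  rfl

/-- For $\alpha=2$ the signed power is conjugation. If $F=B^*B$, the choice $W=\overline B$ works,
and $\operatorname{Tr}F^{-1}$ is the sum of the $|(B^{-1})_{lk}|^2$. -/
lemma isAlphaForm_two {F : Matrix (Fin T) (Fin T) ℂ} (hF : F.PosDef) : IsAlphaForm 2 F := by
  obtain ⟨B, hB⟩ : ∃ B : Matrix (Fin T) (Fin T) ℂ, F = Bᴴ * B := by
    open scoped MatrixOrder Matrix.Norms.L2Operator in
    exact CStarAlgebra.nonneg_iff_eq_star_mul_self.mp hF.posSemidef.nonneg
  have hdet : IsUnit B.det := by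
    have h := hF.isUnit
    rw [Matrix.isUnit_iff_isUnit_det, hB, Matrix.det_mul] at h
    exact isUnit_of_mul_isUnit_right h
  have hconj : ∀ v : Fin T → ℂ, vpow v (2 - 1) = star v := fun v => by
    ext k; simp [vpow, spow]; norm_num
  refine ⟨B.map star, B⁻¹.map star, ?_, fun v => ?_, ?_⟩
  · have : (B⁻¹ * B).map (starRingEnd ℂ) = (1 : Matrix (Fin T) (Fin T) ℂ).map (starRingEnd ℂ) := by
      rw [Matrix.nonsing_inv_mul B hdet]
    rw [Matrix.map_mul] at this
    simpa using this
  · rw [hconj, hconj]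
    have h1 : star (B.map star *ᵥ v) = B *ᵥ star v := by
      ext i; simp [Matrix.mulVec, dotProduct]
    rw [h1, hB, ← Matrix.mulVec_mulVec]; rfl
  · have h2 : traceInv 2 F = (F⁻¹).trace.re := by
      have hu : IsUnit F := hF.isUnit
      have : cfc (fun x : ℝ => x ^ (-1 / ((2 : ℝ) - 1))) F = F⁻¹ := by
        have e : (fun x : ℝ => x ^ (-1 / ((2 : ℝ) - 1))) = fun x => x⁻¹ := by
          ext x; norm_num [Real.rpow_neg_one]
        rw [e]
        have := cfc_inv_id (R := ℝ) hu.unit (hF.isHermitian.isSelfAdjoint)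
        rw [IsUnit.unit_spec] at this
        rw [this, Matrix.coe_units_inv, IsUnit.unit_spec]
      rw [traceInv, this]
    rw [h2, hB, Matrix.mul_inv_rev, ← Matrix.conjTranspose_nonsing_inv, Matrix.trace,
      Complex.re_sum]
    refine le_of_eq (Finset.sum_congr rfl fun l _ => ?_)
    rw [Matrix.diag_apply, Matrix.mul_apply, Complex.re_sum]
    refine Finset.sum_congr rfl fun k _ => ?_
    rw [Matrix.conjTranspose_apply, Complex.star_def, Complex.mul_conj, Complex.ofReal_re,
      Complex.normSq_eq_norm_sq]
    norm_num

/-- With diagonal entries $d_k$, take $W=\operatorname{diag}(d_k^{1/\alpha})$ and $V=W^{-1}$; then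
$|V_{kk}|^{\alpha/(\alpha-1)}=d_k^{-1/(\alpha-1)}$, so the trace bound is an equality. -/
lemma isAlphaForm_of_diagonal {α : ℝ} (hα : 1 < α) {F : Matrix (Fin T) (Fin T) ℂ} (hF : F.PosDef)
    (hd : ∀ k l, k ≠ l → F k l = 0) : IsAlphaForm α F := by
  obtain ⟨d, hd⟩ : ∃ d : Fin T → ℝ, F = Matrix.diagonal fun k => (d k : ℂ) := by
    refine ⟨fun k => (F k k).re, ?_⟩
    ext k l
    by_cases h : k = l
    · subst h
      rw [Matrix.diagonal_apply_eq]
      have := (hF.diag_pos (i := k)).le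
      rw [Complex.le_def] at this
      exact Complex.ext (by simp) (by simpa using this.2.symm)
    · rw [Matrix.diagonal_apply_ne _ h, hd k l h]
  have hpos : ∀ k, 0 < d k := fun k => by
    have := hF.diag_pos (i := k)
    rw [hd, Matrix.diagonal_apply_eq] at this
    exact_mod_cast this
  -- The eigenvalues come in an order unrelated to the diagonal, so they are compared with it as
  -- multisets of roots of the characteristic polynomial.
  have htr : traceInv α F = ∑ k, d k ^ (-1 / (α - 1)) := by
    have hH := hF.isHermitian
    have h1 := hH.roots_charpoly_eq_eigenvalues
    have h2 : F.charpoly.roots = Finset.univ.val.map fun k => (d k : ℂ) := by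
      rw [hd, Matrix.charpoly_diagonal, Finset.prod_eq_multiset_prod]
      have := Polynomial.roots_multiset_prod_X_sub_C (Finset.univ.val.map fun k => (d k : ℂ))
      rwa [Multiset.map_map] at this
    rw [h2] at h1
    have h3 := congrArg (fun s => (Multiset.map (fun z : ℂ => z.re ^ (-1 / (α - 1))) s).sum) h1
    simp only [Multiset.map_map, Function.comp_def] at h3
    rw [traceInv, trace_cfc_eq hH, Complex.re_sum]
    simp only [Complex.ofReal_re]
    simpa [Finset.sum] using h3.symm
  have hα0 : 0 < α := by linarith
  refine ⟨Matrix.diagonal fun k => ((d k ^ (1 / α) : ℝ) : ℂ),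
    Matrix.diagonal fun k => ((d k ^ (-(1 / α)) : ℝ) : ℂ), ?_, fun v => ?_, ?_⟩
  · rw [Matrix.diagonal_mul_diagonal, ← Matrix.diagonal_one]
    congr 1; ext k
    rw [← Complex.ofReal_mul, ← Real.rpow_add (hpos k)]; simp
  · ext k
    rw [hd, Matrix.diagonal_transpose, Matrix.mulVec_diagonal, Matrix.mulVec_diagonal, vpow, vpow,
      Matrix.mulVec_diagonal, spow_real_mul (Real.rpow_pos_of_pos (hpos k) _), ← mul_assoc,
      ← Complex.ofReal_mul, ← Real.rpow_mul (hpos k).le, ← Real.rpow_add (hpos k)]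
    congr 2
    rw [show 1 / α + 1 / α * (α - 1) = 1 by field_simp; ring, Real.rpow_one]
  · rw [htr]
    refine le_of_eq (Finset.sum_congr rfl fun l _ => ?_)
    rw [Finset.sum_eq_single l]
    · rw [Matrix.diagonal_apply_eq, Complex.norm_real, Real.norm_of_nonneg
        (Real.rpow_nonneg (hpos l).le _), ← Real.rpow_mul (hpos l).le]
      congr 1
      field_simp [(by linarith : α - 1 ≠ 0)]
    · intro k _ hk
      rw [Matrix.diagonal_apply_ne _ hk.symm, norm_zero, Real.zero_rpow]
      exact (div_pos hα0 (by linarith)).ne'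
    · simp

end StableInterp
end

noncomputable section

namespace StableInterp

variable {Ω : Type*} [MeasurableSpace Ω]

open scoped RealInnerProductSpace

/-! ### Normalization of spectral measures to the unit sphere -/

/-- The polar projection of a measure to the unit sphere, weighted so that integrals of
`α`-homogeneous functions are preserved. -/
lemma exists_sphere_measure {S E : Type*} [MeasurableSpace S] [NormedAddCommGroup E]
    [NormedSpace ℝ E] [MeasurableSpace E] [BorelSpace E] [SecondCountableTopology E]
    {α : ℝ} (hα : 0 < α) {Γ : Measure S} {g : S → E} (hg : Measurable g)
    (hint : Integrable (fun s => ‖g s‖ ^ α) Γ) :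
    ∃ ν : Measure (Metric.sphere (0 : E) 1), IsFiniteMeasure ν ∧
      ∀ F : E → ℝ, Measurable F → (∀ (r : ℝ) x, 0 ≤ r → F (r • x) = r ^ α * F x) →
        ∫ x, F x ∂ν = ∫ s, F (g s) ∂Γ := by
  set w : S → NNReal := fun s => Real.toNNReal (‖g s‖ ^ α) with hw
  have hwm : Measurable w := (hg.norm.pow_const α).real_toNNReal
  set u : S → E := fun s => ‖g s‖⁻¹ • g s with hu
  have hum : Measurable u := hg.norm.inv.smul hg
  set ν' : Measure E := (Γ.withDensity fun s => (w s : ℝ≥0∞)).map u with hν'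
  have hfin : IsFiniteMeasure (Γ.withDensity fun s => (w s : ℝ≥0∞)) := by
    refine isFiniteMeasure_withDensity ?_
    have := hint.lintegral_lt_top
    exact this.ne
  have hfin' : IsFiniteMeasure ν' := Measure.isFiniteMeasure_map _ _
  -- Where $g=0$ the normalized map takes the value $0$, off the sphere, but the density
  -- $\|g\|^\alpha$ vanishes there.
  have hsph : ∀ᵐ x ∂ν', x ∈ Metric.sphere (0 : E) 1 := by
    have hms : MeasurableSet {x : E | x ∈ Metric.sphere (0 : E) 1} :=
      Metric.isClosed_sphere.measurableSet
    rw [hν', ae_map_iff hum.aemeasurable hms, ae_withDensity_iff hwm.coe_nnreal_ennreal]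
    refine Eventually.of_forall fun s hs => ?_
    have : ‖g s‖ ≠ 0 := fun h => hs (by simp [hw, h, Real.zero_rpow hα.ne'])
    simp [hu, norm_smul, this]
  refine ⟨ν'.comap Subtype.val, ?_, fun F hF hhom => ?_⟩
  · refine ⟨?_⟩
    rw [comap_subtype_coe_apply Metric.isClosed_sphere.measurableSet]
    exact measure_lt_top _ _
  · rw [integral_subtype_comap Metric.isClosed_sphere.measurableSet F,
      Measure.restrict_eq_self_of_ae_mem hsph, hν', integral_map hum.aemeasurable
      hF.aestronglyMeasurable, integral_withDensity_eq_integral_smul hwm]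
    refine integral_congr_ae (Eventually.of_forall fun s => ?_)
    simp only [hu, hhom _ _ (inv_nonneg.mpr (norm_nonneg (g s))), hw, NNReal.smul_def, smul_eq_mul]
    rw [Real.coe_toNNReal _ (by positivity)]
    rcases eq_or_ne (g s) 0 with h0 | h0
    · have := hhom 0 0 le_rfl
      rw [Real.zero_rpow hα.ne', smul_zero, zero_mul] at this
      simp [h0, this]
    · have : 0 < ‖g s‖ := norm_pos_iff.mpr h0
      rw [← mul_assoc, ← Real.mul_rpow this.le (by positivity), mul_inv_cancel₀ this.ne',
        Real.one_rpow, one_mul]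

/-! ### Scale of a complex symmetric stable random variable -/

/-- `X` is complex symmetric `α`-stable and its spectral measure on the unit circle has total mass
`M` (which is `‖X‖_α^α`). -/
structure HasScale (α : ℝ) (P : Measure Ω) (X : Ω → ℂ) (M : ℝ) : Prop where
  aemeasurable : AEMeasurable X P
  exists_measure : ∃ Γ : Measure (Metric.sphere (0 : ℂ) 1), IsFiniteMeasure Γ ∧
    Γ.real Set.univ = M ∧
    ∀ t : ℂ, charFun (P.map X) t
      = Complex.exp (-((∫ z : Metric.sphere (0 : ℂ) 1, |⟪(z : ℂ), t⟫| ^ α ∂Γ : ℝ) : ℂ))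

lemma continuous_abs_inner_rpow {α : ℝ} (hα : 0 < α) :
    Continuous fun p : ℂ × ℂ => |⟪p.1, p.2⟫| ^ α :=
  (continuous_inner (𝕜 := ℝ)).abs.rpow_const fun _ => Or.inr hα.le

lemma abs_inner_rpow_homogeneous {E : Type*} [NormedAddCommGroup E] [InnerProductSpace ℝ E]
    {α : ℝ} (t : E) (r : ℝ) (x : E) (hr : 0 ≤ r) :
    |⟪r • x, t⟫| ^ α = r ^ α * |⟪x, t⟫| ^ α := by
  rw [real_inner_smul_left, abs_mul, abs_of_nonneg hr, Real.mul_rpow hr (abs_nonneg _)]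

lemma norm_rpow_homogeneous {E : Type*} [NormedAddCommGroup E] [NormedSpace ℝ E]
    {α : ℝ} (r : ℝ) (x : E) (hr : 0 ≤ r) : ‖r • x‖ ^ α = r ^ α * ‖x‖ ^ α := by
  rw [norm_smul, Real.norm_of_nonneg hr, Real.mul_rpow hr (norm_nonneg _)]

/-- The exponent of the characteristic function may be represented over any measure space: the
integrands are $\alpha$-homogeneous in $g$, so the polar projection moves everything to the unit
circle. -/
lemma HasScale.of_measure {α : ℝ} (hα : 0 < α) {P : Measure Ω} {X : Ω → ℂ} (hX : AEMeasurable X P)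
    {S : Type*} [MeasurableSpace S] {Γ : Measure S} {g : S → ℂ} (hg : Measurable g)
    (hint : Integrable (fun s => ‖g s‖ ^ α) Γ)
    (h : ∀ t : ℂ, charFun (P.map X) t
      = Complex.exp (-((∫ s, |⟪g s, t⟫| ^ α ∂Γ : ℝ) : ℂ))) :
    HasScale α P X (∫ s, ‖g s‖ ^ α ∂Γ) := by
  obtain ⟨ν, hν, hF⟩ := exists_sphere_measure hα hg hint
  refine ⟨hX, ν, hν, ?_, fun t => ?_⟩
  · have := hF (fun x => ‖x‖ ^ α) (measurable_norm.pow_const α)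
      (fun r x hr => norm_rpow_homogeneous r x hr)
    rw [← this]
    simp
  · rw [h, hF (fun x => |⟪x, t⟫| ^ α)
      ((continuous_abs_inner_rpow hα).comp (Continuous.prodMk_left t)).measurable
      (fun r x hr => abs_inner_rpow_homogeneous t r x hr)]

/-- The integral of `|cos|^α` over a period. -/
def cosConst (α : ℝ) : ℝ := ∫ φ in (0 : ℝ)..(2 * Real.pi), |Real.cos φ| ^ α

lemma cosConst_pos {α : ℝ} (hα : 0 < α) : 0 < cosConst α := by
  have hc : Continuous fun φ => |Real.cos φ| ^ α :=
    Real.continuous_cos.abs.rpow_const fun _ => Or.inr hα.le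
  refine intervalIntegral.integral_pos (by positivity) hc.continuousOn (fun x _ => by positivity)
    ⟨0, ⟨le_rfl, by positivity⟩, by simp⟩

lemma inner_exp_exp (ψ φ : ℝ) :
    ⟪Complex.exp (ψ * Complex.I), Complex.exp (φ * Complex.I)⟫ = Real.cos (φ - ψ) := by
  rw [Complex.inner, ← Complex.exp_conj, ← Complex.exp_add, map_mul, Complex.conj_ofReal,
    Complex.conj_I, show (φ : ℂ) * Complex.I + ψ * -Complex.I = ((φ - ψ : ℝ) : ℂ) * Complex.I by
      push_cast; ring, Complex.exp_ofReal_mul_I_re]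

/-- Rotation invariance: writing $z=e^{i\psi}$ only shifts $|\cos|^\alpha$ within its period. -/
lemma integral_abs_inner_circle {α : ℝ} (z : Metric.sphere (0 : ℂ) 1) :
    ∫ φ in (0 : ℝ)..(2 * Real.pi), |⟪(z : ℂ), Complex.exp (φ * Complex.I)⟫| ^ α = cosConst α := by
  obtain ⟨ψ, hψ⟩ : ∃ ψ : ℝ, (z : ℂ) = Complex.exp (ψ * Complex.I) := by
    refine ⟨(z : ℂ).arg, ?_⟩
    have := Complex.norm_mul_exp_arg_mul_I (z : ℂ)
    rw [norm_eq_of_mem_sphere z] at this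
    simpa using this.symm
  simp_rw [hψ, inner_exp_exp]
  rw [intervalIntegral.integral_comp_sub_right (fun φ => |Real.cos φ| ^ α)]
  have hp : Function.Periodic (fun φ => |Real.cos φ| ^ α) (2 * Real.pi) := fun x => by
    simp [Real.cos_add_two_pi]
  have := hp.intervalIntegral_add_eq (0 - ψ) 0
  rw [cosConst, show 2 * Real.pi - ψ = 0 - ψ + 2 * Real.pi by ring, this, zero_add]

/-- The total mass of a measure on the circle in terms of its `α`-cosine transform. -/
lemma integral_cosine_transform {α : ℝ} (hα : 0 < α) (Γ : Measure (Metric.sphere (0 : ℂ) 1))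
    [IsFiniteMeasure Γ] :
    ∫ φ in (0 : ℝ)..(2 * Real.pi), (∫ z : Metric.sphere (0 : ℂ) 1,
      |⟪(z : ℂ), Complex.exp (φ * Complex.I)⟫| ^ α ∂Γ) = cosConst α * Γ.real Set.univ := by
  rw [intervalIntegral.integral_of_le (by positivity), integral_integral_swap]
  · simp_rw [← intervalIntegral.integral_of_le (by positivity : (0 : ℝ) ≤ 2 * Real.pi),
      integral_abs_inner_circle]
    rw [integral_const, smul_eq_mul, mul_comm]
  · have hc : Continuous fun p : ℝ × Metric.sphere (0 : ℂ) 1 =>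
        |⟪(p.2 : ℂ), Complex.exp (p.1 * Complex.I)⟫| ^ α :=
      (continuous_abs_inner_rpow hα).comp ((continuous_subtype_val.comp continuous_snd).prodMk
        (by fun_prop))
    refine Integrable.of_bound (C := 1) hc.aestronglyMeasurable (Eventually.of_forall fun p => ?_)
    rw [Function.uncurry, Real.norm_of_nonneg (by positivity)]
    refine Real.rpow_le_one (abs_nonneg _) ?_ hα.le
    refine (abs_real_inner_le_norm _ _).trans ?_
    rw [norm_eq_of_mem_sphere, Complex.norm_exp_ofReal_mul_I, one_mul]

lemma integrable_abs_inner {α : ℝ} (hα : 0 < α) (Γ : Measure (Metric.sphere (0 : ℂ) 1))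
    [IsFiniteMeasure Γ] (t : ℂ) :
    Integrable (fun z : Metric.sphere (0 : ℂ) 1 => |⟪(z : ℂ), t⟫| ^ α) Γ := by
  have hc : Continuous fun z : Metric.sphere (0 : ℂ) 1 => |⟪(z : ℂ), t⟫| ^ α :=
    (continuous_abs_inner_rpow hα).comp (continuous_subtype_val.prodMk continuous_const)
  refine Integrable.of_bound (C := ‖t‖ ^ α) hc.aestronglyMeasurable
    (Eventually.of_forall fun p => ?_)
  rw [Real.norm_of_nonneg (by positivity)]
  refine Real.rpow_le_rpow (abs_nonneg _) ?_ hα.le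
  refine (abs_real_inner_le_norm _ _).trans ?_
  rw [norm_eq_of_mem_sphere, one_mul]

/-! ### Uniqueness and additivity of the scale. -/

namespace HasScale

variable {α : ℝ} {P : Measure Ω} {X Y : Ω → ℂ} {M M' : ℝ}

lemma nonneg (h : HasScale α P X M) : 0 ≤ M := by
  obtain ⟨Γ, _, rfl, -⟩ := h.exists_measure
  exact measureReal_nonneg

/-- The law determines the cosine transform of the spectral measure, and its integral over the
circle is a positive multiple of the total mass. The spectral measure itself need not be unique, so
only its mass is compared. -/
lemma unique (h : HasScale α P X M) (hα : 0 < α) (h' : HasScale α P X M') : M = M' := by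
  obtain ⟨Γ, _, rfl, hΓ⟩ := h.exists_measure
  obtain ⟨Γ', _, rfl, hΓ'⟩ := h'.exists_measure
  have h1 := integral_cosine_transform hα Γ
  have h2 := integral_cosine_transform hα Γ'
  have h3 : ∀ t : ℂ, ∫ z : Metric.sphere (0 : ℂ) 1, |⟪(z : ℂ), t⟫| ^ α ∂Γ
      = ∫ z : Metric.sphere (0 : ℂ) 1, |⟪(z : ℂ), t⟫| ^ α ∂Γ' := by
    intro t
    have := (hΓ t).symm.trans (hΓ' t)
    rw [← Complex.ofReal_neg, ← Complex.ofReal_neg, ← Complex.ofReal_exp,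
      ← Complex.ofReal_exp] at this
    have := Real.exp_injective (Complex.ofReal_injective this)
    linarith
  simp_rw [h3] at h1
  exact mul_left_cancel₀ (cosConst_pos hα).ne' (h1.symm.trans h2)

lemma congr (h : HasScale α P X M) (hXY : X =ᵐ[P] Y) : HasScale α P Y M := by
  obtain ⟨Γ, h1, h2, hΓ⟩ := h.exists_measure
  exact ⟨h.aemeasurable.congr hXY, Γ, h1, h2, by rwa [← Measure.map_congr hXY]⟩

lemma sum {ι : Type*} [Fintype ι] [IsProbabilityMeasure P] (hα : 0 < α) {X : ι → Ω → ℂ} {M : ι → ℝ}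
    (h : ∀ i, HasScale α P (X i) (M i)) (hind : iIndepFun X P) :
    HasScale α P (fun ω => ∑ i, X i ω) (∑ i, M i) := by
  choose Γ hfin hM hΓ using fun i => (h i).exists_measure
  refine ⟨Finset.aemeasurable_fun_sum _ fun i _ => (h i).aemeasurable,
    ∑ i, Γ i, inferInstance, ?_, fun t => ?_⟩
  · rw [Measure.real, Measure.finsetSum_apply, ENNReal.toReal_sum (fun i _ => measure_ne_top _ _)]
    exact Finset.sum_congr rfl fun i _ => hM i
  · rw [hind.charFun_map_fun_sum_eq_prod fun i => (h i).aemeasurable, Finset.prod_apply,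
      integral_finsetSum_measure fun i _ => integrable_abs_inner hα (Γ i) t]
    simp_rw [hΓ, ← Complex.exp_sum, Complex.ofReal_sum, Finset.sum_neg_distrib]

end HasScale

end StableInterp
end

noncomputable section

namespace StableInterp

variable {Ω : Type*} [MeasurableSpace Ω]

open scoped RealInnerProductSpace

/-! ### Scales, spectral measures and covariations -/

lemma charFun_map_eq {P : Measure Ω} {X : Ω → ℂ} (hX : AEMeasurable X P) (t : ℂ) :
    charFun (P.map X) t = ∫ ω, Complex.exp (⟪X ω, t⟫ * Complex.I) ∂P := by
  rw [charFun_apply, integral_map hX]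
  fun_prop

/-- Complex linear combinations of a real vector with a spectral measure. -/
lemma IsSpectralMeasure.hasScale {α : ℝ} (hα : 0 < α) {P : Measure Ω} {ι : Type*} [Fintype ι]
    {X : ι → Ω → ℝ} {Γ : Measure (EuclideanSpace ℝ ι)} (hX : ∀ k, AEMeasurable (X k) P)
    (hΓ : IsSpectralMeasure α P X Γ) (c : ι → ℂ) :
    HasScale α P (fun ω => ∑ k, (X k ω : ℂ) * c k) (∫ x, ‖∑ k, (x k : ℂ) * c k‖ ^ α ∂Γ) := by
  have := hΓ.finite
  have hY : AEMeasurable (fun ω => ∑ k, (X k ω : ℂ) * c k) P :=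
    Finset.aemeasurable_fun_sum _ fun k _ => (Complex.measurable_ofReal.comp_aemeasurable
      (hX k)).mul_const _
  have hinner : ∀ (y : ι → ℝ) (t : ℂ), ⟪∑ k, (y k : ℂ) * c k, t⟫ = ∑ k, ⟪c k, t⟫ * y k := by
    intro y t
    rw [sum_inner]
    refine Finset.sum_congr rfl fun k _ => ?_
    rw [← Complex.real_smul, real_inner_smul_left, mul_comm]
  have hg : Continuous fun x : EuclideanSpace ℝ ι => ∑ k, (x k : ℂ) * c k := by fun_prop
  refine HasScale.of_measure hα hY hg.measurable ?_ fun t => ?_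
  · refine Integrable.of_bound (C := (∑ k, ‖c k‖) ^ α)
      (hg.norm.rpow_const fun _ => Or.inr hα.le).aestronglyMeasurable ?_
    filter_upwards [mem_ae_iff.mpr hΓ.sphere] with x hx
    rw [Real.norm_of_nonneg (by positivity)]
    refine Real.rpow_le_rpow (norm_nonneg _) (norm_sum_le_of_le _ fun k _ => ?_) hα.le
    rw [norm_mul, Complex.norm_real]
    refine mul_le_of_le_one_left (norm_nonneg _) ((PiLp.norm_apply_le x k).trans ?_)
    rw [mem_sphere_zero_iff_norm.mp hx]
  · rw [charFun_map_eq hY]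
    simp_rw [hinner]
    rw [← hΓ.charFun]
    refine integral_congr_ae (Eventually.of_forall fun ω => ?_)
    simp only
    rw [mul_comm]

/-- Real linear images of a complex stable variable have a spectral measure. -/
lemma HasScale.exists_isSpectralMeasure {α : ℝ} (hα : 0 < α) {P : Measure Ω} {X : Ω → ℂ} {M : ℝ}
    (h : HasScale α P X M) {ι : Type*} [Fintype ι] (c : ι → ℂ) :
    ∃ Γ, IsSpectralMeasure α P (fun k ω => ⟪X ω, c k⟫) Γ := by
  obtain ⟨Γ, _, -, hΓ⟩ := h.exists_measure
  set g : Metric.sphere (0 : ℂ) 1 → EuclideanSpace ℝ ι := fun z =>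
    WithLp.toLp 2 fun k => ⟪(z : ℂ), c k⟫ with hg
  have hgc : Continuous g := by
    refine (PiLp.continuous_toLp 2 _).comp (continuous_pi fun k => ?_)
    exact continuous_subtype_val.inner continuous_const
  obtain ⟨ν, hν, hF⟩ := exists_sphere_measure (Γ := Γ) hα hgc.measurable
    (by
      have : Continuous fun z => ‖g z‖ ^ α := hgc.norm.rpow_const fun _ => Or.inr hα.le
      exact this.integrable_of_hasCompactSupport (HasCompactSupport.of_compactSpace _))
  set ν1 := ν.map Subtype.val with hν1
  have hfin1 : IsFiniteMeasure ν1 := Measure.isFiniteMeasure_map _ _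
  have hsph1 : ν1 (Metric.sphere 0 1)ᶜ = 0 := by
    rw [hν1, Measure.map_apply measurable_subtype_coe Metric.isClosed_sphere.measurableSet.compl]
    convert measure_empty (μ := ν)
    ext z; simp
  have hneg : Measurable fun x : EuclideanSpace ℝ ι => -x := measurable_neg
  refine ⟨(2⁻¹ : NNReal) • (ν1 + ν1.map fun x => -x), ?_, ?_, ?_, fun t => ?_⟩
  · have : IsFiniteMeasure (ν1.map fun x => -x) := Measure.isFiniteMeasure_map _ _
    infer_instance
  · rw [Measure.smul_apply, Measure.add_apply, Measure.map_apply hneg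
      Metric.isClosed_sphere.measurableSet.compl]
    have : (fun x : EuclideanSpace ℝ ι => -x) ⁻¹' (Metric.sphere 0 1)ᶜ = (Metric.sphere 0 1)ᶜ := by
      ext x; simp
    rw [this, hsph1]; simp
  · rw [Measure.map_smul, Measure.map_add _ _ hneg, Measure.map_map hneg hneg, add_comm]
    congr 2
    convert Measure.map_id
    ext x; simp
  · set t' : ℂ := ∑ k, t k • c k with ht'
    have hin : ∀ z : ℂ, ⟪z, t'⟫ = ∑ k, t k * ⟪z, c k⟫ := fun z => by
      rw [ht', inner_sum]
      exact Finset.sum_congr rfl fun k _ => real_inner_smul_right _ _ _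
    have hFc : Continuous fun x : EuclideanSpace ℝ ι => |∑ k, t k * x k| ^ α := by
      refine Continuous.rpow_const (by fun_prop) fun _ => Or.inr hα.le
    have h1 := hF (fun x => |∑ k, t k * x k| ^ α) hFc.measurable (fun r x hr => by
      simp only [PiLp.smul_apply, smul_eq_mul]
      simp_rw [mul_left_comm _ r, ← Finset.mul_sum]
      rw [abs_mul, abs_of_nonneg hr, Real.mul_rpow hr (abs_nonneg _)])
    have hint1 : ∫ x, |∑ k, t k * x k| ^ α ∂ν1 = ∫ z, |⟪(z : ℂ), t'⟫| ^ α ∂Γ := by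
      rw [hν1, integral_map measurable_subtype_coe.aemeasurable hFc.aestronglyMeasurable, h1]
      simp_rw [hin]; rfl
    have hi1 : Integrable (fun x : EuclideanSpace ℝ ι => |∑ k, t k * x k| ^ α) ν1 := by
      rw [hν1, integrable_map_measure hFc.aestronglyMeasurable measurable_subtype_coe.aemeasurable]
      exact (hFc.comp continuous_subtype_val).integrable_of_hasCompactSupport
        (HasCompactSupport.of_compactSpace _)
    have hev : ∀ x : EuclideanSpace ℝ ι, |∑ k, t k * (-x) k| ^ α = |∑ k, t k * x k| ^ α := by
      intro x; simp
    have hint2 : ∫ x, |∑ k, t k * x k| ^ α ∂(ν1.map fun x => -x) = ∫ z, |⟪(z : ℂ), t'⟫| ^ α ∂Γ := by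
      rw [integral_map hneg.aemeasurable hFc.aestronglyMeasurable]
      simp_rw [hev, hint1]
    have hi2 : Integrable (fun x : EuclideanSpace ℝ ι => |∑ k, t k * x k| ^ α)
        (ν1.map fun x => -x) := by
      rw [integrable_map_measure hFc.aestronglyMeasurable hneg.aemeasurable]
      exact hi1.congr (Eventually.of_forall fun x => (hev x).symm)
    have h3 : ∫ x, |∑ k, t k * x k| ^ α ∂((2⁻¹ : NNReal) • (ν1 + ν1.map fun x => -x))
        = ∫ z, |⟪(z : ℂ), t'⟫| ^ α ∂Γ := by
      rw [integral_smul_nnreal_measure, integral_add_measure hi1 hi2, hint1, hint2, NNReal.smul_def,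
        smul_eq_mul]
      push_cast; ring
    rw [h3, ← hΓ, charFun_map_eq h.aemeasurable]
    simp_rw [hin]
    refine integral_congr_ae (Eventually.of_forall fun ω => ?_)
    simp only
    rw [mul_comm]

lemma HasScale.isSaS {α : ℝ} (hα : 0 < α) {P : Measure Ω} {X : Ω → ℂ} {M : ℝ}
    (h : HasScale α P X M) : IsSaS α P X := by
  refine ⟨?_, ?_⟩
  · rintro (k | k)
    · exact Complex.measurable_re.comp_aemeasurable h.aemeasurable
    · exact Complex.measurable_im.comp_aemeasurable h.aemeasurable
  · obtain ⟨Γ, hΓ⟩ := h.exists_isSpectralMeasure hα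
      (Sum.elim (fun _ => 1) (fun _ => Complex.I) : Unit ⊕ Unit → ℂ)
    refine ⟨Γ, ?_⟩
    convert hΓ using 1
    ext (k | k) ω <;> simp [Complex.inner]

lemma IsSaS.exists_hasScale {α : ℝ} (hα : 0 < α) {P : Measure Ω} {X : Ω → ℂ}
    (h : IsSaS α P X) : ∃ M, HasScale α P X M := by
  obtain ⟨hm, Γ, hΓ⟩ := h
  refine ⟨_, (hΓ.hasScale hα hm (Sum.elim (fun _ => 1) (fun _ => Complex.I))).congr ?_⟩
  exact Eventually.of_forall fun ω => by simp [Complex.re_add_im]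

/-- The definition picks some spectral measure of
$(\operatorname{Re}X,\operatorname{Im}X,\operatorname{Re}X,\operatorname{Im}X)$. It must charge only
points with $y=x$, where the integrand is $|x_1+ix_2|^\alpha$; the integral is then a scale of $X$,
and scales are unique. -/
lemma HasScale.covariation_self {α : ℝ} (hα : 1 < α) {P : Measure Ω} [IsProbabilityMeasure P]
    {X : Ω → ℂ} {M : ℝ} (h : HasScale α P X M) : covariation α P X X = M := by
  have hα0 : 0 < α := by linarith
  have hJ : JointlySaS α P (realQuad X X) := by
    refine ⟨?_, ?_⟩
    · have h1 := Complex.measurable_re.comp_aemeasurable h.aemeasurable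
      have h2 := Complex.measurable_im.comp_aemeasurable h.aemeasurable
      intro k; fin_cases k
      exacts [h1, h2, h1, h2]
    · obtain ⟨Γ, hΓ⟩ := h.exists_isSpectralMeasure hα0 ![1, Complex.I, 1, Complex.I]
      refine ⟨Γ, ?_⟩
      convert hΓ using 1
      ext k ω
      fin_cases k <;> simp [Complex.inner, realQuad]
  rw [covariation, dif_pos hJ]
  generalize_proofs hex
  have hΓ := Classical.choose_spec hex
  set Γ := Classical.choose hex
  have := hΓ.finite
  have h1 := (hΓ.hasScale hα0 hJ.1 ![1, Complex.I, 0, 0]).congr (Y := X)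
    (Eventually.of_forall fun ω => by
      simp [Fin.sum_univ_four, realQuad, Complex.re_add_im])
  have h2 := h.unique hα0 h1
  -- A linear relation between the coordinates passes to the spectral measure: the characteristic
  -- function at $t$ is $1$, so $\int|\langle t,x\rangle|^\alpha\,d\Gamma=0$.
  have hzero : ∀ t : Fin 4 → ℝ, (∀ ω, ∑ k, t k * realQuad X X k ω = 0) →
      ∀ᵐ x ∂Γ, ∑ k, t k * x k = 0 := by
    intro t ht
    have h3 := hΓ.charFun t
    simp only [ht, Complex.ofReal_zero, mul_zero, Complex.exp_zero, integral_const,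
      probReal_univ, one_smul] at h3
    have h4 : ∫ x, |∑ k, t k * x k| ^ α ∂Γ = 0 := by
      rw [← Complex.ofReal_neg, ← Complex.ofReal_exp, ← Complex.ofReal_one] at h3
      have := Complex.ofReal_injective h3
      simpa using this.symm
    have hc : Continuous fun x : EuclideanSpace ℝ (Fin 4) => |∑ k, t k * x k| ^ α :=
      Continuous.rpow_const (by fun_prop) fun _ => Or.inr hα0.le
    rw [integral_eq_zero_iff_of_nonneg (fun x => by positivity)] at h4
    · filter_upwards [h4] with x hx
      exact abs_eq_zero.mp (((Real.rpow_eq_zero (abs_nonneg _) hα0.ne').mp hx))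
    · refine Integrable.of_bound (C := (∑ k, |t k|) ^ α) hc.aestronglyMeasurable ?_
      filter_upwards [mem_ae_iff.mpr hΓ.sphere] with x hx
      rw [Real.norm_of_nonneg (by positivity)]
      refine Real.rpow_le_rpow (abs_nonneg _) ((Finset.abs_sum_le_sum_abs _ _).trans
        (Finset.sum_le_sum fun k _ => ?_)) hα0.le
      rw [abs_mul]
      refine mul_le_of_le_one_right (abs_nonneg _) ((PiLp.norm_apply_le x k).trans ?_)
      rw [mem_sphere_zero_iff_norm.mp hx]
  have e1 := hzero ![1, 0, -1, 0] fun ω => by simp [Fin.sum_univ_four, realQuad]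
  have e2 := hzero ![0, 1, 0, -1] fun ω => by simp [Fin.sum_univ_four, realQuad]
  rw [h2, ← integral_complex_ofReal]
  refine integral_congr_ae ?_
  filter_upwards [e1, e2] with x h1 h2
  simp only [Fin.sum_univ_four, Matrix.cons_val] at h1 h2
  have h1' : x 2 = x 0 := by linarith
  have h2' : x 3 = x 1 := by linarith
  rw [h1', h2', mul_spow_self hα]
  congr 3
  simp [Fin.sum_univ_four, Complex.ext_iff]

lemma HasScale.saNorm_eq {α : ℝ} (hα : 1 < α) {P : Measure Ω} [IsProbabilityMeasure P]
    {X : Ω → ℂ} {M : ℝ} (h : HasScale α P X M) : saNorm α P X = M ^ (1 / α) := by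
  rw [saNorm, h.covariation_self hα, Complex.ofReal_re]

lemma HasScale.saNorm_rpow {α : ℝ} (hα : 1 < α) {P : Measure Ω} [IsProbabilityMeasure P]
    {X : Ω → ℂ} {M : ℝ} (h : HasScale α P X M) : saNorm α P X ^ α = M := by
  rw [h.saNorm_eq hα, ← Real.rpow_mul h.nonneg, one_div_mul_cancel (by linarith), Real.rpow_one]

end StableInterp
end

noncomputable section

namespace StableInterp

variable {Ω : Type*} [MeasurableSpace Ω]

open scoped RealInnerProductSpace

/-! ### Scale and convergence in probability -/

lemma HasScale.charFun_eq_exp {α : ℝ} (hα : 0 < α) {P : Measure Ω} {X : Ω → ℂ} {M : ℝ}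
    (h : HasScale α P X M) : ∃ N : ℂ → ℝ, (∀ t, charFun (P.map X) t = Complex.exp (-(N t : ℂ))) ∧
      (∀ t, 0 ≤ N t) ∧ (∀ t, N t ≤ ‖t‖ ^ α * M) ∧
      ∫ φ in (0 : ℝ)..(2 * Real.pi), N (Complex.exp (φ * Complex.I)) = cosConst α * M := by
  obtain ⟨Γ, _, rfl, hΓ⟩ := h.exists_measure
  refine ⟨_, hΓ, fun t => integral_nonneg fun z => by positivity, fun t => ?_,
    integral_cosine_transform hα Γ⟩
  have := integral_mono (integrable_abs_inner hα Γ t) (integrable_const (‖t‖ ^ α)) fun z => by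
    refine Real.rpow_le_rpow (abs_nonneg _) ((abs_real_inner_le_norm _ _).trans ?_) hα.le
    rw [norm_eq_of_mem_sphere, one_mul]
  rwa [integral_const, smul_eq_mul, mul_comm] at this

/-- A variable of small scale is small in probability. -/
lemma exists_scale_le_measure_le {α : ℝ} (hα : 0 < α) {P : Measure Ω} [IsProbabilityMeasure P]
    {ε : ℝ} (hε : 0 < ε) : ∃ δ > 0, ∀ (X : Ω → ℂ) (M : ℝ), HasScale α P X M → M ≤ δ →
      P.real {ω | ε ≤ ‖X ω‖} ≤ ε := by
  set r : ℝ := ε / 4 with hr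
  have hr0 : 0 < r := by positivity
  -- Each of the real and imaginary parts exceeds $r$ with probability at most $2(2/r)^\alpha M$, by
  -- the truncation inequality for characteristic functions; the two bounds add up to $CM$.
  set C : ℝ := 4 * (2 * r⁻¹) ^ α with hC
  have hC0 : 0 < C := by positivity
  refine ⟨ε / C, by positivity, fun X M h hM => ?_⟩
  obtain ⟨N, hN, hN0, hN1, -⟩ := h.charFun_eq_exp hα
  have hprob : IsProbabilityMeasure (P.map X) := Measure.isProbabilityMeasure_map h.aemeasurable
  have key : ∀ a : ℂ, ‖a‖ = 1 → (P.map X).real {x | r < |⟪a, x⟫|} ≤ 2 * (2 * r⁻¹) ^ α * M := by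
    intro a ha
    refine (measureReal_abs_inner_gt_le_integral_charFun hr0).trans ?_
    have hb : ‖∫ t in -2 * r⁻¹..2 * r⁻¹, 1 - charFun (P.map X) (t • a)‖
        ≤ ((2 * r⁻¹) ^ α * M) * |2 * r⁻¹ - -2 * r⁻¹| := by
      refine intervalIntegral.norm_integral_le_of_norm_le_const fun t ht => ?_
      have ht' : |t| ≤ 2 * r⁻¹ := by
        rw [Set.uIoc_of_le (by have : 0 < r⁻¹ := by positivity
                               linarith)] at ht
        rw [abs_le]; constructor <;> linarith [ht.1, ht.2]
      rw [hN, ← Complex.ofReal_neg, ← Complex.ofReal_exp, ← Complex.ofReal_one,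
        ← Complex.ofReal_sub, Complex.norm_real, Real.norm_of_nonneg
        (by have := Real.exp_le_one_iff.mpr (neg_nonpos.mpr (hN0 (t • a))); linarith)]
      have h1 := Real.add_one_le_exp (-N (t • a))
      have h2 := hN1 (t • a)
      rw [norm_smul, ha, mul_one, Real.norm_eq_abs] at h2
      have h3 : |t| ^ α * M ≤ (2 * r⁻¹) ^ α * M :=
        mul_le_mul_of_nonneg_right (Real.rpow_le_rpow (abs_nonneg _) ht' hα.le) h.nonneg
      linarith
    refine (mul_le_mul_of_nonneg_left hb (by positivity)).trans_eq ?_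
    rw [show 2 * r⁻¹ - -2 * r⁻¹ = 4 * r⁻¹ by ring, abs_of_pos (by positivity)]
    field_simp
    ring
  have hsub : {ω | ε ≤ ‖X ω‖} ⊆ X ⁻¹' ({x | r < |⟪(1 : ℂ), x⟫|} ∪ {x | r < |⟪Complex.I, x⟫|}) := by
    intro ω hω
    by_contra hc
    simp only [Set.mem_preimage, Set.mem_union, Set.mem_ofPred_eq, not_or, not_lt] at hc
    have h1 := Complex.norm_le_abs_re_add_abs_im (X ω)
    simp [Complex.inner] at hc
    have hω' : ε ≤ ‖X ω‖ := hω
    linarith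
  have hms : ∀ a : ℂ, MeasurableSet {x : ℂ | r < |⟪a, x⟫|} := fun a =>
    measurableSet_lt measurable_const (by fun_prop)
  have h1 : P.real {ω | ε ≤ ‖X ω‖} ≤ (P.map X).real {x | r < |⟪(1 : ℂ), x⟫|}
      + (P.map X).real {x | r < |⟪Complex.I, x⟫|} := by
    refine (measureReal_mono hsub).trans ?_
    rw [← map_measureReal_apply_of_aemeasurable h.aemeasurable ((hms _).union (hms _))]
    exact measureReal_union_le _ _
  have h2 := key 1 (by simp)
  have h3 := key Complex.I (by simp)
  have h4 : C * M ≤ ε := by rwa [le_div_iff₀ hC0, mul_comm] at hM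
  rw [hC] at h4
  linarith

/-- A stable variable that is small in probability has small scale. -/
lemma exists_measure_le_scale_le {α : ℝ} (hα : 0 < α) {P : Measure Ω} [IsProbabilityMeasure P]
    {ε : ℝ} (hε : 0 < ε) : ∃ δ > 0, ∀ (X : Ω → ℂ) (M : ℝ), HasScale α P X M →
      P.real {ω | δ ≤ ‖X ω‖} ≤ δ → M ≤ ε := by
  have hK := cosConst_pos hα
  -- On $|t|=1$ the characteristic function differs from $1$ by at most $\delta+2\delta$. For
  -- $\delta\le 1/6$ one has $(1-3\delta)(1+6\delta)\ge1$, so the exponent is at most $6\delta$;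
  -- integrating over the circle gives `cosConst α * M` at most $12\pi\delta$.
  set δ : ℝ := min (1 / 6) (ε * cosConst α / (12 * Real.pi)) with hδ
  have hδ0 : 0 < δ := by rw [hδ]; have := Real.pi_pos; positivity
  have hδ1 : δ ≤ 1 / 6 := min_le_left _ _
  have hδ2 : δ * (12 * Real.pi) ≤ ε * cosConst α := by
    rw [← le_div_iff₀ (by positivity)]; exact min_le_right _ _
  refine ⟨δ, hδ0, fun X M h hX => ?_⟩
  obtain ⟨N, hN, hN0, -, hN2⟩ := h.charFun_eq_exp hα
  have hchar : ∀ t : ℂ, ‖t‖ = 1 → ‖1 - charFun (P.map X) t‖ ≤ 3 * δ := by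
    intro t ht
    rw [charFun_map_eq h.aemeasurable]
    have hexp : AEStronglyMeasurable (fun ω => Complex.exp (⟪X ω, t⟫ * Complex.I)) P := by
      have := h.aemeasurable
      exact AEMeasurable.aestronglyMeasurable (by fun_prop)
    have hint : Integrable (fun ω => Complex.exp (⟪X ω, t⟫ * Complex.I)) P :=
      Integrable.of_bound hexp 1 (Eventually.of_forall fun ω => by
        rw [Complex.norm_exp_ofReal_mul_I])
    have h1 : (1 : ℂ) - ∫ ω, Complex.exp (⟪X ω, t⟫ * Complex.I) ∂P
        = ∫ ω, (1 - Complex.exp (⟪X ω, t⟫ * Complex.I)) ∂P := by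
      rw [integral_sub (integrable_const _) hint]; simp
    have hnm : NullMeasurableSet {ω | δ ≤ ‖X ω‖} P :=
      nullMeasurableSet_le aemeasurable_const h.aemeasurable.norm
    rw [h1]
    have h2 : ∀ ω, ‖1 - Complex.exp (⟪X ω, t⟫ * Complex.I)‖
        ≤ δ + {ω | δ ≤ ‖X ω‖}.indicator (fun _ => 2) ω := by
      intro ω
      by_cases hω : δ ≤ ‖X ω‖
      · rw [Set.indicator_of_mem (by exact hω)]
        have := norm_sub_le (1 : ℂ) (Complex.exp (⟪X ω, t⟫ * Complex.I))
        rw [Complex.norm_exp_ofReal_mul_I, norm_one] at this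
        linarith
      · rw [Set.indicator_of_notMem (by exact hω), add_zero, norm_sub_rev, mul_comm]
        refine (Real.norm_exp_I_mul_ofReal_sub_one_le).trans ?_
        rw [Real.norm_eq_abs]
        refine (abs_real_inner_le_norm _ _).trans ?_
        rw [ht, mul_one]; exact (not_le.mp hω).le
    refine (norm_integral_le_of_norm_le (g := fun ω => δ + {ω | δ ≤ ‖X ω‖}.indicator (fun _ => 2) ω)
      ((integrable_const _).add ((integrable_const (2 : ℝ)).indicator₀ hnm))
      (Eventually.of_forall h2)).trans ?_
    rw [integral_add (integrable_const _) ((integrable_const (2 : ℝ)).indicator₀ hnm),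
      integral_indicator₀ hnm]
    simp only [integral_const, probReal_univ, smul_eq_mul, one_mul, measureReal_restrict_apply_univ]
    linarith
  have hNle : ∀ t : ℂ, ‖t‖ = 1 → N t ≤ 6 * δ := by
    intro t ht
    have h1 := hchar t ht
    rw [hN, ← Complex.ofReal_neg, ← Complex.ofReal_exp, ← Complex.ofReal_one,
      ← Complex.ofReal_sub, Complex.norm_real] at h1
    have h2 := (le_abs_self _).trans h1
    by_contra! hc
    have h3 : Real.exp (-N t) < Real.exp (-(6 * δ)) := Real.exp_lt_exp.mpr (by linarith)
    have h4 : Real.exp (-(6 * δ)) ≤ 1 - 3 * δ := by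
      rw [Real.exp_neg, inv_le_comm₀ (Real.exp_pos _) (by linarith)]
      have := Real.add_one_le_exp (6 * δ)
      refine le_trans ?_ this
      rw [inv_le_iff_one_le_mul₀ (by linarith)]
      nlinarith
    linarith
  have hb : ‖∫ φ in (0 : ℝ)..(2 * Real.pi), N (Complex.exp (φ * Complex.I))‖
      ≤ 6 * δ * |2 * Real.pi - 0| :=
    intervalIntegral.norm_integral_le_of_norm_le_const fun φ _ => by
      rw [Real.norm_of_nonneg (hN0 _)]
      exact hNle _ (Complex.norm_exp_ofReal_mul_I φ)
  rw [hN2, sub_zero, abs_of_pos (by positivity)] at hb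
  have hb' := (le_abs_self _).trans hb
  have : cosConst α * M ≤ cosConst α * ε := by linarith
  exact le_of_mul_le_mul_left this hK

lemma HasScale.ae_eq_zero {α : ℝ} (hα : 0 < α) {P : Measure Ω} [IsProbabilityMeasure P]
    {X : Ω → ℂ} (h : HasScale α P X 0) : X =ᵐ[P] 0 := by
  obtain ⟨N, hN, hN0, hN1, -⟩ := h.charFun_eq_exp hα
  have hprob : IsProbabilityMeasure (P.map X) := Measure.isProbabilityMeasure_map h.aemeasurable
  have : P.map X = Measure.dirac 0 := by
    refine Measure.ext_of_charFun ?_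
    ext t
    have h0 : N t = 0 := le_antisymm (by simpa using hN1 t) (hN0 t)
    rw [hN, h0, charFun_dirac]
    simp
  have h1 : ∀ᵐ x ∂(P.map X), x = 0 := by
    rw [this, ae_dirac_eq]; simp
  exact ae_of_ae_map h.aemeasurable h1

/-- A sequence whose differences to `Y` have scales tending to zero tends to `Y` in probability. -/
lemma tendstoInMeasure_of_hasScale {α : ℝ} (hα : 0 < α) {P : Measure Ω} [IsProbabilityMeasure P]
    {X : ℕ → Ω → ℂ} {Y : Ω → ℂ} {M : ℕ → ℝ} (h : ∀ n, HasScale α P (X n - Y) (M n))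
    (hM : Tendsto M atTop (𝓝 0)) : TendstoInMeasure P X atTop Y := by
  rw [tendstoInMeasure_iff_measureReal_norm]
  intro ε hε
  rw [Metric.tendsto_atTop]
  intro η hη
  obtain ⟨δ, hδ, hd⟩ := exists_scale_le_measure_le (P := P) hα
    (lt_min hε (half_pos hη))
  obtain ⟨n0, hn0⟩ := (hM.eventually_le_const hδ).exists_forall_of_atTop
  refine ⟨n0, fun n hn => ?_⟩
  have h1 := hd _ _ (h n) (hn0 n hn)
  have h2 : P.real {ω | ε ≤ ‖X n ω - Y ω‖} ≤ P.real {ω | min ε (η / 2) ≤ ‖(X n - Y) ω‖} :=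
    measureReal_mono fun ω hω => by
      rw [Set.mem_ofPred_eq] at hω ⊢
      exact (min_le_left _ _).trans hω
  rw [Real.dist_eq, sub_zero, abs_of_nonneg measureReal_nonneg]
  have := min_le_right ε (η / 2)
  linarith

/-- A limit in probability of stable variables whose scales converge is stable. -/
lemma HasScale.of_tendstoInMeasure {α : ℝ} (hα : 0 < α) {P : Measure Ω} [IsProbabilityMeasure P]
    {X : ℕ → Ω → ℂ} {Y : Ω → ℂ} {M : ℕ → ℝ} {m : ℝ} (h : ∀ n, HasScale α P (X n) (M n))
    (hM : Tendsto M atTop (𝓝 m)) (hX : TendstoInMeasure P X atTop Y) : HasScale α P Y m := by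
  have hY : AEMeasurable Y P := hX.aemeasurable fun n => (h n).aemeasurable
  obtain ⟨ns, hns, hae⟩ := hX.exists_seq_tendsto_ae
  have hchar : ∀ t : ℂ, Tendsto (fun k => charFun (P.map (X (ns k))) t) atTop
      (𝓝 (charFun (P.map Y) t)) := by
    intro t
    simp_rw [charFun_map_eq (h _).aemeasurable, charFun_map_eq hY]
    refine tendsto_integral_of_dominated_convergence (fun _ => 1) (fun k => ?_)
      (integrable_const _) (fun k => Eventually.of_forall fun ω => ?_) ?_
    · have := (h (ns k)).aemeasurable
      exact AEMeasurable.aestronglyMeasurable (by fun_prop)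
    · rw [Complex.norm_exp_ofReal_mul_I]
    · filter_upwards [hae] with ω hω
      have hc : Continuous fun x : ℂ => Complex.exp (⟪x, t⟫ * Complex.I) := by fun_prop
      exact (hc.tendsto _).comp hω
  choose Γ hfin hMΓ hΓ using fun n => (h n).exists_measure
  -- Splitting off the mass leaves probability measures on a compact circle, which have a limit
  -- along an ultrafilter. A zero measure cannot be normalized; an arbitrary point mass serves
  -- because its weight is $0$.
  have hπ : ∀ n, ∃ π : ProbabilityMeasure (Metric.sphere (0 : ℂ) 1),
      ∀ g : Metric.sphere (0 : ℂ) 1 → ℝ, ∫ z, g z ∂(Γ n) = M n * ∫ z, g z ∂(π : Measure _) := by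
    intro n
    have := hfin n
    by_cases h0 : Γ n = 0
    · refine ⟨⟨Measure.dirac ⟨1, by simp⟩, inferInstance⟩, fun g => ?_⟩
      have hM0 : M n = 0 := by rw [← hMΓ n, h0]; simp
      rw [h0, hM0]; simp
    · have hne : NeZero (Γ n) := ⟨h0⟩
      refine ⟨⟨((Γ n) Set.univ)⁻¹ • Γ n, inferInstance⟩, fun g => ?_⟩
      have hpos : M n ≠ 0 := by
        rw [← hMΓ n]
        simpa [Measure.real, ENNReal.toReal_eq_zero_iff] using h0
      simp only [ProbabilityMeasure.coe_mk]
      rw [integral_smul_measure, ENNReal.toReal_inv, smul_eq_mul, ← mul_assoc]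
      change _ = M n * ((Γ n).real Set.univ)⁻¹ * _
      rw [hMΓ n, mul_inv_cancel₀ hpos, one_mul]
  choose π hπ using hπ
  set U : Ultrafilter ℕ := Ultrafilter.of atTop with hU
  have hUle : (U : Filter ℕ) ≤ atTop := Ultrafilter.of_le _
  obtain ⟨π0, -, hπ0⟩ := isCompact_univ.ultrafilter_le_nhds (U.map fun k => π (ns k)) (by simp)
  have hconv : Tendsto (fun k => π (ns k)) U (𝓝 π0) := hπ0
  rw [ProbabilityMeasure.tendsto_iff_forall_integral_tendsto] at hconv
  have hMU : Tendsto (fun k => M (ns k)) U (𝓝 m) := (hM.comp hns.tendsto_atTop).mono_left hUle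
  have hm : 0 ≤ m := ge_of_tendsto' hM fun n => (h n).nonneg
  refine ⟨hY, m.toNNReal • (π0 : Measure _), inferInstance, ?_, fun t => ?_⟩
  · rw [measureReal_nnreal_smul_apply]; simp [hm]
  · have hc : Continuous fun z : Metric.sphere (0 : ℂ) 1 => |⟪(z : ℂ), t⟫| ^ α :=
      (continuous_abs_inner_rpow hα).comp (continuous_subtype_val.prodMk continuous_const)
    have h1 := hconv (BoundedContinuousFunction.mkOfCompact ⟨_, hc⟩)
    simp only [BoundedContinuousFunction.mkOfCompact_apply, ContinuousMap.coe_mk] at h1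
    have h2 : Tendsto (fun k => charFun (P.map (X (ns k))) t) U (𝓝 (Complex.exp
        (-((m * ∫ z, |⟪(z : ℂ), t⟫| ^ α ∂(π0 : Measure (Metric.sphere (0 : ℂ) 1)) : ℝ) : ℂ)))) := by
      simp_rw [hΓ, hπ]
      exact (Complex.continuous_exp.tendsto _).comp
        ((Complex.continuous_ofReal.tendsto _).comp (hMU.mul h1)).neg
    rw [tendsto_nhds_unique ((hchar t).mono_left hUle) h2, integral_smul_nnreal_measure,
      NNReal.smul_def, Real.coe_toNNReal _ hm, smul_eq_mul]

/-- A sequence that is Cauchy in probability has a subsequence that converges in probability. -/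
lemma exists_subseq_tendstoInMeasure {P : Measure Ω} [IsProbabilityMeasure P] {X : ℕ → Ω → ℂ}
    (hX : ∀ n, AEMeasurable (X n) P)
    (hC : ∀ ε > 0, ∃ n0, ∀ m ≥ n0, ∀ n ≥ n0, P.real {ω | ε ≤ ‖X m ω - X n ω‖} ≤ ε) :
    ∃ (ns : ℕ → ℕ) (Y : Ω → ℂ), StrictMono ns ∧ TendstoInMeasure P (fun k => X (ns k)) atTop Y := by
  -- Riesz's argument: along this subsequence the increments exceed $2^{-k}$ with probability at
  -- most $2^{-k}$, so Borel–Cantelli gives almost sure convergence.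
  obtain ⟨ns, hns, hP⟩ := Filter.extraction_forall_of_eventually'
    (P := fun k n => ∀ m ≥ n, P.real {ω | (1 / 2 : ℝ) ^ k ≤ ‖X m ω - X n ω‖} ≤ (1 / 2 : ℝ) ^ k)
    (fun k => by
      obtain ⟨n0, h⟩ := hC ((1 / 2 : ℝ) ^ k) (by positivity)
      exact ⟨n0, fun n hn m hm => h m (le_trans hn hm) n hn⟩)
  have hsum : ∑' k, P {ω | (1 / 2 : ℝ) ^ k ≤ ‖X (ns (k + 1)) ω - X (ns k) ω‖} ≠ ∞ := by
    have h1 : ∀ k, P {ω | (1 / 2 : ℝ) ^ k ≤ ‖X (ns (k + 1)) ω - X (ns k) ω‖}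
        ≤ ENNReal.ofReal ((1 / 2 : ℝ) ^ k) := fun k => by
      rw [← ofReal_measureReal]
      exact ENNReal.ofReal_le_ofReal (hP k _ (hns (Nat.lt_succ_self k)).le)
    refine ne_top_of_le_ne_top ?_ (ENNReal.tsum_le_tsum h1)
    rw [← ENNReal.ofReal_tsum_of_nonneg (fun k => by positivity) summable_geometric_two]
    exact ENNReal.ofReal_ne_top
  have hlim : ∀ᵐ ω ∂P, ∃ y, Tendsto (fun k => X (ns k) ω) atTop (𝓝 y) := by
    filter_upwards [ae_eventually_notMem hsum] with ω hω
    refine cauchySeq_tendsto_of_complete (cauchySeq_of_summable_dist ?_)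
    refine Summable.of_norm_bounded_eventually_nat summable_geometric_two ?_
    filter_upwards [hω] with k hk
    simp only [not_le] at hk
    rw [Real.norm_of_nonneg dist_nonneg, dist_comm, dist_eq_norm]
    exact hk.le
  classical
  refine ⟨ns, fun ω => if h : ∃ y, Tendsto (fun k => X (ns k) ω) atTop (𝓝 y) then h.choose else 0,
    hns, tendstoInMeasure_of_tendsto_ae (fun k => (hX _).aestronglyMeasurable) ?_⟩
  filter_upwards [hlim] with ω hω
  rw [dif_pos hω]
  exact hω.choose_spec

end StableInterp
end

noncomputable section

namespace StableInterp

variable {Ω : Type*} [MeasurableSpace Ω] {T : ℕ}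

/-! ### The spectral density is an `ℓ^α` form at almost every frequency -/

/-- The Bregman inequality is the tangent bound of a convex function at $v$, and the slope there is
at most $\alpha R^{\alpha-1}$. -/
lemma norm_rpow_sub_le {α : ℝ} (hα : 1 < α) {u v : ℂ} {R : ℝ} (hv : ‖v‖ ≤ R) :
    ‖v‖ ^ α - ‖u‖ ^ α ≤ α * (‖v - u‖ * R ^ (α - 1)) := by
  have h1 := alpha_mul_re_le hα u v
  have h2 := re_mul_spow_le hα (v - u) v
  rw [sub_mul, Complex.sub_re, mul_spow_self hα, Complex.ofReal_re] at h2
  have h3 : ‖v - u‖ * ‖v‖ ^ (α - 1) ≤ ‖v - u‖ * R ^ (α - 1) :=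
    mul_le_mul_of_nonneg_left (Real.rpow_le_rpow (norm_nonneg _) hv (by linarith)) (norm_nonneg _)
  have h4 := mul_le_mul_of_nonneg_left (h2.trans h3) (by linarith : 0 ≤ α)
  linarith

lemma abs_norm_rpow_sub_le {α : ℝ} (hα : 1 < α) {u v : ℂ} {R : ℝ} (hu : ‖u‖ ≤ R) (hv : ‖v‖ ≤ R) :
    |‖v‖ ^ α - ‖u‖ ^ α| ≤ α * (‖v - u‖ * R ^ (α - 1)) := by
  have h1 := norm_rpow_sub_le hα (u := u) hv
  have h2 := norm_rpow_sub_le hα (u := v) hu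
  rw [norm_sub_rev] at h2
  exact abs_le.mpr ⟨by linarith, h1⟩

/-- Linear combinations of the coordinates of an increment have scales given by a common measure. -/
lemma exists_measure_increment {α : ℝ} (hα : 0 < α) {P : Measure Ω} {Z : ℝ → Ω → Fin T → ℂ}
    (hZ : IsSaSFamily α P
      (fun (p : Set.Icc (-Real.pi) Real.pi × Fin T) ω => Z p.1 ω p.2))
    (s t : Set.Icc (-Real.pi) Real.pi) :
    ∃ (E : Type) (_ : MeasurableSpace E) (Γ : Measure E) (_ : IsFiniteMeasure Γ)
      (z : Fin T → E → ℂ) (C : ℝ), (∀ k, Measurable (z k)) ∧ (∀ᵐ x ∂Γ, ∀ k, ‖z k x‖ ≤ C) ∧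
      ∀ v : Fin T → ℂ, HasScale α P (fun ω => v ⬝ᵥ (Z t ω - Z s ω))
        (∫ x, ‖∑ k, v k * z k x‖ ^ α ∂Γ) := by
  classical
  set A : Finset (Set.Icc (-Real.pi) Real.pi × Fin T) := {s, t} ×ˢ Finset.univ with hA
  obtain ⟨hm, Γ, hΓ⟩ := hZ A
  -- The weights extract the increment, $+1$ at time $t$ and $-1$ at time $s$; they cancel when
  -- $s=t$.
  set w : A → ℂ := fun p => (if p.1.1 = t then 1 else 0) - (if p.1.1 = s then 1 else 0) with hw
  set d : Fin T → A ⊕ A → ℂ := fun k => Sum.elim (fun p => if p.1.2 = k then w p else 0)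
    (fun p => if p.1.2 = k then Complex.I * w p else 0) with hd
  refine ⟨EuclideanSpace ℝ (A ⊕ A), inferInstance, Γ, hΓ.finite,
    fun k x => ∑ j, (x j : ℂ) * d k j, ∑ k, ∑ j, ‖d k j‖, fun k => ?_, ?_, fun v => ?_⟩
  · have : Continuous fun x : EuclideanSpace ℝ (A ⊕ A) => ∑ j, (x j : ℂ) * d k j := by fun_prop
    exact this.measurable
  · filter_upwards [mem_ae_iff.mpr hΓ.sphere] with x hx k
    refine le_trans (norm_sum_le_of_le _ fun j _ => ?_)
      (Finset.single_le_sum (f := fun k => ∑ j, ‖d k j‖) (fun _ _ => by positivity)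
        (Finset.mem_univ k))
    rw [norm_mul, Complex.norm_real]
    refine mul_le_of_le_one_left (norm_nonneg _) ((PiLp.norm_apply_le x j).trans ?_)
    rw [mem_sphere_zero_iff_norm.mp hx]
  · have h1 := hΓ.hasScale hα hm (fun j => ∑ k, v k * d k j)
    have h2 : ∀ x : EuclideanSpace ℝ (A ⊕ A), ∑ j, (x j : ℂ) * ∑ k, v k * d k j
        = ∑ k, v k * ∑ j, (x j : ℂ) * d k j := by
      intro x
      simp_rw [Finset.mul_sum]
      rw [Finset.sum_comm]
      exact Finset.sum_congr rfl fun k _ => Finset.sum_congr rfl fun j _ => by ring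
    simp_rw [h2] at h1
    refine h1.congr (Eventually.of_forall fun ω => ?_)
    have h3 : ∀ p : A, ∑ k, v k * d k (Sum.inl p) = v p.1.2 * w p := fun p => by
      simp [hd]
    have h4 : ∀ p : A, ∑ k, v k * d k (Sum.inr p) = Complex.I * (v p.1.2 * w p) := fun p => by
      simp [hd]; ring
    simp only [Fintype.sum_sum_type, Sum.elim_inl, Sum.elim_inr, h3, h4]
    rw [← Finset.sum_add_distrib]
    have h5 : ∀ p : A, ((Z p.1.1 ω p.1.2).re : ℂ) * (v p.1.2 * w p)
        + ((Z p.1.1 ω p.1.2).im : ℂ) * (Complex.I * (v p.1.2 * w p))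
        = (fun q : Set.Icc (-Real.pi) Real.pi × Fin T => Z q.1 ω q.2 * (v q.2 *
          ((if q.1 = t then 1 else 0) - (if q.1 = s then 1 else 0)))) p := fun p => by
      simp only [hw]
      conv_rhs => rw [← Complex.re_add_im (Z p.1.1 ω p.1.2)]
      ring
    rw [Finset.sum_congr rfl fun p _ => h5 p,
      Finset.sum_coe_sort A (fun q : Set.Icc (-Real.pi) Real.pi × Fin T => Z q.1 ω q.2 * (v q.2 *
          ((if q.1 = t then 1 else 0) - (if q.1 = s then 1 else 0)))), hA, Finset.sum_product_right]
    refine Finset.sum_congr rfl fun k _ => ?_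
    simp only [mul_sub, Finset.sum_sub_distrib, mul_ite, mul_one, mul_zero, Finset.sum_ite_eq',
      Finset.mem_insert, Finset.mem_singleton, true_or, or_true, if_true, Pi.sub_apply]
    ring

/-- The matrix `∫_s^t f`. -/
def specMass (f : ℝ → Matrix (Fin T) (Fin T) ℂ) (s t : ℝ) : Matrix (Fin T) (Fin T) ℂ :=
  Matrix.of fun k l => ∫ θ in Set.Ioc s t, f θ k l

lemma HasSpectralDensity.hasScale {α : ℝ} (hα : 1 < α) {P : Measure Ω} [IsProbabilityMeasure P]
    {Z : ℝ → Ω → Fin T → ℂ} {f : ℝ → Matrix (Fin T) (Fin T) ℂ} (h : HasSpectralDensity α P Z f)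
    {s t : ℝ} (hs : -Real.pi ≤ s) (hst : s ≤ t) (ht : t ≤ Real.pi) (v : Fin T → ℂ) :
    HasScale α P (fun ω => v ⬝ᵥ (Z t ω - Z s ω)) (modular α (specMass f s t) v) := by
  obtain ⟨E, _, Γ, _, z, C, -, -, hz⟩ := exists_measure_increment (by linarith) h.stable
    ⟨s, hs, hst.trans ht⟩ ⟨t, hs.trans hst, ht⟩
  have h1 := (hz v).covariation_self hα
  have h2 := h.spectral s t hs hst ht v v
  have h3 := h2.symm.trans h1
  have : modular α (specMass f s t) v = ∫ x, ‖∑ k, v k * z k x‖ ^ α ∂Γ := by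
    rw [modular, form, specMass, h3, Complex.ofReal_re]
  rw [this]; exact hz v

/-- Test the covariation formula on $e_k+\varepsilon e_l$. As an integral of $|z_k+\varepsilon
z_l|^\alpha$ over one measure with bounded $z_k,z_l$, the result changes by $O(\varepsilon)$ from
its value at $\varepsilon=0$. The formula contains $\mu_{kl}\varepsilon^{\alpha-1}$ and otherwise
changes by $O(\varepsilon)$, so $|\mu_{kl}|=O(\varepsilon^{2-\alpha})$, which tends to $0$ since
$\alpha<2$. -/
lemma HasSpectralDensity.specMass_eq_zero {α : ℝ} (hα : 1 < α) (hα2 : α < 2) {P : Measure Ω}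
    [IsProbabilityMeasure P] {Z : ℝ → Ω → Fin T → ℂ} {f : ℝ → Matrix (Fin T) (Fin T) ℂ}
    (h : HasSpectralDensity α P Z f) {s t : ℝ} (hs : -Real.pi ≤ s) (hst : s ≤ t)
    (ht : t ≤ Real.pi) {k l : Fin T} (hkl : k ≠ l) : specMass f s t k l = 0 := by
  have hα0 : 0 < α := by linarith
  obtain ⟨E, _, Γ, _, z, C, hzm, hzC, hz⟩ := exists_measure_increment hα0 h.stable
    ⟨s, hs, hst.trans ht⟩ ⟨t, hs.trans hst, ht⟩
  set μ := specMass f s t with hμ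
  have hform : ∀ v, form α μ v v = ((∫ x, ‖∑ j, v j * z j x‖ ^ α ∂Γ : ℝ) : ℂ) := fun v =>
    (h.spectral s t hs hst ht v v).symm.trans ((hz v).covariation_self hα)
  have hCB : ∀ᵐ x ∂Γ, ‖z k x‖ ≤ |C| ∧ ‖z l x‖ ≤ |C| := by
    filter_upwards [hzC] with x hx
    exact ⟨(hx k).trans (le_abs_self _), (hx l).trans (le_abs_self _)⟩
  -- the vector `e_k + ε e_l`
  have hvec : ∀ ε : ℝ, 0 ≤ ε → form α μ (Pi.single k 1 + Pi.single l (ε : ℂ))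
      (Pi.single k 1 + Pi.single l (ε : ℂ))
      = μ k k + μ k l * ((ε ^ (α - 1) : ℝ) : ℂ)
          + ε * (μ l k + μ l l * ((ε ^ (α - 1) : ℝ) : ℂ)) := by
    intro ε hε
    have hp : vpow (Pi.single k 1 + Pi.single l (ε : ℂ)) (α - 1)
        = Pi.single k 1 + Pi.single l ((ε ^ (α - 1) : ℝ) : ℂ) := by
      ext j
      simp only [vpow, Pi.add_apply]
      by_cases hjk : j = k
      · subst hjk
        simp [hkl, spow]
      · by_cases hjl : j = l
        · subst hjl
          simp only [Pi.single_eq_same, Pi.single_eq_of_ne hjk, zero_add]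
          rcases hε.eq_or_lt with rfl | hε
          · simp [spow_zero, Real.zero_rpow (by linarith : α - 1 ≠ 0)]
          · have := spow_real_mul (β := α - 1) hε 1
            rw [mul_one] at this
            rw [this]; simp [spow]
        · simp [hjk, hjl, spow_zero]
    rw [form, hp, Matrix.mulVec_add, add_dotProduct, single_dotProduct, single_dotProduct]
    simp only [Pi.add_apply, Matrix.mulVec_single, Pi.smul_apply, Matrix.col_apply,
      MulOpposite.op_one, one_smul, MulOpposite.smul_eq_mul_unop, MulOpposite.unop_op, one_mul]
  have hbound : ∀ ε : ℝ, 0 < ε → ε ≤ 1 → ‖form α μ (Pi.single k 1 + Pi.single l (ε : ℂ))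
      (Pi.single k 1 + Pi.single l (ε : ℂ)) - form α μ (Pi.single k 1 + Pi.single l ((0 : ℝ) : ℂ))
      (Pi.single k 1 + Pi.single l ((0 : ℝ) : ℂ))‖
      ≤ ε * (α * (|C| * (2 * |C|) ^ (α - 1)) * Γ.real Set.univ) := by
    intro ε hε hε1
    have hsum : ∀ (r : ℝ) x, ∑ j, (Pi.single k 1 + Pi.single l (r : ℂ) : Fin T → ℂ) j * z j x
        = z k x + r * z l x := by
      intro r x
      change (Pi.single k 1 + Pi.single l (r : ℂ)) ⬝ᵥ (fun j => z j x) = _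
      rw [add_dotProduct, single_dotProduct, single_dotProduct, one_mul]
    have hle : ∀ r : ℝ, 0 ≤ r → r ≤ 1 → ∀ᵐ x ∂Γ, ‖z k x + r * z l x‖ ≤ 2 * |C| := by
      intro r hr hr1
      filter_upwards [hCB] with x hx
      refine (norm_add_le _ _).trans ?_
      rw [norm_mul, Complex.norm_real, Real.norm_of_nonneg hr]
      nlinarith [hx.1, hx.2, norm_nonneg (z l x)]
    have hint : ∀ r : ℝ, 0 ≤ r → r ≤ 1 → Integrable (fun x => ‖z k x + r * z l x‖ ^ α) Γ := by
      intro r hr hr1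
      refine Integrable.of_bound (C := (2 * |C|) ^ α) ?_ ?_
      · exact (((hzm k).add ((hzm l).const_mul _)).norm.pow_const _).aestronglyMeasurable
      · filter_upwards [hle r hr hr1] with x hx
        rw [Real.norm_of_nonneg (by positivity)]
        exact Real.rpow_le_rpow (norm_nonneg _) hx hα0.le
    rw [hform, hform]
    simp_rw [hsum]
    rw [← Complex.ofReal_sub, Complex.norm_real,
      ← integral_sub (hint ε hε.le hε1) (hint 0 le_rfl zero_le_one)]
    refine (norm_integral_le_of_norm_le_const
      (C := ε * (α * (|C| * (2 * |C|) ^ (α - 1)))) ?_).trans_eq (by ring)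
    filter_upwards [hCB, hle ε hε.le hε1, hle 0 le_rfl zero_le_one] with x hx h1 h2
    refine (abs_norm_rpow_sub_le hα h2 h1).trans ?_
    have : z k x + ε * z l x - (z k x + ((0 : ℝ) : ℂ) * z l x) = ε * z l x := by simp
    rw [this, norm_mul, Complex.norm_real, Real.norm_of_nonneg hε.le]
    have h3 : ‖z l x‖ * (2 * |C|) ^ (α - 1) ≤ |C| * (2 * |C|) ^ (α - 1) :=
      mul_le_mul_of_nonneg_right hx.2 (by positivity)
    have h4 := mul_le_mul_of_nonneg_left h3 (by positivity : 0 ≤ α * ε)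
    linarith
  set D : ℝ := α * (|C| * (2 * |C|) ^ (α - 1)) * Γ.real Set.univ + (‖μ l k‖ + ‖μ l l‖) with hD
  have hfin : ∀ ε : ℝ, 0 < ε → ε ≤ 1 → ‖μ k l‖ ≤ D * ε ^ (2 - α) := by
    intro ε hε hε1
    have h1 := hbound ε hε hε1
    rw [hvec ε hε.le, hvec 0 le_rfl, Real.zero_rpow (by linarith : α - 1 ≠ 0)] at h1
    set p : ℝ := ε ^ (α - 1) with hp
    have hp0 : 0 < p := by positivity
    have hp1 : p ≤ 1 := Real.rpow_le_one hε.le hε1 (by linarith)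
    have h2 : ‖μ k l * (p : ℂ)‖ ≤ ‖μ k k + μ k l * (p : ℂ) + ε * (μ l k + μ l l * (p : ℂ))
        - (μ k k + μ k l * ((0 : ℝ) : ℂ) + ((0 : ℝ) : ℂ) * (μ l k + μ l l * ((0 : ℝ) : ℂ)))‖
        + ε * (‖μ l k‖ + ‖μ l l‖) := by
      have e : μ k l * (p : ℂ) = (μ k k + μ k l * (p : ℂ) + ε * (μ l k + μ l l * (p : ℂ))
        - (μ k k + μ k l * ((0 : ℝ) : ℂ) + ((0 : ℝ) : ℂ) * (μ l k + μ l l * ((0 : ℝ) : ℂ))))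
        - ε * (μ l k + μ l l * (p : ℂ)) := by push_cast; ring
      nth_rewrite 1 [e]
      refine (norm_sub_le _ _).trans (add_le_add le_rfl ?_)
      rw [norm_mul, Complex.norm_real, Real.norm_of_nonneg hε.le]
      refine mul_le_mul_of_nonneg_left ((norm_add_le _ _).trans (add_le_add le_rfl ?_)) hε.le
      rw [norm_mul, Complex.norm_real, Real.norm_of_nonneg hp0.le]
      exact mul_le_of_le_one_right (norm_nonneg _) hp1
    have h3 : ‖μ k l‖ * p ≤ D * ε := by
      rw [norm_mul, Complex.norm_real, Real.norm_of_nonneg hp0.le] at h2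
      rw [hD]; linarith
    have h4 : ε = ε ^ (2 - α) * p := by
      rw [hp, ← Real.rpow_add hε]; norm_num
    rw [h4, ← mul_assoc] at h3
    exact le_of_mul_le_mul_right h3 hp0
  have hlim : Tendsto (fun ε : ℝ => D * ε ^ (2 - α)) (𝓝[>] 0) (𝓝 0) := by
    have : Tendsto (fun ε : ℝ => D * ε ^ (2 - α)) (𝓝 0) (𝓝 (D * 0 ^ (2 - α))) :=
      ((Real.continuous_rpow_const (by linarith)).tendsto 0).const_mul D
    rw [Real.zero_rpow (by linarith : 2 - α ≠ 0), mul_zero] at this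
    exact this.mono_left nhdsWithin_le_nhds
  have : ‖μ k l‖ ≤ 0 := by
    refine ge_of_tendsto hlim ?_
    filter_upwards [Ioo_mem_nhdsGT (zero_lt_one' ℝ)] with ε hε
    exact hfin ε hε.1 hε.2.le
  exact norm_le_zero_iff.mp this

/-- Lebesgue differentiation of the indefinite integral, which is constant on the open interval; the
endpoint $b$ is discarded as a null set. -/
lemma ae_eq_zero_of_integral_Ioc_eq_zero {a b : ℝ} (hab : a ≤ b) {g : ℝ → ℂ}
    (hg : IntegrableOn g (Set.Ioc a b))
    (h : ∀ t, a ≤ t → t ≤ b → ∫ θ in Set.Ioc a t, g θ = 0) :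
    ∀ᵐ θ ∂(volume.restrict (Set.Ioc a b)), g θ = 0 := by
  rw [ae_restrict_iff' measurableSet_Ioc]
  have hint : IntervalIntegrable g volume a b := by
    rwa [intervalIntegrable_iff_integrableOn_Ioc_of_le hab]
  have hb : ∀ᵐ x : ℝ, x ≠ b := by simp [ae_iff, measure_singleton]
  filter_upwards [hint.ae_hasDerivAt_integral, hb] with x hx hxb hmem
  rw [Set.uIcc_of_le hab] at hx
  have h1 := hx ⟨hmem.1.le, hmem.2⟩ a ⟨le_rfl, hab⟩
  have h2 : (fun y => ∫ t in a..y, g t) =ᶠ[𝓝 x] fun _ => 0 := by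
    filter_upwards [Ioo_mem_nhds hmem.1 (lt_of_le_of_ne hmem.2 hxb)] with y hy
    rw [intervalIntegral.integral_of_le hy.1.le]
    exact h y hy.1.le hy.2.le
  exact h1.unique ((hasDerivAt_const x (0 : ℂ)).congr_of_eventuallyEq h2)

/-- At almost every frequency the spectral density is an `ℓ^α` form. For `α < 2` this is because it
is diagonal there. -/
lemma HasSpectralDensity.ae_isAlphaForm {α : ℝ} (hα : 1 < α) (hα2 : α ≤ 2) {P : Measure Ω}
    [IsProbabilityMeasure P] {Z : ℝ → Ω → Fin T → ℂ} {f : ℝ → Matrix (Fin T) (Fin T) ℂ}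
    (h : HasSpectralDensity α P Z f) (hf : Minimality α f) :
    ∀ᵐ θ ∂(volume.restrict (Set.Ioc (-Real.pi) Real.pi)), IsAlphaForm α (f θ) := by
  rcases hα2.eq_or_lt with rfl | hα2
  · filter_upwards [hf.1] with θ hθ
    exact isAlphaForm_two hθ
  · have hpi : -Real.pi ≤ Real.pi := by linarith [Real.pi_pos]
    have hd : ∀ᵐ θ ∂(volume.restrict (Set.Ioc (-Real.pi) Real.pi)),
        ∀ k l, k ≠ l → f θ k l = 0 := by
      refine ae_all_iff.mpr fun k => ae_all_iff.mpr fun l => ?_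
      by_cases hkl : k = l
      · exact Eventually.of_forall fun θ h => absurd hkl h
      · filter_upwards [ae_eq_zero_of_integral_Ioc_eq_zero hpi (h.integrable k l)
          fun t h1 h2 => h.specMass_eq_zero hα hα2 le_rfl h1 h2 hkl] with θ hθ _ using hθ
    filter_upwards [hf.1, hd] with θ h1 h2
    exact isAlphaForm_of_diagonal hα h1 h2

end StableInterp
end

noncomputable section

namespace StableInterp

variable {T : ℕ}

/-! ### The space `L^α(f)` -/

/-- Lebesgue measure on the frequencies `(-π, π]`. -/
abbrev freq : Measure ℝ := volume.restrict (Set.Ioc (-Real.pi) Real.pi)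

/-- The properties of a spectral density on which the interpolation theory rests. -/
structure IsDensity (α : ℝ) (f : ℝ → Matrix (Fin T) (Fin T) ℂ) : Prop where
  one_lt : 1 < α
  posDef : ∀ᵐ θ ∂freq, (f θ).PosDef
  alphaForm : ∀ᵐ θ ∂freq, IsAlphaForm α (f θ)
  integrable : ∀ k l, Integrable (fun θ => f θ k l) freq
  integrable_trace : Integrable (fun θ => traceInv α (f θ)) freq

lemma HasSpectralDensity.isDensity {Ω : Type*} [MeasurableSpace Ω] {α : ℝ} (hα : 1 < α)
    (hα2 : α ≤ 2) {P : Measure Ω} [IsProbabilityMeasure P] {Z : ℝ → Ω → Fin T → ℂ}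
    {f : ℝ → Matrix (Fin T) (Fin T) ℂ} (h : HasSpectralDensity α P Z f) (hf : Minimality α f) :
    IsDensity α f :=
  ⟨hα, hf.1, h.ae_isAlphaForm hα hα2 hf, h.integrable, hf.2.re⟩

lemma lalpha_eq (α : ℝ) (f : ℝ → Matrix (Fin T) (Fin T) ℂ) (h : ℝ → Fin T → ℂ) :
    lalpha α f h = ∫⁻ θ, ENNReal.ofReal (modular α (f θ) (h θ)) ∂freq := rfl

lemma lalpha_congr {α : ℝ} {f : ℝ → Matrix (Fin T) (Fin T) ℂ} {h g : ℝ → Fin T → ℂ}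
    (hg : h =ᵐ[freq] g) : lalpha α f h = lalpha α f g := by
  rw [lalpha_eq, lalpha_eq]
  refine lintegral_congr_ae ?_
  filter_upwards [hg] with θ hθ
  rw [hθ]

/-- The norm of `L^α(f)`. -/
def lnorm (α : ℝ) (f : ℝ → Matrix (Fin T) (Fin T) ℂ) (h : ℝ → Fin T → ℂ) : ℝ≥0∞ :=
  lalpha α f h ^ (1 / α)

/-! ### The norm of $L^\alpha(f)$ and the embedding into $L^1$. -/

namespace IsDensity

variable {α : ℝ} {f : ℝ → Matrix (Fin T) (Fin T) ℂ} {g h : ℝ → Fin T → ℂ}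

lemma aestronglyMeasurable_form (hf : IsDensity α f) (hg : AEStronglyMeasurable g freq)
    (hh : AEStronglyMeasurable h freq) :
    AEStronglyMeasurable (fun θ => form α (f θ) (g θ) (h θ)) freq := by
  have h1 : ∀ (u : ℝ → Fin T → ℂ), AEStronglyMeasurable u freq → ∀ k,
      AEStronglyMeasurable (fun θ => u θ k) freq := fun u hu k =>
    (continuous_apply k).comp_aestronglyMeasurable hu
  have h2 : AEStronglyMeasurable (fun θ => vpow (h θ) (α - 1)) freq :=
    (continuous_vpow (by linarith [hf.one_lt])).comp_aestronglyMeasurable hh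
  simp only [form, dotProduct, Matrix.mulVec]
  refine Finset.aestronglyMeasurable_fun_sum _ fun k _ => (h1 g hg k).mul ?_
  exact Finset.aestronglyMeasurable_fun_sum _ fun l _ => (hf.integrable k l).1.mul (h1 _ h2 l)

lemma aemeasurable_modular (hf : IsDensity α f) (hh : AEStronglyMeasurable h freq) :
    AEMeasurable (fun θ => modular α (f θ) (h θ)) freq :=
  Complex.measurable_re.comp_aemeasurable (hf.aestronglyMeasurable_form hh hh).aemeasurable

lemma integrable_modular (hf : IsDensity α f) (hh : MemLalpha α f h) :
    Integrable (fun θ => modular α (f θ) (h θ)) freq := by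
  refine ⟨(hf.aemeasurable_modular hh.1).aestronglyMeasurable, ?_⟩
  rw [hasFiniteIntegral_iff_ofReal]
  · exact hh.2
  · filter_upwards [hf.alphaForm] with θ hθ using hθ.modular_nonneg hf.one_lt _

lemma toReal_lalpha (hf : IsDensity α f) (hh : AEStronglyMeasurable h freq) :
    (lalpha α f h).toReal = ∫ θ, modular α (f θ) (h θ) ∂freq := by
  rw [integral_eq_lintegral_of_nonneg_ae _ (hf.aemeasurable_modular hh).aestronglyMeasurable]
  · rfl
  · filter_upwards [hf.alphaForm] with θ hθ using hθ.modular_nonneg hf.one_lt _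

lemma lalpha_smul (hf : IsDensity α f) (c : ℂ) :
    lalpha α f (c • h) = ENNReal.ofReal (‖c‖ ^ α) * lalpha α f h := by
  rw [lalpha_eq, lalpha_eq, ← lintegral_const_mul' _ _ ENNReal.ofReal_ne_top]
  refine lintegral_congr_ae ?_
  filter_upwards [hf.alphaForm] with θ hθ
  rw [Pi.smul_apply, hθ.modular_smul hf.one_lt, ENNReal.ofReal_mul (by positivity)]

lemma lnorm_smul (hf : IsDensity α f) (c : ℂ) :
    lnorm α f (c • h) = ENNReal.ofReal ‖c‖ * lnorm α f h := by
  have hα : 0 < α := by linarith [hf.one_lt]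
  rw [lnorm, hf.lalpha_smul, ENNReal.mul_rpow_of_nonneg _ _ (by positivity),
    ENNReal.ofReal_rpow_of_nonneg (by positivity) (by positivity), ← Real.rpow_mul (norm_nonneg _),
    mul_one_div_cancel hα.ne', Real.rpow_one, lnorm]

lemma lalpha_eq_lnorm_rpow (hf : IsDensity α f) : lalpha α f h = lnorm α f h ^ α := by
  have hα : 0 < α := by linarith [hf.one_lt]
  rw [lnorm, ← ENNReal.rpow_mul, one_div_mul_cancel hα.ne', ENNReal.rpow_one]

/-- Minkowski twice: in $\ell^\alpha$ at almost every frequency, then in $L^\alpha$ for the scalar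
functions $\theta\mapsto$ norm of the value at $\theta$. -/
lemma lnorm_add_le (hf : IsDensity α f) (hg : AEStronglyMeasurable g freq)
    (hh : AEStronglyMeasurable h freq) : lnorm α f (g + h) ≤ lnorm α f g + lnorm α f h := by
  have hα : 0 < α := by linarith [hf.one_lt]
  have hm : ∀ u : ℝ → Fin T → ℂ, AEStronglyMeasurable u freq →
      AEMeasurable (fun θ => ENNReal.ofReal (modular α (f θ) (u θ) ^ (1 / α))) freq := fun u hu =>
    ((hf.aemeasurable_modular hu).pow_const _).ennreal_ofReal
  have hpow : ∀ u : ℝ → Fin T → ℂ, lnorm α f u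
      = (∫⁻ θ, ENNReal.ofReal (modular α (f θ) (u θ) ^ (1 / α)) ^ α ∂freq) ^ (1 / α) := by
    intro u
    rw [lnorm, lalpha_eq]
    congr 1
    refine lintegral_congr_ae ?_
    filter_upwards [hf.alphaForm] with θ hθ
    have h0 := hθ.modular_nonneg hf.one_lt (u θ)
    rw [ENNReal.ofReal_rpow_of_nonneg (by positivity) hα.le, ← Real.rpow_mul h0,
      one_div_mul_cancel hα.ne', Real.rpow_one]
  rw [hpow, hpow, hpow]
  refine le_trans ?_ (ENNReal.lintegral_Lp_add_le (hm g hg) (hm h hh) hf.one_lt.le)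
  refine ENNReal.rpow_le_rpow (lintegral_mono_ae ?_) (by positivity)
  filter_upwards [hf.alphaForm] with θ hθ
  refine ENNReal.rpow_le_rpow ?_ hα.le
  have h1 := hθ.modular_nonneg hf.one_lt (g θ)
  have h2 := hθ.modular_nonneg hf.one_lt (h θ)
  rw [Pi.add_apply, Pi.add_apply, ← ENNReal.ofReal_add (by positivity) (by positivity)]
  exact ENNReal.ofReal_le_ofReal (hθ.modular_add_rpow_le hf.one_lt _ _)

lemma lnorm_neg (hf : IsDensity α f) : lnorm α f (-h) = lnorm α f h := by
  rw [← neg_one_smul ℂ h, hf.lnorm_smul]; simp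

lemma lnorm_sub_le (hf : IsDensity α f) (hg : AEStronglyMeasurable g freq)
    (hh : AEStronglyMeasurable h freq) : lnorm α f (g - h) ≤ lnorm α f g + lnorm α f h := by
  rw [sub_eq_add_neg, ← hf.lnorm_neg (h := h)]
  exact hf.lnorm_add_le hg hh.neg

lemma lnorm_lt_top (hf : IsDensity α f) (hh : lalpha α f h < ∞) : lnorm α f h < ∞ :=
  ENNReal.rpow_lt_top_of_nonneg (by have := hf.one_lt; positivity) hh.ne

lemma lalpha_lt_top (hf : IsDensity α f) (hh : lnorm α f h < ∞) : lalpha α f h < ∞ := by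
  rw [hf.lalpha_eq_lnorm_rpow]
  exact ENNReal.rpow_lt_top_of_nonneg (by linarith [hf.one_lt]) hh.ne

lemma memLalpha_add (hf : IsDensity α f) (hg : MemLalpha α f g) (hh : MemLalpha α f h) :
    MemLalpha α f (g + h) :=
  ⟨hg.1.add hh.1, hf.lalpha_lt_top ((hf.lnorm_add_le hg.1 hh.1).trans_lt
    (ENNReal.add_lt_top.mpr ⟨hf.lnorm_lt_top hg.2, hf.lnorm_lt_top hh.2⟩))⟩

lemma memLalpha_smul (hf : IsDensity α f) (c : ℂ) (hh : MemLalpha α f h) :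
    MemLalpha α f (c • h) := by
  refine ⟨hh.1.const_smul c, ?_⟩
  rw [hf.lalpha_smul]
  exact ENNReal.mul_lt_top ENNReal.ofReal_lt_top hh.2

lemma memLalpha_sub (hf : IsDensity α f) (hg : MemLalpha α f g) (hh : MemLalpha α f h) :
    MemLalpha α f (g - h) := by
  rw [sub_eq_add_neg, ← neg_one_smul ℂ h]
  exact hf.memLalpha_add hg (hf.memLalpha_smul _ hh)

lemma tendsto_lnorm_iff (hf : IsDensity α f) {ι : Type*} {l : Filter ι}
    {u : ι → ℝ → Fin T → ℂ} : Tendsto (fun i => lnorm α f (u i)) l (𝓝 0) ↔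
      Tendsto (fun i => lalpha α f (u i)) l (𝓝 0) := by
  have hα : 0 < α := by linarith [hf.one_lt]
  constructor
  · intro h
    simp_rw [hf.lalpha_eq_lnorm_rpow]
    have := ((ENNReal.continuous_rpow_const (y := α)).tendsto 0).comp h
    rw [ENNReal.zero_rpow_of_pos hα] at this
    exact this
  · intro h
    have := ((ENNReal.continuous_rpow_const (y := 1 / α)).tendsto 0).comp h
    rw [ENNReal.zero_rpow_of_pos (by positivity)] at this
    exact this

lemma tendsto_lnorm (hf : IsDensity α f) {ι : Type*} {l : Filter ι} {u : ι → ℝ → Fin T → ℂ}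
    (hu : ∀ i, AEStronglyMeasurable (u i) freq) (hh : MemLalpha α f h)
    (hlim : Tendsto (fun i => lalpha α f (h - u i)) l (𝓝 0)) :
    Tendsto (fun i => lnorm α f (u i)) l (𝓝 (lnorm α f h)) := by
  have hlim' := hf.tendsto_lnorm_iff.mpr hlim
  have hne := (hf.lnorm_lt_top hh.2).ne
  have h1 : Tendsto (fun i => lnorm α f h - lnorm α f (h - u i)) l (𝓝 (lnorm α f h)) := by
    simpa using ENNReal.Tendsto.sub (tendsto_const_nhds (x := lnorm α f h)) hlim' (Or.inl hne)
  have h2 : Tendsto (fun i => lnorm α f h + lnorm α f (h - u i)) l (𝓝 (lnorm α f h)) := by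
    simpa using (tendsto_const_nhds (x := lnorm α f h)).add hlim'
  refine tendsto_of_tendsto_of_tendsto_of_le_of_le h1 h2 (fun i => ?_) (fun i => ?_)
  · rw [tsub_le_iff_right]
    have := hf.lnorm_add_le (hu i) (hh.1.sub (hu i))
    rwa [add_sub_cancel] at this
  · have := hf.lnorm_sub_le hh.1 (hh.1.sub (hu i))
    rwa [sub_sub_cancel] at this

lemma tendsto_lalpha (hf : IsDensity α f) {ι : Type*} {l : Filter ι} {u : ι → ℝ → Fin T → ℂ}
    (hu : ∀ i, AEStronglyMeasurable (u i) freq) (hh : MemLalpha α f h)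
    (hlim : Tendsto (fun i => lalpha α f (h - u i)) l (𝓝 0)) :
    Tendsto (fun i => lalpha α f (u i)) l (𝓝 (lalpha α f h)) := by
  simp_rw [hf.lalpha_eq_lnorm_rpow]
  exact ((ENNReal.continuous_rpow_const (y := α)).tendsto _).comp (hf.tendsto_lnorm hu hh hlim)

/-- Bounded measurable functions belong to `L^α(f)`. -/
lemma memLalpha_of_bounded (hf : IsDensity α f) (hh : AEStronglyMeasurable h freq) {C : ℝ}
    (hC : ∀ θ, ‖h θ‖ ≤ C) : MemLalpha α f h := by
  refine ⟨hh, ?_⟩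
  have h0 : 0 ≤ C := (norm_nonneg _).trans (hC 0)
  have hα : 0 < α - 1 := by linarith [hf.one_lt]
  have hint : Integrable (fun θ => ∑ k, ∑ l, C * (‖f θ k l‖ * C ^ (α - 1))) freq :=
    integrable_finsetSum _ fun k _ => integrable_finsetSum _ fun l _ =>
      (((hf.integrable k l).norm).mul_const _).const_mul _
  rw [lalpha_eq]
  refine lt_of_le_of_lt (lintegral_mono fun θ => ENNReal.ofReal_le_ofReal ?_)
    hint.lintegral_lt_top
  refine (Complex.re_le_norm _).trans ?_
  rw [form]
  refine norm_sum_le_of_le _ fun k _ => ?_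
  rw [norm_mul, ← Finset.mul_sum]
  refine mul_le_mul ((norm_le_pi_norm _ k).trans (hC θ)) ?_ (norm_nonneg _) h0
  rw [Matrix.mulVec, dotProduct]
  refine norm_sum_le_of_le _ fun l _ => ?_
  rw [norm_mul]
  refine mul_le_mul_of_nonneg_left ?_ (norm_nonneg _)
  rw [vpow, norm_spow hα]
  exact Real.rpow_le_rpow (norm_nonneg _) ((norm_le_pi_norm _ l).trans (hC θ)) hα.le

/-- Under the minimality condition the elements of `L^α(f)` are integrable, continuously. -/
lemma lintegral_norm_le (hf : IsDensity α f) (hh : AEStronglyMeasurable h freq) {ε : ℝ}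
    (hε : 0 < ε) (l : Fin T) : ∫⁻ θ, ‖h θ l‖ₑ ∂freq ≤
      ENNReal.ofReal (ε * ∫ θ, traceInv α (f θ) ∂freq)
        + ENNReal.ofReal (ε ^ (1 - α)) * lalpha α f h := by
  have h1 : ∫⁻ θ, ‖h θ l‖ₑ ∂freq ≤ ∫⁻ θ, (ENNReal.ofReal (ε * traceInv α (f θ))
      + ENNReal.ofReal (ε ^ (1 - α)) * ENNReal.ofReal (modular α (f θ) (h θ))) ∂freq := by
    refine lintegral_mono_ae ?_
    filter_upwards [hf.alphaForm] with θ hθ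
    rw [← ENNReal.ofReal_mul (by positivity), ← ENNReal.ofReal_add
      (mul_nonneg hε.le hθ.traceInv_nonneg)
      (mul_nonneg (by positivity) (hθ.modular_nonneg hf.one_lt _)), ← ofReal_norm]
    exact ENNReal.ofReal_le_ofReal (hθ.norm_apply_le hf.one_lt hε _ _)
  refine h1.trans_eq ?_
  rw [lintegral_add_right' _ (((hf.aemeasurable_modular hh).ennreal_ofReal).const_mul _),
    lintegral_const_mul' _ _ ENNReal.ofReal_ne_top, ← lalpha_eq,
    ← ofReal_integral_eq_lintegral_ofReal (hf.integrable_trace.const_mul ε),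
    integral_const_mul]
  filter_upwards [hf.alphaForm] with θ hθ using mul_nonneg hε.le hθ.traceInv_nonneg

lemma integrable_apply (hf : IsDensity α f) (hh : MemLalpha α f h) (l : Fin T) :
    Integrable (fun θ => h θ l) freq := by
  refine ⟨(continuous_apply l).comp_aestronglyMeasurable hh.1, ?_⟩
  refine (hf.lintegral_norm_le hh.1 one_pos l).trans_lt ?_
  exact ENNReal.add_lt_top.mpr ⟨ENNReal.ofReal_lt_top,
    ENNReal.mul_lt_top ENNReal.ofReal_lt_top hh.2⟩

/-- Smallness in `L^α(f)` implies smallness in `L^1`. -/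
lemma exists_lalpha_le_lintegral_le (hf : IsDensity α f) {η : ℝ≥0∞} (hη : 0 < η) :
    ∃ δ : ℝ≥0∞, 0 < δ ∧ ∀ h : ℝ → Fin T → ℂ, AEStronglyMeasurable h freq → lalpha α f h ≤ δ →
      ∀ l, ∫⁻ θ, ‖h θ l‖ₑ ∂freq ≤ η := by
  set τ := ∫ θ, traceInv α (f θ) ∂freq with hτ
  obtain ⟨r, hr0, hrη⟩ : ∃ r : ℝ, 0 < r ∧ ENNReal.ofReal r ≤ η := by
    obtain ⟨r, hr0, hr⟩ := ENNReal.lt_iff_exists_nnreal_btwn.mp hη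
    exact ⟨r, by exact_mod_cast hr0, by simpa using hr.le⟩
  have hτ0 : 0 ≤ τ := integral_nonneg_of_ae (by
    filter_upwards [hf.alphaForm] with θ hθ using hθ.traceInv_nonneg)
  -- First $\varepsilon$ brings the trace term below $r/2$ (the $+1$ guards against $\tau=0$); only
  -- then is $\delta$ chosen to bring $\varepsilon^{1-\alpha}\delta$ to $r/2$.
  set ε : ℝ := r / 2 / (τ + 1) with hε
  have hε0 : 0 < ε := by positivity
  refine ⟨ENNReal.ofReal (r / 2 / ε ^ (1 - α)), ENNReal.ofReal_pos.mpr (by positivity),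
    fun h hh hle l => (hf.lintegral_norm_le hh hε0 l).trans (le_trans ?_ hrη)⟩
  have h1 : ε * τ ≤ r / 2 := by
    rw [hε, div_mul_eq_mul_div, div_le_iff₀ (by positivity)]
    nlinarith
  refine (add_le_add (ENNReal.ofReal_le_ofReal h1) (mul_le_mul_right hle _)).trans ?_
  rw [← ENNReal.ofReal_mul (by positivity), mul_div_cancel₀ _ (by positivity),
    ← ENNReal.ofReal_add (by positivity) (by positivity), add_halves]

end IsDensity

end StableInterp
end

noncomputable section

namespace StableInterp

variable {Ω : Type*} {T : ℕ}

/-! ### Step functions -/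

lemma sum_fin_succ_sub_castSucc {G : Type*} [AddCommGroup G] :
    ∀ {n : ℕ} (h : Fin (n + 1) → G), ∑ i : Fin n, (h i.succ - h i.castSucc) = h (Fin.last n) - h 0
  | 0, h => by simp
  | n + 1, h => by
    rw [Fin.sum_univ_castSucc]
    have := sum_fin_succ_sub_castSucc fun i => h i.castSucc
    simp only [Fin.succ_castSucc, Fin.succ_last] at this ⊢
    rw [this]; simp

/-- Telescoping of increments over the part of a partition between two of its points. -/
lemma sum_increments_between {G : Type*} [AddCommGroup G] {n : ℕ} {s : Fin (n + 1) → ℝ}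
    (hs : StrictMono s) {a b : Fin (n + 1)} (hab : a ≤ b) (F : ℝ → G) :
    ∑ i : Fin n, (if s a < s i.succ ∧ s i.succ ≤ s b then F (s i.succ) - F (s i.castSucc) else 0)
      = F (s b) - F (s a) := by
  -- Clamping the index to $[a,b]$ makes the terms outside the range vanish, so the full telescoping
  -- sum is the required one.
  have h := sum_fin_succ_sub_castSucc fun i => F (s (max a (min i b)))
  have h1 : max a (min (Fin.last n) b) = b := by
    rw [min_eq_right (Fin.le_last b), max_eq_right hab]
  have h2 : max a (min 0 b) = a := by
    rw [min_eq_left (Fin.zero_le b), max_eq_left (Fin.zero_le a)]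
  simp only [h1, h2] at h
  rw [← h]
  refine Finset.sum_congr rfl fun i _ => ?_
  simp only [hs.lt_iff_lt, hs.le_iff_le]
  split_ifs with hc
  · have h3 : a ≤ i.castSucc := by
      rw [Fin.le_def]; have := hc.1; rw [Fin.lt_def] at this; simp at this ⊢; omega
    have h4 : i.castSucc ≤ b := (Fin.castSucc_le_succ i).trans hc.2
    rw [min_eq_left hc.2, min_eq_left h4, max_eq_right h3, max_eq_right hc.1.le]
  · rcases le_or_gt i.succ a with h3 | h3
    · have h4 : i.castSucc ≤ a := (Fin.castSucc_le_succ i).trans h3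
      rw [min_eq_left (h3.trans hab), min_eq_left (h4.trans hab), max_eq_left h3, max_eq_left h4,
        sub_self]
    · have h4 : b < i.succ := not_le.mp fun h => hc ⟨h3, h⟩
      have h5 : b ≤ i.castSucc := by
        rw [Fin.lt_def] at h4; rw [Fin.le_def]; simp at h4 ⊢; omega
      rw [min_eq_right h4.le, min_eq_right h5, sub_self]

namespace StepFun

/-- Pairing of the values of a step function with the increments of a function. -/
def pair {G H : Type*} [AddCommGroup G] [Module ℂ G] [AddCommGroup H] [Module ℂ H]
    (φ : StepFun T) (B : (Fin T → ℂ) →ₗ[ℂ] G →ₗ[ℂ] H) (F : ℝ → G) : H :=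
  ∑ i : Fin φ.n, B (φ.v i) (F (φ.t i.succ) - F (φ.t i.castSucc))

/-- The indicator of $(t_i,t_{i+1}]$ at $\theta$ is the increment of $x\mapsto 1_{\theta\le x}$.
Values and stochastic integrals thus become instances of one pairing, and both follow from a single
refinement argument. -/
lemma toFun_eq_pair (φ : StepFun T) (θ : ℝ) :
    φ.toFun θ = φ.pair (LinearMap.lsmul ℂ (Fin T → ℂ)).flip (fun x => if θ ≤ x then 1 else 0) := by
  refine Finset.sum_congr rfl fun i _ => ?_
  have hle : φ.t i.castSucc ≤ φ.t i.succ := φ.mono (Fin.castSucc_le_succ i)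
  simp only [LinearMap.flip_apply, LinearMap.lsmul_apply, Set.indicator_apply, Set.mem_Ioc]
  by_cases h1 : θ ≤ φ.t i.castSucc
  · simp [h1, h1.trans hle]
  · by_cases h2 : θ ≤ φ.t i.succ
    · simp [h1, h2, not_le.mp h1]
    · simp [h1, h2]

/-- The bilinear dot product. -/
def dotLin : (Fin T → ℂ) →ₗ[ℂ] (Fin T → ℂ) →ₗ[ℂ] ℂ :=
  LinearMap.mk₂ ℂ (fun u v => u ⬝ᵥ v) add_dotProduct smul_dotProduct dotProduct_add
    (fun c u v => dotProduct_smul c u v)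

lemma integral_eq_pair (φ : StepFun T) (Z : ℝ → Ω → Fin T → ℂ) (ω : Ω) :
    φ.integral Z ω = φ.pair dotLin (fun x => Z x ω) := rfl

/-- A step function can be paired over any finer partition. -/
lemma pair_refine {G H : Type*} [AddCommGroup G] [Module ℂ G] [AddCommGroup H] [Module ℂ H]
    (φ : StepFun T) (B : (Fin T → ℂ) →ₗ[ℂ] G →ₗ[ℂ] H) (F : ℝ → G) {n : ℕ} {s : Fin (n + 1) → ℝ}
    (hs : StrictMono s) (hsub : ∀ i, φ.t i ∈ Set.range s) :
    ∑ i : Fin n, B (φ.toFun (s i.succ)) (F (s i.succ) - F (s i.castSucc)) = φ.pair B F := by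
  choose j hj using hsub
  -- A cell is open on the left and closed on the right, so a step function takes on the cell its
  -- value at the right endpoint.
  have h1 : ∀ i : Fin n, B (φ.toFun (s i.succ)) (F (s i.succ) - F (s i.castSucc))
      = ∑ k : Fin φ.n, B (φ.v k) (if s (j k.castSucc) < s i.succ ∧ s i.succ ≤ s (j k.succ) then
          F (s i.succ) - F (s i.castSucc) else 0) := by
    intro i
    rw [toFun, map_sum, LinearMap.sum_apply]
    refine Finset.sum_congr rfl fun k _ => ?_
    simp only [Set.indicator_apply, Set.mem_Ioc, hj]
    split_ifs <;> simp
  rw [Finset.sum_congr rfl fun i _ => h1 i, Finset.sum_comm, pair]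
  refine Finset.sum_congr rfl fun k _ => ?_
  rw [← map_sum, sum_increments_between hs, hj, hj]
  rw [← hs.le_iff_le, hj, hj]
  exact φ.mono (Fin.castSucc_le_succ k)

/-- Linear combinations of step functions. -/
lemma exists_linear_comb (φ ψ : StepFun T) (a b : ℂ) : ∃ χ : StepFun T,
    (∀ θ, χ.toFun θ = a • φ.toFun θ + b • ψ.toFun θ) ∧
    ∀ (Z : ℝ → Ω → Fin T → ℂ) (ω : Ω),
      χ.integral Z ω = a * φ.integral Z ω + b * ψ.integral Z ω := by
  classical
  set S : Finset ℝ := Finset.univ.image φ.t ∪ Finset.univ.image ψ.t with hS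
  have hne : S.Nonempty := ⟨φ.t 0, Finset.mem_union_left _
    (Finset.mem_image_of_mem _ (Finset.mem_univ _))⟩
  obtain ⟨n, hn⟩ := Nat.exists_eq_succ_of_ne_zero (Finset.card_pos.mpr hne).ne'
  set s : Fin (n + 1) → ℝ := fun i => S.orderEmbOfFin hn i with hs
  have hmono : StrictMono s := (S.orderEmbOfFin hn).strictMono
  have hrange : Set.range s = S := Finset.range_orderEmbOfFin S hn
  have hφ : ∀ i, φ.t i ∈ Set.range s := fun i => by
    rw [hrange]; exact Finset.mem_coe.mpr (Finset.mem_union_left _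
      (Finset.mem_image_of_mem _ (Finset.mem_univ _)))
  have hψ : ∀ i, ψ.t i ∈ Set.range s := fun i => by
    rw [hrange]; exact Finset.mem_coe.mpr (Finset.mem_union_right _
      (Finset.mem_image_of_mem _ (Finset.mem_univ _)))
  have hmem : ∀ i, s i ∈ Set.Icc (-Real.pi) Real.pi := by
    intro i
    have : s i ∈ (S : Set ℝ) := hrange ▸ Set.mem_range_self i
    rcases Finset.mem_union.mp (Finset.mem_coe.mp this) with h | h
    · obtain ⟨k, -, hk⟩ := Finset.mem_image.mp h
      exact hk ▸ φ.mem k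
    · obtain ⟨k, -, hk⟩ := Finset.mem_image.mp h
      exact hk ▸ ψ.mem k
  set χ : StepFun T := ⟨n, s, hmono.monotone, hmem,
    fun i => a • φ.toFun (s i.succ) + b • ψ.toFun (s i.succ)⟩ with hχ
  have key : ∀ {G H : Type} [AddCommGroup G] [Module ℂ G] [AddCommGroup H] [Module ℂ H]
      (B : (Fin T → ℂ) →ₗ[ℂ] G →ₗ[ℂ] H) (F : ℝ → G),
      χ.pair B F = a • φ.pair B F + b • ψ.pair B F := by
    intro G H _ _ _ _ B F
    rw [← φ.pair_refine B F hmono hφ, ← ψ.pair_refine B F hmono hψ, Finset.smul_sum,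
      Finset.smul_sum, ← Finset.sum_add_distrib]
    refine Finset.sum_congr rfl fun i _ => ?_
    change B (a • φ.toFun (s i.succ) + b • ψ.toFun (s i.succ))
      (F (s i.succ) - F (s i.castSucc)) = _
    rw [map_add, map_smul, map_smul]
    rfl
  refine ⟨χ, fun θ => ?_, fun Z ω => ?_⟩
  · rw [toFun_eq_pair, toFun_eq_pair, toFun_eq_pair, key]
  · rw [integral_eq_pair, integral_eq_pair, integral_eq_pair, key]; rfl

lemma measurable_toFun (φ : StepFun T) : Measurable φ.toFun := by
  unfold toFun
  exact Finset.measurable_fun_sum _ fun i _ => (measurable_const (a := φ.v i)).indicator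
    (measurableSet_Ioc (a := φ.t i.castSucc) (b := φ.t i.succ))

lemma aestronglyMeasurable_toFun (φ : StepFun T) : AEStronglyMeasurable φ.toFun freq :=
  φ.measurable_toFun.aestronglyMeasurable

/-- The intervals of a partition are disjoint, so at most one value is present at $\theta$ and the
nonlinear functional passes through the sum. -/
lemma modular_toFun {α : ℝ} (F : Matrix (Fin T) (Fin T) ℂ) (φ : StepFun T) (θ : ℝ) :
    modular α F (φ.toFun θ) = ∑ i : Fin φ.n, (Set.Ioc (φ.t i.castSucc) (φ.t i.succ)).indicator
      (fun _ => modular α F (φ.v i)) θ := by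
  have h0 : modular α F 0 = 0 := by simp [modular, form]
  by_cases h : ∃ i : Fin φ.n, θ ∈ Set.Ioc (φ.t i.castSucc) (φ.t i.succ)
  · obtain ⟨i, hi⟩ := h
    have hne : ∀ j, j ≠ i → θ ∉ Set.Ioc (φ.t j.castSucc) (φ.t j.succ) := by
      intro j hj hmem
      rcases lt_or_gt_of_ne hj with h | h
      · have : φ.t j.succ ≤ φ.t i.castSucc := φ.mono (by
          rw [Fin.le_def]; rw [Fin.lt_def] at h; simp; omega)
        exact absurd hmem.2 (not_le.mpr (this.trans_lt hi.1))
      · have : φ.t i.succ ≤ φ.t j.castSucc := φ.mono (by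
          rw [Fin.le_def]; rw [Fin.lt_def] at h; simp; omega)
        exact absurd hi.2 (not_le.mpr (this.trans_lt hmem.1))
    rw [toFun, Finset.sum_eq_single i (fun j _ hj => Set.indicator_of_notMem (hne j hj) _)
      (fun h => absurd (Finset.mem_univ i) h), Set.indicator_of_mem hi,
      Finset.sum_eq_single i (fun j _ hj => Set.indicator_of_notMem (hne j hj) _)
      (fun h => absurd (Finset.mem_univ i) h), Set.indicator_of_mem hi]
  · push Not at h
    rw [toFun, Finset.sum_eq_zero fun j _ => Set.indicator_of_notMem (h j) _, h0,
      Finset.sum_eq_zero fun j _ => Set.indicator_of_notMem (h j) _]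

lemma modular_specMass {α : ℝ} {f : ℝ → Matrix (Fin T) (Fin T) ℂ} {s t : ℝ}
    (hf : ∀ k l, IntegrableOn (fun θ => f θ k l) (Set.Ioc s t)) (v : Fin T → ℂ) :
    Integrable (fun θ => modular α (f θ) v) (volume.restrict (Set.Ioc s t)) ∧
    ∫ θ in Set.Ioc s t, modular α (f θ) v = modular α (specMass f s t) v := by
  have h1 : ∀ k, Integrable (fun θ => ∑ l, f θ k l * vpow v (α - 1) l)
      (volume.restrict (Set.Ioc s t)) := fun k =>
    integrable_finsetSum _ fun l _ => (hf k l).mul_const _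
  have hint : Integrable (fun θ => form α (f θ) v v) (volume.restrict (Set.Ioc s t)) := by
    simp only [form, dotProduct, Matrix.mulVec]
    exact integrable_finsetSum _ fun k _ => (h1 k).const_mul _
  refine ⟨hint.re, ?_⟩
  have h2 : ∫ θ in Set.Ioc s t, form α (f θ) v v = form α (specMass f s t) v v := by
    simp only [form, dotProduct, Matrix.mulVec, specMass, Matrix.of_apply]
    rw [integral_finsetSum _ fun k _ => (h1 k).const_mul _]
    refine Finset.sum_congr rfl fun k _ => ?_
    rw [integral_const_mul, integral_finsetSum _ fun l _ => (hf k l).mul_const _]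
    congr 1
    exact Finset.sum_congr rfl fun l _ => integral_mul_const _ _
  rw [modular, ← h2]
  exact integral_re hint

lemma toReal_lalpha_toFun {α : ℝ} {f : ℝ → Matrix (Fin T) (Fin T) ℂ} (hf : IsDensity α f)
    (φ : StepFun T) : (lalpha α f φ.toFun).toReal
      = ∑ i : Fin φ.n, modular α (specMass f (φ.t i.castSucc) (φ.t i.succ)) (φ.v i) := by
  have hsub : ∀ i : Fin φ.n, Set.Ioc (φ.t i.castSucc) (φ.t i.succ) ⊆ Set.Ioc (-Real.pi) Real.pi :=
    fun i => Set.Ioc_subset_Ioc (φ.mem _).1 (φ.mem _).2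
  have h1 := fun i : Fin φ.n => modular_specMass (α := α) (f := f)
    (fun k l => IntegrableOn.mono_set (hf.integrable k l) (hsub i)) (φ.v i)
  rw [hf.toReal_lalpha φ.aestronglyMeasurable_toFun]
  simp_rw [modular_toFun]
  have h2 : ∀ i : Fin φ.n, (freq).restrict (Set.Ioc (φ.t i.castSucc) (φ.t i.succ))
      = volume.restrict (Set.Ioc (φ.t i.castSucc) (φ.t i.succ)) := fun i => by
    rw [Measure.restrict_restrict measurableSet_Ioc, Set.inter_eq_left.mpr (hsub i)]
  have h3 : ∀ (i : Fin φ.n), (fun θ => (Set.Ioc (φ.t i.castSucc) (φ.t i.succ)).indicator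
      (fun _ => modular α (f θ) (φ.v i)) θ) = (Set.Ioc (φ.t i.castSucc) (φ.t i.succ)).indicator
      (fun θ => modular α (f θ) (φ.v i)) := fun i => by
    ext θ; simp only [Set.indicator_apply]
  rw [integral_finsetSum]
  · refine Finset.sum_congr rfl fun i _ => ?_
    rw [h3, integral_indicator measurableSet_Ioc, h2, (h1 i).2]
  · intro i _
    rw [h3, integrable_indicator_iff measurableSet_Ioc, IntegrableOn, h2]
    exact (h1 i).1

/-- Independent increments make the scales add up, and the scale of each increment is the modular of
the mass of $f$ on its interval. -/
lemma hasScale_integral [MeasurableSpace Ω] {α : ℝ} {P : Measure Ω} [IsProbabilityMeasure P]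
    {Z : ℝ → Ω → Fin T → ℂ} {f : ℝ → Matrix (Fin T) (Fin T) ℂ} (hf : IsDensity α f)
    (hZ : HasSpectralDensity α P Z f) (φ : StepFun T) :
    HasScale α P (φ.integral Z) (lalpha α f φ.toFun).toReal := by
  rw [φ.toReal_lalpha_toFun hf]
  refine HasScale.sum (by linarith [hf.one_lt]) (fun i => hZ.hasScale hf.one_lt (φ.mem _).1
    (φ.mono (Fin.castSucc_le_succ i)) (φ.mem _).2 (φ.v i)) ?_
  have hm : ∀ v : Fin T → ℂ, Measurable fun w : Fin T → ℂ => v ⬝ᵥ w := fun v => by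
    simp only [dotProduct]; fun_prop
  exact (hZ.indep φ.n φ.t φ.mono φ.mem).comp (fun i w => φ.v i ⬝ᵥ w) fun i => hm _

end StepFun

/-! ### Stochastic integrals -/

variable [MeasurableSpace Ω]

lemma tendstoInMeasure_linear_comb {P : Measure Ω} [IsFiniteMeasure P] {X Y : ℕ → Ω → ℂ}
    {X' Y' : Ω → ℂ} (hX : TendstoInMeasure P X atTop X') (hY : TendstoInMeasure P Y atTop Y')
    (a b : ℂ) : TendstoInMeasure P (fun n => a • X n + b • Y n) atTop (a • X' + b • Y') := by
  rw [tendstoInMeasure_iff_norm] at *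
  intro ε hε
  set δ : ℝ := ε / 2 / (‖a‖ + ‖b‖ + 1) with hδ
  have hδ0 : 0 < δ := by positivity
  have h := (hX δ hδ0).add (hY δ hδ0)
  rw [add_zero] at h
  refine tendsto_of_tendsto_of_tendsto_of_le_of_le tendsto_const_nhds h (fun _ => zero_le)
    fun n => le_trans (measure_mono fun ω hω => ?_) (measure_union_le _ _)
  by_contra hc
  simp only [Set.mem_union, Set.mem_ofPred_eq, not_or, not_le] at hc hω
  have e : (a • X n + b • Y n) ω - (a • X' + b • Y') ω
      = a * (X n ω - X' ω) + b * (Y n ω - Y' ω) := by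
    simp; ring
  rw [e] at hω
  have h1 := norm_add_le (a * (X n ω - X' ω)) (b * (Y n ω - Y' ω))
  rw [norm_mul, norm_mul] at h1
  have h2 : ‖a‖ * ‖X n ω - X' ω‖ ≤ ‖a‖ * δ := mul_le_mul_of_nonneg_left hc.1.le (norm_nonneg _)
  have h3 : ‖b‖ * ‖Y n ω - Y' ω‖ ≤ ‖b‖ * δ := mul_le_mul_of_nonneg_left hc.2.le (norm_nonneg _)
  have h4 : (‖a‖ + ‖b‖ + 1) * δ = ε / 2 := by
    rw [hδ, mul_div_cancel₀ _ (by positivity)]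
  nlinarith

section Integral

variable {α : ℝ} {P : Measure Ω} {Z : ℝ → Ω → Fin T → ℂ}
  {f : ℝ → Matrix (Fin T) (Fin T) ℂ} {g h : ℝ → Fin T → ℂ} {X Y : Ω → ℂ}

/-- The isometry property: it holds for step functions, their norms converge, and stability with
convergent scales survives limits in probability. -/
lemma IsStochIntegral.hasScale [IsProbabilityMeasure P] (hX : IsStochIntegral α P Z f h X)
    (hf : IsDensity α f) (hZ : HasSpectralDensity α P Z f) :
    HasScale α P X (lalpha α f h).toReal := by
  obtain ⟨hh, φ, hφ, hφX⟩ := hX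
  refine HasScale.of_tendstoInMeasure (by linarith [hf.one_lt])
    (fun n => (φ n).hasScale_integral hf hZ) ?_ hφX
  exact (ENNReal.tendsto_toReal hh.2.ne).comp
    (hf.tendsto_lalpha (fun n => (φ n).aestronglyMeasurable_toFun) hh hφ)

lemma IsStochIntegral.linear_comb [IsProbabilityMeasure P] (hX : IsStochIntegral α P Z f h X)
    (hY : IsStochIntegral α P Z f g Y) (hf : IsDensity α f) (a b : ℂ) :
    IsStochIntegral α P Z f (a • h + b • g) (a • X + b • Y) := by
  obtain ⟨hh, φ, hφ, hφX⟩ := hX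
  obtain ⟨hg, ψ, hψ, hψY⟩ := hY
  choose χ hχ hχi using fun n => (φ n).exists_linear_comb (Ω := Ω) (ψ n) a b
  refine ⟨hf.memLalpha_add (hf.memLalpha_smul _ hh) (hf.memLalpha_smul _ hg), χ, ?_, ?_⟩
  · rw [← hf.tendsto_lnorm_iff] at hφ hψ ⊢
    have h1 := (ENNReal.Tendsto.const_mul (a := ENNReal.ofReal ‖a‖) hφ
      (Or.inr ENNReal.ofReal_ne_top)).add (ENNReal.Tendsto.const_mul (a := ENNReal.ofReal ‖b‖) hψ
      (Or.inr ENNReal.ofReal_ne_top))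
    rw [mul_zero, mul_zero, add_zero] at h1
    refine tendsto_of_tendsto_of_tendsto_of_le_of_le tendsto_const_nhds h1 (fun _ => zero_le)
      fun n => ?_
    have e : (fun θ => (a • h + b • g) θ - (χ n).toFun θ)
        = a • (fun θ => h θ - (φ n).toFun θ) + b • (fun θ => g θ - (ψ n).toFun θ) := by
      ext θ k
      simp only [Pi.add_apply, Pi.sub_apply, Pi.smul_apply, hχ, smul_eq_mul]; ring
    have h2 := hf.lnorm_add_le
      ((hh.1.sub (φ n).aestronglyMeasurable_toFun).const_smul a)
      ((hg.1.sub (ψ n).aestronglyMeasurable_toFun).const_smul b)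
    rw [hf.lnorm_smul, hf.lnorm_smul] at h2
    simp only [e]
    exact h2
  · have e : (fun n ω => (χ n).integral Z ω)
        = fun n => a • (φ n).integral Z + b • (ψ n).integral Z := by
      ext n ω
      simp [hχi]
    rw [e]
    exact tendstoInMeasure_linear_comb hφX hψY a b

lemma IsStochIntegral.sub [IsProbabilityMeasure P] (hX : IsStochIntegral α P Z f h X)
    (hY : IsStochIntegral α P Z f g Y) (hf : IsDensity α f) :
    IsStochIntegral α P Z f (h - g) (X - Y) := by
  have := hX.linear_comb hY hf 1 (-1)
  simpa [sub_eq_add_neg] using this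

lemma isStochIntegral_zero [IsProbabilityMeasure P] (hf : IsDensity α f) :
    IsStochIntegral α P Z f 0 0 := by
  let φ : StepFun T := ⟨0, fun _ => 0, monotone_const,
    fun _ => ⟨by linarith [Real.pi_pos], Real.pi_pos.le⟩, fun _ => 0⟩
  have h0 : φ.toFun = 0 := by ext θ; simp [StepFun.toFun]
  have h1 : ∀ ω, φ.integral Z ω = 0 := fun ω => by simp [StepFun.integral]
  refine ⟨hf.memLalpha_of_bounded aestronglyMeasurable_const (C := 0) (by simp), fun _ => φ, ?_, ?_⟩
  · have : lalpha α f (fun θ => (0 : ℝ → Fin T → ℂ) θ - φ.toFun θ) = 0 := by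
      rw [lalpha_eq]; simp [h0, modular, form]
    simp only [this, tendsto_const_nhds]
  · have : (fun (_ : ℕ) ω => φ.integral Z ω) = fun _ => 0 := by ext n ω; exact h1 ω
    rw [this]
    exact tendstoInMeasure_of_tendsto_ae (fun _ => aestronglyMeasurable_zero)
      (Eventually.of_forall fun _ => tendsto_const_nhds)

/-- The stochastic integral is closed: limits in `L^α(f)` and in probability go together. -/
lemma IsStochIntegral.of_tendsto (hf : IsDensity α f) {p : ℕ → ℝ → Fin T → ℂ} {ζ : ℕ → Ω → ℂ}
    (hp : ∀ n, IsStochIntegral α P Z f (p n) (ζ n)) (hh : MemLalpha α f h)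
    (hlim : Tendsto (fun n => lalpha α f (h - p n)) atTop (𝓝 0))
    (hζ : TendstoInMeasure P ζ atTop X) : IsStochIntegral α P Z f h X := by
  -- Diagonal choice: a single step function approximates the integrand in $L^\alpha(f)$ and the
  -- integral in probability, both to within $2^{-n}$.
  have hstep : ∀ n : ℕ, ∃ φ : StepFun T, lnorm α f (p n - φ.toFun) ≤ ENNReal.ofReal ((1 / 2) ^ n) ∧
      P {ω | (1 / 2 : ℝ) ^ n ≤ ‖φ.integral Z ω - ζ n ω‖} ≤ ENNReal.ofReal ((1 / 2) ^ n) := by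
    intro n
    obtain ⟨-, φ, h1, h2⟩ := hp n
    rw [← hf.tendsto_lnorm_iff] at h1
    rw [tendstoInMeasure_iff_norm] at h2
    have hpos : (0 : ℝ≥0∞) < ENNReal.ofReal ((1 / 2) ^ n) := ENNReal.ofReal_pos.mpr (by positivity)
    obtain ⟨m, hm1, hm2⟩ := ((h1.eventually_le_const hpos).and
      ((h2 ((1 / 2 : ℝ) ^ n) (by positivity)).eventually_le_const hpos)).exists
    exact ⟨φ m, hm1, hm2⟩
  choose φ hφ1 hφ2 using hstep
  have hgeo : Tendsto (fun n : ℕ => ENNReal.ofReal ((1 / 2) ^ n)) atTop (𝓝 0) := by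
    rw [← ENNReal.ofReal_zero]
    exact ENNReal.tendsto_ofReal (tendsto_pow_atTop_nhds_zero_of_lt_one (by norm_num) (by norm_num))
  refine ⟨hh, φ, ?_, ?_⟩
  · rw [← hf.tendsto_lnorm_iff] at hlim ⊢
    have := hlim.add hgeo
    rw [add_zero] at this
    refine tendsto_of_tendsto_of_tendsto_of_le_of_le tendsto_const_nhds this (fun _ => zero_le)
      fun n => ?_
    have h1 := hf.lnorm_add_le (hh.1.sub (hp n).1.1)
      ((hp n).1.1.sub (φ n).aestronglyMeasurable_toFun)
    rw [sub_add_sub_cancel] at h1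
    exact h1.trans (add_le_add le_rfl (hφ1 n))
  · rw [tendstoInMeasure_iff_norm] at hζ ⊢
    intro ε hε
    have := (hζ (ε / 2) (half_pos hε)).add hgeo
    rw [add_zero] at this
    refine tendsto_of_tendsto_of_tendsto_of_le_of_le' tendsto_const_nhds this
      (Eventually.of_forall fun _ => zero_le) ?_
    have hsmall : ∀ᶠ n : ℕ in atTop, (1 / 2 : ℝ) ^ n ≤ ε / 2 :=
      (tendsto_pow_atTop_nhds_zero_of_lt_one (by norm_num) (by norm_num)).eventually_le_const
        (half_pos hε)
    filter_upwards [hsmall] with n hn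
    refine le_trans (measure_mono fun ω hω => ?_) ((measure_union_le _ _).trans
      (add_le_add le_rfl (hφ2 n)))
    by_contra hc
    simp only [Set.mem_union, Set.mem_ofPred_eq, not_or, not_le] at hc hω
    have := norm_add_le ((φ n).integral Z ω - ζ n ω) (ζ n ω - X ω)
    rw [sub_add_sub_cancel] at this
    linarith [hc.1, hc.2]

end Integral

end StableInterp
end

noncomputable section

namespace StableInterp

variable {T : ℕ}

/-! ### Characters and Fourier coefficients on `(-π, π]` -/

lemma ex_eq (n : ℤ) (θ : ℝ) : ex n θ = Complex.exp (((n * θ : ℝ) : ℂ) * Complex.I) := by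
  rw [ex]; congr 1; push_cast; ring

lemma norm_ex (n : ℤ) (θ : ℝ) : ‖ex n θ‖ = 1 := by
  rw [ex_eq, Complex.norm_exp_ofReal_mul_I]

lemma continuous_ex (n : ℤ) : Continuous (ex n) := by
  unfold ex; fun_prop

lemma ex_add (m n : ℤ) (θ : ℝ) : ex (m + n) θ = ex m θ * ex n θ := by
  rw [ex, ex, ex, ← Complex.exp_add]; congr 1; push_cast; ring

lemma ex_zero (θ : ℝ) : ex 0 θ = 1 := by simp [ex]

lemma integral_ex (n : ℤ) : ∫ θ, ex n θ ∂freq = if n = 0 then 2 * Real.pi else 0 := by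
  split_ifs with h
  · subst h
    simp only [ex_zero, integral_const, measureReal_restrict_apply_univ, Real.volume_real_Ioc]
    rw [max_eq_left (by linarith [Real.pi_pos]), Complex.real_smul]
    push_cast; ring
  · rw [freq, ← intervalIntegral.integral_of_le (by linarith [Real.pi_pos])]
    have hc : Complex.I * (n : ℂ) ≠ 0 := mul_ne_zero Complex.I_ne_zero (by exact_mod_cast h)
    unfold ex
    rw [integral_exp_mul_complex hc, Complex.ofReal_zero, div_eq_zero_iff]
    left
    rw [sub_eq_zero, Complex.exp_eq_exp_iff_exists_int]
    exact ⟨n, by push_cast; ring⟩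

lemma integral_ex_mul_ex (m n : ℤ) :
    ∫ θ, ex m θ * ex n θ ∂freq = if m + n = 0 then 2 * Real.pi else 0 := by
  simp_rw [← ex_add]; exact integral_ex _

lemma integrable_ex_mul {g : ℝ → ℂ} (hg : Integrable g freq) (n : ℤ) :
    Integrable (fun θ => ex n θ * g θ) freq :=
  hg.bdd_mul (c := 1) (continuous_ex n).aestronglyMeasurable
    (Eventually.of_forall fun θ => (norm_ex n θ).le)

lemma integrable_ex (n : ℤ) : Integrable (ex n) freq := by
  have := integrable_ex_mul (integrable_const (1 : ℂ)) n
  simpa using this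

/-- An integrable function on `(-π, π]` whose Fourier coefficients vanish is zero. -/
lemma ae_eq_zero_of_fourier {g : ℝ → ℂ} (hg : Integrable g freq)
    (h : ∀ n : ℤ, ∫ θ, ex n θ * g θ ∂freq = 0) : g =ᵐ[freq] 0 := by
  have hpi := Real.pi_pos
  have hfact : Fact (0 < 2 * Real.pi) := ⟨by positivity⟩
  have hcoe : Measurable fun θ : ℝ => (θ : AddCircle (2 * Real.pi)) :=
    AddCircle.measurable_mk'
  have hint : ∀ F : C(AddCircle (2 * Real.pi), ℂ),
      Integrable (fun θ : ℝ => F (θ : AddCircle (2 * Real.pi)) * g θ) freq := fun F =>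
    hg.bdd_mul (c := ‖F‖) (F.continuous.measurable.comp hcoe).aestronglyMeasurable
      (Eventually.of_forall fun θ => F.norm_coe_le_norm _)
  -- Integration against $g$ is a bounded functional on continuous periodic functions. It kills the
  -- characters, whose span is dense, hence everything.
  set L : C(AddCircle (2 * Real.pi), ℂ) →L[ℂ] ℂ := LinearMap.mkContinuous
    { toFun := fun F => ∫ θ, F (θ : AddCircle (2 * Real.pi)) * g θ ∂freq
      map_add' := fun F G => by
        rw [← integral_add (hint F) (hint G)]
        simp only [ContinuousMap.add_apply, add_mul]
      map_smul' := fun c F => by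
        simp only [ContinuousMap.smul_apply, smul_eq_mul, RingHom.id_apply, mul_assoc]
        rw [integral_const_mul] } (∫ θ, ‖g θ‖ ∂freq)
    (fun F => by
      change ‖∫ θ, F (θ : AddCircle (2 * Real.pi)) * g θ ∂freq‖ ≤ _
      refine (norm_integral_le_of_norm_le (hg.norm.const_mul ‖F‖)
        (Eventually.of_forall fun θ => ?_)).trans_eq (by rw [integral_const_mul, mul_comm])
      rw [norm_mul]
      exact mul_le_mul_of_nonneg_right (F.norm_coe_le_norm _) (norm_nonneg _)) with hL
  have hLapply : ∀ F, L F = ∫ θ, F (θ : AddCircle (2 * Real.pi)) * g θ ∂freq := fun F => rfl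
  have hker : ∀ F, L F = 0 := by
    have hle : (Submodule.span ℂ (Set.range (@fourier (2 * Real.pi)))).topologicalClosure
        ≤ LinearMap.ker (L : C(AddCircle (2 * Real.pi), ℂ) →ₗ[ℂ] ℂ) := by
      refine Submodule.topologicalClosure_minimal _ (Submodule.span_le.mpr ?_) L.isClosed_ker
      rintro _ ⟨n, rfl⟩
      rw [SetLike.mem_coe, LinearMap.mem_ker]
      change L _ = 0
      rw [hLapply, ← h n]
      refine integral_congr_ae (Eventually.of_forall fun θ => ?_)
      simp only
      rw [fourier_coe_apply, ex]
      congr 2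
      push_cast
      field_simp
    intro F
    have : F ∈ (Submodule.span ℂ (Set.range (@fourier (2 * Real.pi)))).topologicalClosure := by
      rw [span_fourier_closure_eq_top]; exact Submodule.mem_top
    exact LinearMap.mem_ker.mp (hle this)
  have hIoo := isOpen_Ioo (a := -Real.pi) (b := Real.pi)
    |>.ae_eq_zero_of_integral_contDiff_smul_eq_zero (μ := volume) (f := g)
    ((IntegrableOn.mono_set hg Set.Ioo_subset_Ioc_self).locallyIntegrableOn) (by
      intro φ hφ _ hsupp
      have hout : ∀ x, x ∉ Set.Ioo (-Real.pi) Real.pi → φ x = 0 := fun x hx =>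
        image_eq_zero_of_notMem_tsupport fun h => hx (hsupp h)
      have h1 : (fun x => (φ x : ℂ)) (-Real.pi)
          = (fun x => (φ x : ℂ)) (-Real.pi + 2 * Real.pi) := by
        simp only
        rw [hout _ (by simp), hout (-Real.pi + 2 * Real.pi) (fun h => by linarith [h.2])]
      -- A test function supported in the open interval vanishes at both ends, so it descends to the
      -- circle.
      set F : C(AddCircle (2 * Real.pi), ℂ) := ⟨AddCircle.liftIoc (2 * Real.pi) (-Real.pi)
        (fun x => (φ x : ℂ)), AddCircle.liftIoc_continuous h1
          (Complex.continuous_ofReal.comp hφ.continuous).continuousOn⟩ with hF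
      have h2 := hker F
      rw [hLapply] at h2
      rw [← setIntegral_eq_integral_of_forall_compl_eq_zero (s := Set.Ioc (-Real.pi) Real.pi)
        (fun x hx => by rw [hout x fun h => hx ⟨h.1, h.2.le⟩, zero_smul]), ← h2]
      refine setIntegral_congr_fun measurableSet_Ioc fun θ hθ => ?_
      simp only [hF, ContinuousMap.coe_mk]
      rw [AddCircle.liftIoc_coe_apply (by
        rw [show -Real.pi + 2 * Real.pi = Real.pi by ring]; exact hθ), Complex.real_smul])
  have hne : ∀ᵐ x : ℝ, x ≠ Real.pi := by simp [ae_iff, measure_singleton]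
  rw [Filter.EventuallyEq, freq, ae_restrict_iff' measurableSet_Ioc]
  filter_upwards [hIoo, hne] with x hx hx' hmem
  exact hx ⟨hmem.1, lt_of_le_of_ne hmem.2 hx'⟩

/-! ### Trigonometric polynomials -/

/-- The span of the functions `e^{ijθ} δ_k`, `j ∉ {0, …, N}`. -/
def expSpan (T N : ℕ) : Submodule ℂ (ℝ → Fin T → ℂ) :=
  Submodule.span ℂ {q : ℝ → Fin T → ℂ | ∃ j : ℤ, ∃ k : Fin T,
    j ∉ Set.Ico 0 ((N : ℤ) + 1) ∧ q = fun θ => Pi.single k (ex j θ)}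

lemma continuous_single_ex (k : Fin T) (j : ℤ) :
    Continuous fun θ => (Pi.single k (ex j θ) : Fin T → ℂ) :=
  (continuous_single k).comp (continuous_ex j)

lemma norm_single_ex (k : Fin T) (j : ℤ) (θ : ℝ) : ‖(Pi.single k (ex j θ) : Fin T → ℂ)‖ = 1 := by
  rw [Pi.norm_single, norm_ex]

lemma expSpan_bounded {N : ℕ} {p : ℝ → Fin T → ℂ} (hp : p ∈ expSpan T N) :
    Continuous p ∧ ∃ C, ∀ θ, ‖p θ‖ ≤ C := by
  refine Submodule.span_induction
    (p := fun p _ => Continuous p ∧ ∃ C, ∀ θ, ‖p θ‖ ≤ C) ?_ ?_ ?_ ?_ hp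
  · rintro _ ⟨j, k, -, rfl⟩
    exact ⟨continuous_single_ex k j, 1, fun θ => (norm_single_ex k j θ).le⟩
  · exact ⟨continuous_const, 0, fun θ => by simp⟩
  · rintro p q - - ⟨h1, C, h2⟩ ⟨h3, D, h4⟩
    exact ⟨h1.add h3, C + D, fun θ => (norm_add_le _ _).trans (add_le_add (h2 θ) (h4 θ))⟩
  · rintro c p - ⟨h1, C, h2⟩
    refine ⟨h1.const_smul c, ‖c‖ * C, fun θ => ?_⟩
    rw [Pi.smul_apply, norm_smul]
    exact mul_le_mul_of_nonneg_left (h2 θ) (norm_nonneg _)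

lemma IsDensity.memLalpha_expSpan {α : ℝ} {f : ℝ → Matrix (Fin T) (Fin T) ℂ} (hf : IsDensity α f)
    {N : ℕ} {p : ℝ → Fin T → ℂ} (hp : p ∈ expSpan T N) : MemLalpha α f p := by
  obtain ⟨h1, C, h2⟩ := expSpan_bounded hp
  exact hf.memLalpha_of_bounded h1.aestronglyMeasurable h2

lemma integrable_expSpan {N : ℕ} {p : ℝ → Fin T → ℂ} (hp : p ∈ expSpan T N) (l : Fin T) :
    Integrable (fun θ => p θ l) freq := by
  obtain ⟨h1, C, h2⟩ := expSpan_bounded hp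
  exact Integrable.of_bound ((continuous_apply l).comp h1).aestronglyMeasurable C
    (Eventually.of_forall fun θ => (norm_le_pi_norm _ l).trans (h2 θ))

lemma integral_expSpan {N : ℕ} {p : ℝ → Fin T → ℂ} (hp : p ∈ expSpan T N) (k : Fin (N + 1))
    (l : Fin T) : ∫ θ, ex (-((k : ℕ) : ℤ)) θ * p θ l ∂freq = 0 := by
  refine Submodule.span_induction
    (p := fun p _ => ∫ θ, ex (-((k : ℕ) : ℤ)) θ * p θ l ∂freq = 0) ?_ ?_ ?_ ?_ hp
  · rintro _ ⟨j, k', hj, rfl⟩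
    by_cases hl : l = k'
    · subst hl
      simp only [Pi.single_eq_same]
      rw [integral_ex_mul_ex, if_neg]
      · exact Complex.ofReal_zero
      intro h0
      refine hj ⟨?_, ?_⟩ <;> have := k.2 <;> omega
    · simp [Pi.single_eq_of_ne hl]
  · simp
  · intro p q hp hq h1 h2
    simp only [Pi.add_apply, mul_add]
    rw [integral_add (integrable_ex_mul (integrable_expSpan hp l) _)
      (integrable_ex_mul (integrable_expSpan hq l) _), h1, h2, add_zero]
  · intro c p _ h1
    simp only [Pi.smul_apply, smul_eq_mul, mul_left_comm _ c]
    rw [integral_const_mul, h1, mul_zero]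

/-- The elements of `L_N^α(f)` have vanishing Fourier coefficients with indices `0, …, N`. -/
lemma MemLN.integral_eq_zero {α : ℝ} {f : ℝ → Matrix (Fin T) (Fin T) ℂ} (hf : IsDensity α f)
    {N : ℕ} {h : ℝ → Fin T → ℂ} (hh : MemLN α N f h) (k : Fin (N + 1)) (l : Fin T) :
    ∫ θ, ex (-((k : ℕ) : ℤ)) θ * h θ l ∂freq = 0 := by
  rw [← norm_le_zero_iff, ← ENNReal.ofReal_eq_zero, ofReal_norm, ← nonpos_iff_eq_zero]
  refine le_of_forall_pos_le_add fun η hη => ?_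
  rw [zero_add]
  obtain ⟨δ, hδ, hδη⟩ := hf.exists_lalpha_le_lintegral_le hη
  obtain ⟨p, hp, hpδ⟩ := hh.2 δ hδ
  have hp' : p ∈ expSpan T N := hp
  have h1 := hδη (h - p) (hh.1.1.sub (hf.memLalpha_expSpan hp').1) hpδ.le l
  have h2 : ∫ θ, ex (-((k : ℕ) : ℤ)) θ * h θ l ∂freq
      = ∫ θ, ex (-((k : ℕ) : ℤ)) θ * (h - p) θ l ∂freq := by
    simp only [Pi.sub_apply, mul_sub]
    rw [integral_sub (integrable_ex_mul (hf.integrable_apply hh.1 l) _)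
      (integrable_ex_mul (integrable_expSpan hp' l) _), integral_expSpan hp', sub_zero]
  rw [h2]
  refine (enorm_integral_le_lintegral_enorm _).trans (le_trans (lintegral_mono fun θ => ?_) h1)
  rw [enorm_mul, ← ofReal_norm (ex _ θ), norm_ex, ENNReal.ofReal_one, one_mul]

lemma polyC_apply {N : ℕ} (c : Fin (N + 1) → Fin T → ℂ) (θ : ℝ) (l : Fin T) :
    polyC c θ l = ∑ j : Fin (N + 1), ex (-((j : ℕ) : ℤ)) θ * c j l := by
  simp [polyC]

lemma integrable_polyC {N : ℕ} (c : Fin (N + 1) → Fin T → ℂ) (l : Fin T) :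
    Integrable (fun θ => polyC c θ l) freq := by
  simp_rw [polyC_apply]
  exact integrable_finsetSum _ fun j _ => (integrable_ex _).mul_const _

lemma integral_ex_mul_polyC {N : ℕ} (c : Fin (N + 1) → Fin T → ℂ) (m : ℤ) (l : Fin T) :
    ∫ θ, ex m θ * polyC c θ l ∂freq
      = ∑ j : Fin (N + 1), (if m = ((j : ℕ) : ℤ) then 2 * Real.pi else 0) * c j l := by
  simp_rw [polyC_apply, Finset.mul_sum, ← mul_assoc]
  rw [integral_finsetSum _ fun j _ => (integrable_ex_mul (integrable_ex _) _).mul_const _]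
  refine Finset.sum_congr rfl fun j _ => ?_
  rw [integral_mul_const, integral_ex_mul_ex]
  simp [add_neg_eq_zero]

lemma integral_ex_mul_polyC_self {N : ℕ} (c : Fin (N + 1) → Fin T → ℂ) (k : Fin (N + 1))
    (l : Fin T) : ∫ θ, ex ((k : ℕ) : ℤ) θ * polyC c θ l ∂freq = 2 * Real.pi * c k l := by
  rw [integral_ex_mul_polyC, Finset.sum_eq_single k]
  · simp
  · intro j _ hj
    rw [if_neg, Complex.ofReal_zero, zero_mul]
    intro h
    exact hj (Fin.ext (by exact_mod_cast h.symm))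
  · simp

lemma polyC_injective {N : ℕ} {c c' : Fin (N + 1) → Fin T → ℂ}
    (h : polyC c =ᵐ[freq] polyC c') : c = c' := by
  ext k l
  have h1 := integral_ex_mul_polyC_self c k l
  have h2 := integral_ex_mul_polyC_self c' k l
  have h3 : ∫ θ, ex ((k : ℕ) : ℤ) θ * polyC c θ l ∂freq
      = ∫ θ, ex ((k : ℕ) : ℤ) θ * polyC c' θ l ∂freq := by
    refine integral_congr_ae ?_
    filter_upwards [h] with θ hθ
    rw [hθ]
  rw [h1, h2] at h3
  exact mul_left_cancel₀ (by simp [Real.pi_ne_zero]) h3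

/-- A function with vanishing Fourier coefficients outside `{0, …, N}` is a polynomial `C_N`. -/
lemma exists_eq_polyC {N : ℕ} {G : ℝ → Fin T → ℂ} (hG : ∀ l, Integrable (fun θ => G θ l) freq)
    (h : ∀ m : ℤ, m ∉ Set.Ico 0 ((N : ℤ) + 1) → ∀ l, ∫ θ, ex m θ * G θ l ∂freq = 0) :
    ∃ c : Fin (N + 1) → Fin T → ℂ, G =ᵐ[freq] polyC c := by
  -- $C_N$ carries the frequencies $-j$, so its coefficients are recovered by integrating against
  -- $e^{ij\theta}$.
  set c : Fin (N + 1) → Fin T → ℂ := fun j l =>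
    (2 * Real.pi : ℂ)⁻¹ * ∫ θ, ex ((j : ℕ) : ℤ) θ * G θ l ∂freq with hc
  have hpi : (2 * Real.pi : ℂ) ≠ 0 := by simp [Real.pi_ne_zero]
  have key : ∀ l, (fun θ => G θ l - polyC c θ l) =ᵐ[freq] 0 := by
    intro l
    refine ae_eq_zero_of_fourier ((hG l).sub (integrable_polyC c l)) fun m => ?_
    simp only [mul_sub]
    rw [integral_sub (integrable_ex_mul (hG l) m) (integrable_ex_mul (integrable_polyC c l) m),
      sub_eq_zero]
    by_cases hm : m ∈ Set.Ico 0 ((N : ℤ) + 1)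
    · obtain ⟨k, rfl⟩ : ∃ k : Fin (N + 1), m = ((k : ℕ) : ℤ) := by
        refine ⟨⟨m.toNat, ?_⟩, ?_⟩
        · have := hm.1; have := hm.2; omega
        · simp [hm.1]
      rw [integral_ex_mul_polyC_self, hc, mul_inv_cancel_left₀ hpi]
    · rw [h m hm l, integral_ex_mul_polyC, Finset.sum_eq_zero]
      intro j _
      rw [if_neg, Complex.ofReal_zero, zero_mul]
      rintro rfl
      refine hm ⟨by omega, ?_⟩
      have := j.2; omega
  refine ⟨c, ?_⟩
  filter_upwards [ae_all_iff.mpr key] with θ hθ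
  exact funext fun l => sub_eq_zero.mp (hθ l)

end StableInterp
end

noncomputable section

namespace StableInterp

variable {T : ℕ} {α : ℝ} {f : ℝ → Matrix (Fin T) (Fin T) ℂ} {N : ℕ}

/-! ### Completeness and best approximation in `L^α(f)` -/

lemma continuous_modular (hα : 1 < α) (F : Matrix (Fin T) (Fin T) ℂ) :
    Continuous (modular α F) := by
  have h : Continuous fun v : Fin T → ℂ => vpow v (α - 1) := continuous_vpow (by linarith)
  unfold modular form
  exact Complex.continuous_re.comp
    (continuous_id.dotProduct (Continuous.matrix_mulVec continuous_const h))

lemma IsDensity.lalpha_neg (hf : IsDensity α f) (h : ℝ → Fin T → ℂ) :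
    lalpha α f (-h) = lalpha α f h := by
  rw [hf.lalpha_eq_lnorm_rpow, hf.lnorm_neg, ← hf.lalpha_eq_lnorm_rpow]

lemma IsDensity.lalpha_sub_comm (hf : IsDensity α f) (g h : ℝ → Fin T → ℂ) :
    lalpha α f (g - h) = lalpha α f (h - g) := by
  rw [← neg_sub h g, hf.lalpha_neg]

/-- `L^α(f)` is complete. -/
lemma IsDensity.exists_tendsto_of_cauchy (hf : IsDensity α f) {p : ℕ → ℝ → Fin T → ℂ}
    (hp : ∀ n, MemLalpha α f (p n))
    (hC : ∀ ε : ℝ≥0∞, 0 < ε → ∃ n₀, ∀ m ≥ n₀, ∀ n ≥ n₀, lalpha α f (p m - p n) ≤ ε) :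
    ∃ h, MemLalpha α f h ∧ Tendsto (fun n => lalpha α f (h - p n)) atTop (𝓝 0) := by
  have hη : ∀ i : ℕ, ∃ η : ℝ≥0∞, 0 < η ∧ η < 2⁻¹ ^ i := fun i =>
    exists_between (ENNReal.pow_pos (by simp) i)
  choose η hη0 hη1 using hη
  choose δ hδ0 hδ using fun i => hf.exists_lalpha_le_lintegral_le (hη0 i)
  -- The thresholds make the $L^1$ differences along the subsequence summable, which yields a
  -- pointwise limit almost everywhere; Fatou's lemma then transfers the Cauchy bound to that limit.
  obtain ⟨ns, hns, hnsC⟩ := Filter.extraction_forall_of_eventually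
    (P := fun i k => ∀ m ≥ k, ∀ n ≥ k, lalpha α f (p m - p n) ≤ δ i) (fun i => by
      obtain ⟨n₀, h⟩ := hC (δ i) (hδ0 i)
      filter_upwards [eventually_ge_atTop n₀] with k hk m hm n hn
      exact h m (hk.trans hm) n (hk.trans hn))
  have hcoord : ∀ l : Fin T, ∀ᵐ θ ∂freq, ∃ z, Tendsto (fun k => p (ns k) θ l) atTop (𝓝 z) := by
    intro l
    refine Lp.ae_tendsto_of_cauchy_eLpNorm (f := fun k θ => p (ns k) θ l) (p := 1)
      (B := fun i => 2⁻¹ ^ i) (fun k => (continuous_apply l).comp_aestronglyMeasurable (hp _).1)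
      le_rfl ?_ ?_
    · rw [ENNReal.tsum_geometric]; simp
    · intro i m n hm hn
      rw [eLpNorm_one_eq_lintegral_enorm]
      exact (hδ i (p (ns m) - p (ns n)) ((hp _).1.sub (hp _).1)
        (hnsC i _ (hns.monotone hm) _ (hns.monotone hn)) l).trans_lt (hη1 i)
  obtain ⟨h, hh, hlim⟩ := exists_stronglyMeasurable_limit_of_tendsto_ae (f := fun k => p (ns k))
    (fun k => (hp _).1) (by
      filter_upwards [ae_all_iff.mpr hcoord] with θ hθ
      choose z hz using hθ
      exact ⟨z, tendsto_pi_nhds.mpr hz⟩)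
  have hle : ∀ ε : ℝ≥0∞, 0 < ε → ∀ᶠ n in atTop, lalpha α f (h - p n) ≤ ε := by
    intro ε hε
    obtain ⟨n₀, hn₀⟩ := hC ε hε
    filter_upwards [eventually_ge_atTop n₀] with n hn
    calc lalpha α f (h - p n)
        ≤ ∫⁻ θ, liminf (fun k => ENNReal.ofReal (modular α (f θ) ((p (ns k) - p n) θ))) atTop
            ∂freq := by
          rw [lalpha_eq]
          refine lintegral_mono_ae ?_
          filter_upwards [hlim] with θ hθ
          refine (Tendsto.liminf_eq ?_).ge
          exact (ENNReal.continuous_ofReal.comp (continuous_modular hf.one_lt (f θ))).continuousAt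
            |>.tendsto.comp (hθ.sub tendsto_const_nhds)
      _ ≤ liminf (fun k => lalpha α f (p (ns k) - p n)) atTop :=
          lintegral_liminf_le' fun k =>
            (hf.aemeasurable_modular ((hp _).1.sub (hp _).1)).ennreal_ofReal
      _ ≤ ε := by
          refine liminf_le_of_frequently_le' (Eventually.frequently ?_)
          filter_upwards [eventually_ge_atTop n₀] with k hk
          exact hn₀ _ (hk.trans (hns.id_le k)) _ hn
  have hlim0 : Tendsto (fun n => lalpha α f (h - p n)) atTop (𝓝 0) :=
    ENNReal.tendsto_nhds_zero.mpr fun ε hε => hle ε hε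
  refine ⟨h, ?_, hlim0⟩
  obtain ⟨n, hn⟩ := (hle 1 one_pos).exists
  have := hf.memLalpha_add ⟨hh.aestronglyMeasurable.sub (hp n).1, hn.trans_lt ENNReal.one_lt_top⟩
    (hp n)
  rwa [sub_add_cancel] at this

/-- Uniform convexity of `L^α(f)`. -/
lemma IsDensity.exists_lalpha_sub_le (hf : IsDensity α f) {d ε : ℝ} (hd : 0 ≤ d) (hε : 0 < ε) :
    ∃ η > 0, ∀ g h : ℝ → Fin T → ℂ, MemLalpha α f g → MemLalpha α f h →
      (lalpha α f g).toReal ≤ d + η → (lalpha α f h).toReal ≤ d + η →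
      d ≤ (lalpha α f ((1 / 2 : ℂ) • (g + h))).toReal → (lalpha α f (g - h)).toReal ≤ ε := by
  have hδ : 0 < ε / (4 * (d + 1)) := by positivity
  obtain ⟨K, hK, hmod⟩ := exists_modular_sub_le (T := T) hf.one_lt hδ
  set δ := ε / (4 * (d + 1)) with hδ_def
  -- Integrated uniform convexity leaves $K\eta+2\delta(d+\eta)$ after the terms $Kd$ cancel;
  -- $\delta$ and $\eta$ are chosen so that each part is at most $\varepsilon/2$.
  refine ⟨min 1 (ε / (2 * (K + 1))), by positivity, fun g h hg hh h1 h2 h3 => ?_⟩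
  set η := min 1 (ε / (2 * (K + 1))) with hη
  have hη1 : η ≤ 1 := min_le_left _ _
  have hη2 : K * η ≤ ε / 2 := by
    have : η ≤ ε / (2 * (K + 1)) := min_le_right _ _
    rw [le_div_iff₀ (by positivity)] at this
    have h0 : 0 ≤ η := by positivity
    nlinarith
  have hhalf := hf.memLalpha_smul (1 / 2 : ℂ) (hf.memLalpha_add hg hh)
  have hsub := hf.memLalpha_sub hg hh
  have key : (lalpha α f (g - h)).toReal + K * (lalpha α f ((1 / 2 : ℂ) • (g + h))).toReal
      ≤ (K / 2 + δ) * ((lalpha α f g).toReal + (lalpha α f h).toReal) := by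
    rw [hf.toReal_lalpha hg.1, hf.toReal_lalpha hh.1, hf.toReal_lalpha hhalf.1,
      hf.toReal_lalpha hsub.1, ← integral_const_mul, ← integral_add (hf.integrable_modular hsub)
      ((hf.integrable_modular hhalf).const_mul _), ← integral_add (hf.integrable_modular hg)
      (hf.integrable_modular hh), ← integral_const_mul]
    refine integral_mono_ae ((hf.integrable_modular hsub).add
      ((hf.integrable_modular hhalf).const_mul _)) (((hf.integrable_modular hg).add
      (hf.integrable_modular hh)).const_mul _) ?_
    filter_upwards [hf.alphaForm] with θ hθ using hmod _ hθ _ _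
  have h4 : K * d ≤ K * (lalpha α f ((1 / 2 : ℂ) • (g + h))).toReal :=
    mul_le_mul_of_nonneg_left h3 hK
  have h5 : (K / 2 + δ) * ((lalpha α f g).toReal + (lalpha α f h).toReal)
      ≤ (K / 2 + δ) * (2 * (d + η)) := mul_le_mul_of_nonneg_left (by linarith) (by positivity)
  have h6 : 2 * δ * (d + 1) = ε / 2 := by
    rw [hδ_def]; field_simp; norm_num
  have h7 : 2 * δ * (d + η) ≤ 2 * δ * (d + 1) :=
    mul_le_mul_of_nonneg_left (by linarith) (by positivity)
  nlinarith

lemma MemLN.exists_seq {h : ℝ → Fin T → ℂ} (hh : MemLN α N f h) :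
    ∃ q : ℕ → ℝ → Fin T → ℂ, (∀ n, q n ∈ expSpan T N) ∧
      Tendsto (fun n => lalpha α f (h - q n)) atTop (𝓝 0) := by
  choose q hq hqh using fun n : ℕ => hh.2 ((n : ℝ≥0∞) + 1)⁻¹ (by simp)
  refine ⟨q, hq, tendsto_of_tendsto_of_tendsto_of_le_of_le tendsto_const_nhds ?_
    (fun _ => zero_le) (fun n => (hqh n).le)⟩
  have := (tendsto_add_atTop_iff_nat 1).mpr ENNReal.tendsto_inv_nat_nhds_zero
  simpa using this

lemma memLN_of_tendsto {h : ℝ → Fin T → ℂ} (hh : MemLalpha α f h) {q : ℕ → ℝ → Fin T → ℂ}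
    (hq : ∀ n, q n ∈ expSpan T N) (hlim : Tendsto (fun n => lalpha α f (h - q n)) atTop (𝓝 0)) :
    MemLN α N f h := by
  refine ⟨hh, fun ε hε => ?_⟩
  obtain ⟨n, hn⟩ := ((tendsto_order.mp hlim).2 ε hε).exists
  exact ⟨q n, hq n, hn⟩

lemma MemLN.congr {g h : ℝ → Fin T → ℂ} (hh : MemLN α N f h) (hgh : h =ᵐ[freq] g) :
    MemLN α N f g := by
  refine ⟨⟨hh.1.1.congr hgh, lalpha_congr hgh ▸ hh.1.2⟩, fun ε hε => ?_⟩
  obtain ⟨p, hp, hpε⟩ := hh.2 ε hε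
  refine ⟨p, hp, ?_⟩
  rwa [lalpha_congr (hgh.symm.sub (EventuallyEq.refl _ p))]

lemma IsDensity.memLN_linear_comb (hf : IsDensity α f) {g h : ℝ → Fin T → ℂ} (hg : MemLN α N f g)
    (hh : MemLN α N f h) (a b : ℂ) : MemLN α N f (a • g + b • h) := by
  obtain ⟨p, hp, hpg⟩ := hg.exists_seq
  obtain ⟨q, hq, hqh⟩ := hh.exists_seq
  refine memLN_of_tendsto (hf.memLalpha_add (hf.memLalpha_smul _ hg.1) (hf.memLalpha_smul _ hh.1))
    (q := fun n => a • p n + b • q n) (fun n => Submodule.add_mem _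
      (Submodule.smul_mem _ _ (hp n)) (Submodule.smul_mem _ _ (hq n))) ?_
  rw [← hf.tendsto_lnorm_iff] at hpg hqh ⊢
  have h1 := (ENNReal.Tendsto.const_mul (a := ENNReal.ofReal ‖a‖) hpg
    (Or.inr ENNReal.ofReal_ne_top)).add (ENNReal.Tendsto.const_mul (a := ENNReal.ofReal ‖b‖) hqh
    (Or.inr ENNReal.ofReal_ne_top))
  rw [mul_zero, mul_zero, add_zero] at h1
  refine tendsto_of_tendsto_of_tendsto_of_le_of_le tendsto_const_nhds h1 (fun _ => zero_le)
    fun n => ?_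
  have h2 : a • g + b • h - (a • p n + b • q n) = a • (g - p n) + b • (h - q n) := by
    rw [smul_sub, smul_sub]; abel
  simp only
  rw [h2, ← hf.lnorm_smul, ← hf.lnorm_smul]
  exact hf.lnorm_add_le ((hg.1.1.sub (hf.memLalpha_expSpan (hp n)).1).const_smul a)
    ((hh.1.1.sub (hf.memLalpha_expSpan (hq n)).1).const_smul b)

lemma IsDensity.memLN_expSpan (hf : IsDensity α f) {p : ℝ → Fin T → ℂ} (hp : p ∈ expSpan T N) :
    MemLN α N f p :=
  ⟨hf.memLalpha_expSpan hp, fun ε hε => ⟨p, hp, by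
    rw [sub_self, ← zero_smul ℂ (0 : ℝ → Fin T → ℂ), hf.lalpha_smul, norm_zero,
      Real.zero_rpow (by linarith [hf.one_lt]), ENNReal.ofReal_zero, zero_mul]
    exact hε⟩⟩

/-- The elements of `L^α(f)` have best approximations in `L_N^α(f)`. -/
lemma IsDensity.exists_best_approx (hf : IsDensity α f) (N : ℕ) {A : ℝ → Fin T → ℂ}
    (hA : MemLalpha α f A) : ∃ h, MemLN α N f h ∧
      ∀ g, MemLN α N f g → lalpha α f (A - h) ≤ lalpha α f (A - g) := by
  -- The infimum is taken over trigonometric polynomials only; by density it also bounds the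
  -- distance to the closed space from below. Midpoints of a minimizing sequence stay in the span,
  -- so uniform convexity makes the sequence Cauchy.
  set S : Set ℝ := (fun p => (lalpha α f (A - p)).toReal) '' (expSpan T N : Set _) with hS
  have hbdd : BddBelow S := ⟨0, by rintro _ ⟨p, -, rfl⟩; exact ENNReal.toReal_nonneg⟩
  have hne : S.Nonempty := ⟨_, 0, Submodule.zero_mem _, rfl⟩
  set d := sInf S with hd
  have hd0 : 0 ≤ d := le_csInf hne (by rintro _ ⟨p, -, rfl⟩; exact ENNReal.toReal_nonneg)
  have hdle : ∀ p ∈ expSpan T N, d ≤ (lalpha α f (A - p)).toReal := fun p hp =>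
    csInf_le hbdd ⟨p, hp, rfl⟩
  have hsub : ∀ p ∈ expSpan T N, MemLalpha α f (A - p) := fun p hp =>
    hf.memLalpha_sub hA (hf.memLalpha_expSpan hp)
  have hex : ∀ n : ℕ, ∃ p ∈ expSpan T N, (lalpha α f (A - p)).toReal ≤ d + 1 / ((n : ℝ) + 1) := by
    intro n
    obtain ⟨_, ⟨p, hp, rfl⟩, hlt⟩ := exists_lt_of_csInf_lt hne
      (show sInf S < d + 1 / ((n : ℝ) + 1) from lt_add_of_pos_right _ (by positivity))
    exact ⟨p, hp, hlt.le⟩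
  choose p hp hpd using hex
  obtain ⟨h, hh, hlim⟩ := hf.exists_tendsto_of_cauchy (p := p)
    (fun n => hf.memLalpha_expSpan (hp n)) (by
      intro ε hε
      obtain ⟨r, hr0, hr⟩ : ∃ r : ℝ, 0 < r ∧ ENNReal.ofReal r ≤ ε := by
        obtain ⟨r, hr0, hr⟩ := ENNReal.lt_iff_exists_nnreal_btwn.mp hε
        exact ⟨r, by exact_mod_cast hr0, by simpa using hr.le⟩
      obtain ⟨η, hη, H⟩ := hf.exists_lalpha_sub_le hd0 hr0
      obtain ⟨n₀, hn₀⟩ := exists_nat_one_div_lt hη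
      have hle : ∀ n ≥ n₀, (lalpha α f (A - p n)).toReal ≤ d + η := fun n hn =>
        (hpd n).trans (add_le_add_right ((one_div_le_one_div_of_le (by positivity)
          (by exact_mod_cast Nat.succ_le_succ hn)).trans hn₀.le) _)
      refine ⟨n₀, fun m hm n hn => ?_⟩
      have h1 := H (A - p n) (A - p m) (hsub _ (hp n)) (hsub _ (hp m)) (hle n hn) (hle m hm) (by
        have : (1 / 2 : ℂ) • (A - p n + (A - p m)) = A - (1 / 2 : ℂ) • (p n + p m) := by
          ext θ l; simp; ring
        rw [this]
        exact hdle _ (Submodule.smul_mem _ _ (Submodule.add_mem _ (hp n) (hp m))))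
      rw [sub_sub_sub_cancel_left] at h1
      have hfin := (hf.memLalpha_sub (hf.memLalpha_expSpan (hp m)) (hf.memLalpha_expSpan (hp n))).2
      rw [← ENNReal.ofReal_toReal hfin.ne]
      exact (ENNReal.ofReal_le_ofReal h1).trans hr)
  refine ⟨h, memLN_of_tendsto hh hp hlim, fun g hg => ?_⟩
  have hconv : ∀ (u : ℝ → Fin T → ℂ) (q : ℕ → ℝ → Fin T → ℂ), MemLalpha α f u →
      (∀ n, q n ∈ expSpan T N) → Tendsto (fun n => lalpha α f (u - q n)) atTop (𝓝 0) →
      Tendsto (fun n => (lalpha α f (A - q n)).toReal) atTop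
        (𝓝 (lalpha α f (A - u)).toReal) := by
    intro u q hu hq hlim
    have hAu := hf.memLalpha_sub hA hu
    refine (ENNReal.tendsto_toReal hAu.2.ne).comp (hf.tendsto_lalpha (fun n => (hsub _ (hq n)).1)
      hAu ?_)
    simp_rw [sub_sub_sub_cancel_left, hf.lalpha_sub_comm _ u]
    exact hlim
  have h1 : (lalpha α f (A - h)).toReal ≤ d := by
    have := (tendsto_one_div_add_atTop_nhds_zero_nat (𝕜 := ℝ)).const_add d
    rw [add_zero] at this
    exact le_of_tendsto_of_tendsto' (hconv h p hh hp hlim) this hpd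
  obtain ⟨q, hq, hqg⟩ := hg.exists_seq
  have h2 : d ≤ (lalpha α f (A - g)).toReal :=
    ge_of_tendsto' (hconv g q hg.1 hq hqg) fun n => hdle _ (hq n)
  exact (ENNReal.toReal_le_toReal (hf.memLalpha_sub hA hh).2.ne
    (hf.memLalpha_sub hA hg.1).2.ne).mp (h1.trans h2)

/-- Best approximations are unique. -/
lemma IsDensity.lalpha_sub_eq_zero (hf : IsDensity α f) {A g h : ℝ → Fin T → ℂ}
    (hA : MemLalpha α f A) (hh : MemLN α N f h)
    (hmin : ∀ u, MemLN α N f u → lalpha α f (A - h) ≤ lalpha α f (A - u)) (hg : MemLN α N f g)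
    (hgh : lalpha α f (A - g) ≤ lalpha α f (A - h)) : lalpha α f (g - h) = 0 := by
  have hAh := hf.memLalpha_sub hA hh.1
  have hAg := hf.memLalpha_sub hA hg.1
  suffices h0 : (lalpha α f (g - h)).toReal = 0 from
    ((ENNReal.toReal_eq_zero_iff _).mp h0).resolve_right (hf.memLalpha_sub hg.1 hh.1).2.ne
  refine le_antisymm (le_of_forall_pos_le_add fun ε hε => ?_) ENNReal.toReal_nonneg
  rw [zero_add]
  obtain ⟨η, hη, H⟩ := hf.exists_lalpha_sub_le (d := (lalpha α f (A - h)).toReal)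
    ENNReal.toReal_nonneg hε
  have := H (A - h) (A - g) hAh hAg (by linarith)
    ((ENNReal.toReal_mono hAh.2.ne hgh).trans (by linarith)) (by
      have h1 : (1 / 2 : ℂ) • (A - h + (A - g)) = A - ((1 / 2 : ℂ) • h + (1 / 2 : ℂ) • g) := by
        ext θ l; simp; ring
      have hmid := hf.memLN_linear_comb hh hg (1 / 2) (1 / 2)
      rw [h1]
      exact ENNReal.toReal_mono (hf.memLalpha_sub hA hmid.1).2.ne (hmin _ hmid))
  rwa [sub_sub_sub_cancel_left] at this

end StableInterp
end

noncomputable section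

namespace StableInterp

variable {T : ℕ} {α : ℝ}

/-! ### Orthogonality and the system of equations -/

lemma form_add_left (F : Matrix (Fin T) (Fin T) ℂ) (u v w : Fin T → ℂ) :
    form α F (u + v) w = form α F u w + form α F v w := add_dotProduct _ _ _

lemma form_smul_left (F : Matrix (Fin T) (Fin T) ℂ) (c : ℂ) (u w : Fin T → ℂ) :
    form α F (c • u) w = c * form α F u w := smul_dotProduct _ _ _

lemma continuous_form (hα : 1 < α) (F : Matrix (Fin T) (Fin T) ℂ) (u : Fin T → ℂ) :
    Continuous (form α F u) := by
  have h : Continuous fun v : Fin T → ℂ => vpow v (α - 1) := continuous_vpow (by linarith)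
  unfold form
  exact continuous_const.dotProduct (Continuous.matrix_mulVec continuous_const h)

lemma IsAlphaForm.modular_add_le {F : Matrix (Fin T) (Fin T) ℂ} (hF : IsAlphaForm α F)
    (hα : 1 < α) (u v : Fin T → ℂ) :
    modular α F (u + v) ≤ 2 ^ α * (modular α F u + modular α F v) := by
  have h := hF.modular_add_rpow_le hα u v
  have hα0 : 0 < α := by linarith
  have h0 := hF.modular_nonneg hα (u + v)
  generalize modular α F u = x, hF.modular_nonneg hα u = hx at *
  generalize modular α F v = y, hF.modular_nonneg hα v = hy at *
  have h1 : modular α F (u + v) ^ (1 / α) ≤ 2 * (x + y) ^ (1 / α) := by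
    have hx1 : x ^ (1 / α) ≤ (x + y) ^ (1 / α) :=
      Real.rpow_le_rpow hx (by linarith) (by positivity)
    have hy1 : y ^ (1 / α) ≤ (x + y) ^ (1 / α) :=
      Real.rpow_le_rpow hy (by linarith) (by positivity)
    linarith
  have h2 := Real.rpow_le_rpow (by positivity) h1 hα0.le
  rwa [Real.mul_rpow (by norm_num) (by positivity), ← Real.rpow_mul h0,
    ← Real.rpow_mul (by positivity), one_div_mul_cancel hα0.ne', Real.rpow_one,
    Real.rpow_one] at h2

/-- The Bregman inequality based at the perturbed point. Taking the slope there rather than at $e$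
bounds the difference from above, so minimality can be exploited without differentiating the norm.
-/
lemma IsAlphaForm.modular_add_smul_sub_le {F : Matrix (Fin T) (Fin T) ℂ} (hF : IsAlphaForm α F)
    (hα : 1 < α) (e p : Fin T → ℂ) (s : ℝ) :
    modular α F (e + (s : ℂ) • p) - modular α F e
      ≤ α * s * (form α F p (e + (s : ℂ) • p)).re := by
  have h := hF.alpha_mul_re_form_le hα e (e + (s : ℂ) • p)
  have h1 : modular α F (e + (s : ℂ) • p) = (form α F e (e + (s : ℂ) • p)).re
      + s * (form α F p (e + (s : ℂ) • p)).re := by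
    rw [modular, form_add_left, form_smul_left, Complex.add_re, Complex.re_ofReal_mul]
  nlinarith

variable {f : ℝ → Matrix (Fin T) (Fin T) ℂ} {N : ℕ}

namespace IsDensity

lemma integrable_form (hf : IsDensity α f) {g h : ℝ → Fin T → ℂ} (hg : MemLalpha α f g)
    (hh : MemLalpha α f h) : Integrable (fun θ => form α (f θ) (g θ) (h θ)) freq := by
  refine ((hf.integrable_modular hg).add (hf.integrable_modular hh)).mono'
    (hf.aestronglyMeasurable_form hg.1 hh.1) ?_
  filter_upwards [hf.alphaForm] with θ hθ using hθ.norm_form_le hf.one_lt _ _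

/-- Minimality bounds $\alpha s\int\operatorname{Re}$ of the form at $e+sp$ below by $0$. Divide by
$\alpha s$ and let $s\downarrow0$ by dominated convergence. -/
lemma integral_re_form_nonneg (hf : IsDensity α f) {e p : ℝ → Fin T → ℂ} (he : MemLalpha α f e)
    (hp : MemLalpha α f p) (h : ∀ s : ℝ, lalpha α f e ≤ lalpha α f (e + (s : ℂ) • p)) :
    0 ≤ ∫ θ, (form α (f θ) (p θ) (e θ)).re ∂freq := by
  have hα := hf.one_lt
  set s : ℕ → ℝ := fun n => 1 / ((n : ℝ) + 1) with hs
  have hs0 : ∀ n, 0 < s n := fun n => by positivity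
  have hs1 : ∀ n, s n ≤ 1 := fun n => by
    rw [hs, div_le_one (by positivity)]; linarith [n.cast_nonneg (α := ℝ)]
  have hmem : ∀ n, MemLalpha α f (e + (s n : ℂ) • p) := fun n =>
    hf.memLalpha_add he (hf.memLalpha_smul _ hp)
  have hnonneg : ∀ n, 0 ≤ ∫ θ, (form α (f θ) (p θ) ((e + (s n : ℂ) • p) θ)).re ∂freq := by
    intro n
    have h1 := ENNReal.toReal_mono (hmem n).2.ne (h (s n))
    rw [hf.toReal_lalpha he.1, hf.toReal_lalpha (hmem n).1] at h1
    have h2 : ∫ θ, (modular α (f θ) ((e + (s n : ℂ) • p) θ) - modular α (f θ) (e θ)) ∂freq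
        ≤ ∫ θ, α * s n * (form α (f θ) (p θ) ((e + (s n : ℂ) • p) θ)).re ∂freq := by
      refine integral_mono_ae ((hf.integrable_modular (hmem n)).sub (hf.integrable_modular he))
        ((hf.integrable_form hp (hmem n)).re.const_mul _) ?_
      filter_upwards [hf.alphaForm] with θ hθ using hθ.modular_add_smul_sub_le hα _ _ _
    rw [integral_sub (hf.integrable_modular (hmem n)) (hf.integrable_modular he),
      integral_const_mul] at h2
    have h3 : 0 < α * s n := mul_pos (by linarith) (hs0 n)
    exact nonneg_of_mul_nonneg_right (by linarith) h3
  have hlim : Tendsto (fun n => ∫ θ, (form α (f θ) (p θ) ((e + (s n : ℂ) • p) θ)).re ∂freq) atTop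
      (𝓝 (∫ θ, (form α (f θ) (p θ) (e θ)).re ∂freq)) := by
    refine tendsto_integral_of_dominated_convergence
      (fun θ => modular α (f θ) (p θ)
        + 2 ^ α * (modular α (f θ) (e θ) + modular α (f θ) (p θ)))
      (fun n => (hf.integrable_form hp (hmem n)).re.aestronglyMeasurable)
      ((hf.integrable_modular hp).add (((hf.integrable_modular he).add
        (hf.integrable_modular hp)).const_mul _)) (fun n => ?_) ?_
    · filter_upwards [hf.alphaForm] with θ hθ
      rw [Real.norm_eq_abs]
      refine (Complex.abs_re_le_norm _).trans ((hθ.norm_form_le hα _ _).trans ?_)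
      refine add_le_add_right ((hθ.modular_add_le hα _ _).trans
        (mul_le_mul_of_nonneg_left (add_le_add_right ?_ _) (by positivity))) _
      rw [Pi.smul_apply, hθ.modular_smul hα]
      refine mul_le_of_le_one_left (hθ.modular_nonneg hα _) ?_
      rw [Complex.norm_real, Real.norm_of_nonneg (hs0 n).le]
      exact Real.rpow_le_one (hs0 n).le (hs1 n) (by linarith)
    · refine Eventually.of_forall fun θ => ?_
      have hs : Tendsto (fun n => e θ + (s n : ℂ) • p θ) atTop (𝓝 (e θ)) := by
        have h1 : Tendsto (fun n => (s n : ℂ)) atTop (𝓝 ((0 : ℝ) : ℂ)) :=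
          (Complex.continuous_ofReal.tendsto 0).comp tendsto_one_div_add_atTop_nhds_zero_nat
        simpa using (h1.smul_const (p θ)).const_add (e θ)
      exact (Complex.continuous_re.comp (continuous_form hα (f θ) (p θ))).continuousAt.tendsto.comp
        hs
  exact ge_of_tendsto' hlim hnonneg

/-- The variational characterization of the error of a best approximation. -/
lemma integral_form_eq_zero (hf : IsDensity α f) {e : ℝ → Fin T → ℂ} (he : MemLalpha α f e)
    (h : ∀ p ∈ expSpan T N, lalpha α f e ≤ lalpha α f (e + p)) {p : ℝ → Fin T → ℂ}
    (hp : p ∈ expSpan T N) : ∫ θ, form α (f θ) (p θ) (e θ) ∂freq = 0 := by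
  -- The span is complex, so $p$ may be multiplied by any $c$; the values $\pm1,\pm i$ leave only
  -- the integral $0$.
  have hre : ∀ c : ℂ, 0 ≤ (c * ∫ θ, form α (f θ) (p θ) (e θ) ∂freq).re := by
    intro c
    have hcp := Submodule.smul_mem _ c hp
    have hmem := hf.memLalpha_expSpan hcp
    have h1 := hf.integral_re_form_nonneg he hmem
      fun s => h _ (Submodule.smul_mem _ (s : ℂ) hcp)
    have h2 : ∫ θ, (form α (f θ) ((c • p) θ) (e θ)).re ∂freq
        = (∫ θ, form α (f θ) ((c • p) θ) (e θ) ∂freq).re :=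
      integral_re (hf.integrable_form hmem he)
    rw [h2] at h1
    simp only [Pi.smul_apply, form_smul_left] at h1
    rwa [integral_const_mul] at h1
  generalize ∫ θ, form α (f θ) (p θ) (e θ) ∂freq = z at hre
  have h1 := hre 1
  have h2 := hre (-1)
  have h3 := hre Complex.I
  have h4 := hre (-Complex.I)
  simp at h1 h2 h3 h4
  exact Complex.ext (le_antisymm h2 h1) (le_antisymm h3 h4)

lemma errChar_eq (hf : IsDensity α f) {e : ℝ → Fin T → ℂ} {c : Fin (N + 1) → Fin T → ℂ}
    (h : (fun θ => f θ *ᵥ vpow (e θ) (α - 1)) =ᵐ[freq] polyC c) : errChar α f c =ᵐ[freq] e := by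
  have hα : 0 < α - 1 := by linarith [hf.one_lt]
  filter_upwards [h, hf.posDef] with θ hθ hpos
  rw [errChar, ← hθ, Matrix.mulVec_mulVec, Matrix.nonsing_inv_mul _
    ((Matrix.isUnit_iff_isUnit_det _).mp hpos.isUnit), Matrix.one_mulVec,
    vpow_vpow hα (mul_one_div_cancel hα.ne')]

lemma mulVec_vpow_errChar (hf : IsDensity α f) (c : Fin (N + 1) → Fin T → ℂ) :
    (fun θ => f θ *ᵥ vpow (errChar α f c θ) (α - 1)) =ᵐ[freq] polyC c := by
  have hα : 0 < α - 1 := by linarith [hf.one_lt]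
  filter_upwards [hf.posDef] with θ hpos
  rw [errChar, vpow_vpow (by positivity) (one_div_mul_cancel hα.ne'), Matrix.mulVec_mulVec,
    Matrix.mul_nonsing_inv _ ((Matrix.isUnit_iff_isUnit_det _).mp hpos.isUnit), Matrix.one_mulVec]

/-- The error of a best approximation is `(f⁻¹ C_N)^{<1/(α-1)>}`. -/
lemma exists_errChar_eq (hf : IsDensity α f) {e : ℝ → Fin T → ℂ} (he : MemLalpha α f e)
    (h : ∀ p ∈ expSpan T N, lalpha α f e ≤ lalpha α f (e + p)) :
    ∃ c : Fin (N + 1) → Fin T → ℂ, errChar α f c =ᵐ[freq] e := by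
  have hform : ∀ (m : ℤ) (l : Fin T) (θ : ℝ), form α (f θ) (Pi.single l (ex m θ)) (e θ)
      = ex m θ * (f θ *ᵥ vpow (e θ) (α - 1)) l := fun m l θ => single_dotProduct _ _ _
  have hbdd : ∀ (m : ℤ) (l : Fin T), MemLalpha α f fun θ => Pi.single l (ex m θ) := fun m l =>
    hf.memLalpha_of_bounded (continuous_single_ex l m).aestronglyMeasurable
      fun θ => (norm_single_ex l m θ).le
  obtain ⟨c, hc⟩ := exists_eq_polyC (N := N) (G := fun θ => f θ *ᵥ vpow (e θ) (α - 1))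
    (fun l => by
      have := hf.integrable_form (hbdd 0 l) he
      simp_rw [hform, ex_zero, one_mul] at this
      exact this)
    (fun m hm l => by
      have := hf.integral_form_eq_zero he h (p := fun θ => Pi.single l (ex m θ))
        (Submodule.subset_span ⟨m, l, hm, rfl⟩)
      simp_rw [hform] at this
      exact this)
  exact ⟨c, hf.errChar_eq hc⟩

end IsDensity

lemma memLalpha_polyA (hf : IsDensity α f) (a : Fin (N + 1) → Fin T → ℂ) :
    MemLalpha α f (polyA a) := by
  refine hf.memLalpha_of_bounded (C := ∑ j, ‖a j‖) ?_ fun θ => norm_sum_le_of_le _ fun j _ => ?_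
  · unfold polyA
    exact (continuous_finsetSum _ fun j _ =>
      (continuous_ex _).smul continuous_const).aestronglyMeasurable
  · rw [norm_smul, norm_ex, one_mul]

/-- The best approximation of `A_N` in `L_N^α(f)` is `A_N - (f⁻¹ C_N)^{<1/(α-1)>}` for a solution
`C_N` of the system. -/
lemma IsDensity.exists_solvesSystem (hf : IsDensity α f) (a : Fin (N + 1) → Fin T → ℂ) :
    ∃ c, SolvesSystem α f a c ∧ MemLN α N f (specChar α f a c) ∧ MemLalpha α f (errChar α f c) ∧
      ∀ g, MemLN α N f g → lalpha α f (errChar α f c) ≤ lalpha α f (polyA a - g) := by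
  have hA := memLalpha_polyA hf a
  obtain ⟨h, hh, hmin⟩ := hf.exists_best_approx N hA
  have he := hf.memLalpha_sub hA hh.1
  obtain ⟨c, hc⟩ := hf.exists_errChar_eq he (N := N) fun p hp => by
    have := hmin _ (hf.memLN_linear_comb hh (hf.memLN_expSpan hp) 1 (-1))
    rwa [one_smul, neg_one_smul, ← sub_eq_add_neg, ← sub_add] at this
  have hs : h =ᵐ[freq] specChar α f a c := by
    filter_upwards [hc] with θ hθ
    rw [specChar, hθ, Pi.sub_apply, sub_sub_cancel]
  have hLN := hh.congr hs
  refine ⟨c, fun k l => ⟨integrable_ex_mul (hf.integrable_apply hLN.1 l) _,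
    hLN.integral_eq_zero hf k l⟩, hLN, ⟨he.1.congr hc.symm, lalpha_congr hc ▸ he.2⟩, fun g hg => ?_⟩
  rw [lalpha_congr hc]
  exact hmin g hg

/-- $A_N$ cancels in the difference of two errors, and the frequencies of any $C_N$ are exactly
those that the system annihilates. -/
lemma SolvesSystem.integral_errChar_sub {a c c' d : Fin (N + 1) → Fin T → ℂ}
    (hc : SolvesSystem α f a c) (hc' : SolvesSystem α f a c') :
    Integrable (fun θ => (errChar α f c θ - errChar α f c' θ) ⬝ᵥ polyC d θ) freq ∧
      ∫ θ, (errChar α f c θ - errChar α f c' θ) ⬝ᵥ polyC d θ ∂freq = 0 := by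
  have heq : ∀ θ, (errChar α f c θ - errChar α f c' θ) ⬝ᵥ polyC d θ
      = ∑ l, ∑ j : Fin (N + 1), (ex (-((j : ℕ) : ℤ)) θ * specChar α f a c' θ l
        - ex (-((j : ℕ) : ℤ)) θ * specChar α f a c θ l) * d j l := by
    intro θ
    simp only [dotProduct, polyC_apply, Finset.mul_sum, specChar, Pi.sub_apply]
    refine Finset.sum_congr rfl fun l _ => Finset.sum_congr rfl fun j _ => ?_
    ring
  have hint : ∀ l (j : Fin (N + 1)), Integrable (fun θ =>
      (ex (-((j : ℕ) : ℤ)) θ * specChar α f a c' θ l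
        - ex (-((j : ℕ) : ℤ)) θ * specChar α f a c θ l) * d j l) freq := fun l j =>
    (Integrable.sub (hc' j l).1 (hc j l).1).mul_const _
  simp_rw [heq]
  refine ⟨integrable_finsetSum _ fun l _ => integrable_finsetSum _ fun j _ => hint l j, ?_⟩
  rw [integral_finsetSum _ fun l _ => integrable_finsetSum _ fun j _ => hint l j]
  refine Finset.sum_eq_zero fun l _ => ?_
  rw [integral_finsetSum _ fun j _ => hint l j]
  refine Finset.sum_eq_zero fun j _ => ?_
  rw [integral_mul_const, integral_sub (hc' j l).1 (hc j l).1, (hc' j l).2, (hc j l).2, sub_zero,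
    zero_mul]

/-- The system has at most one solution. -/
lemma IsDensity.solvesSystem_unique (hf : IsDensity α f) {a c c' : Fin (N + 1) → Fin T → ℂ}
    (hc : SolvesSystem α f a c) (hc' : SolvesSystem α f a c') : c = c' := by
  have hα := hf.one_lt
  obtain ⟨hi1, h1⟩ := hc.integral_errChar_sub (d := c) hc'
  obtain ⟨hi2, h2⟩ := hc.integral_errChar_sub (d := c') hc'
  set e := errChar α f c with he
  set e' := errChar α f c' with he'
  -- This is $\operatorname{Re}(e-e')^\top(C_N-C_N')$ with $C_N=f e^{<\alpha-1>}$, the monotonicity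
  -- expression of the signed power. Its integral is $0$, and it is nonnegative by the sum of two
  -- Bregman inequalities; where it vanishes both are equalities.
  set D : ℝ → ℝ := fun θ =>
    ((e θ - e' θ) ⬝ᵥ polyC c θ - (e θ - e' θ) ⬝ᵥ polyC c' θ).re with hD
  have hDint : Integrable D freq := (hi1.sub hi2).re
  have hD0 : ∫ θ, D θ ∂freq = 0 := by
    have h3 : ∫ θ, D θ ∂freq
        = (∫ θ, ((e θ - e' θ) ⬝ᵥ polyC c θ - (e θ - e' θ) ⬝ᵥ polyC c' θ) ∂freq).re :=
      integral_re (hi1.sub hi2)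
    rw [h3, integral_sub hi1 hi2, h1, h2, sub_zero, Complex.zero_re]
  have hDeq : ∀ᵐ θ ∂freq, IsAlphaForm α (f θ) ∧
      D θ = modular α (f θ) (e θ) + modular α (f θ) (e' θ) - (form α (f θ) (e' θ) (e θ)).re
        - (form α (f θ) (e θ) (e' θ)).re := by
    filter_upwards [hf.alphaForm, hf.mulVec_vpow_errChar c, hf.mulVec_vpow_errChar c']
      with θ hθ h3 h4
    refine ⟨hθ, ?_⟩
    simp only [hD]
    rw [← h3, ← h4, sub_dotProduct, sub_dotProduct]
    simp only [modular, form, Complex.sub_re]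
    ring
  have hDnonneg : 0 ≤ᵐ[freq] D := by
    filter_upwards [hDeq] with θ ⟨hθ, h⟩
    have h3 := hθ.alpha_mul_re_form_le hα (e θ) (e' θ)
    have h4 := hθ.alpha_mul_re_form_le hα (e' θ) (e θ)
    rw [Pi.zero_apply, h]
    nlinarith
  have hDz := (integral_eq_zero_iff_of_nonneg_ae hDnonneg hDint).mp hD0
  refine polyC_injective ?_
  filter_upwards [hDeq, hDz, hf.mulVec_vpow_errChar c, hf.mulVec_vpow_errChar c']
    with θ ⟨hθ, h⟩ hz h5 h6
  have h3 := hθ.alpha_mul_re_form_le hα (e θ) (e' θ)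
  have h4 := hθ.alpha_mul_re_form_le hα (e' θ) (e θ)
  rw [hz, Pi.zero_apply] at h
  have h7 : e θ = e' θ := by
    refine hθ.eq_of_alpha_mul_re_form_eq hα (le_antisymm h3 ?_)
    nlinarith
  rw [← h5, ← h6, ← he, ← he', h7]

end StableInterp
end

noncomputable section

namespace StableInterp

variable {Ω : Type*} [MeasurableSpace Ω] {P : Measure Ω} [IsProbabilityMeasure P] {T : ℕ} {α : ℝ}
  {Z : ℝ → Ω → Fin T → ℂ} {f : ℝ → Matrix (Fin T) (Fin T) ℂ} {N : ℕ} {ξ : ℤ → Ω → ℂ}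

/-! ### The observed values as stochastic integrals -/

lemma IsStochIntegral.sum (hf : IsDensity α f) {ι : Type*} (s : Finset ι) (c : ι → ℂ)
    {h : ι → ℝ → Fin T → ℂ} {X : ι → Ω → ℂ} (hX : ∀ i, IsStochIntegral α P Z f (h i) (X i)) :
    IsStochIntegral α P Z f (∑ i ∈ s, c i • h i) (∑ i ∈ s, c i • X i) := by
  classical
  induction s using Finset.induction_on with
  | empty => simpa using isStochIntegral_zero hf
  | insert i s hi ih =>
    rw [Finset.sum_insert hi, Finset.sum_insert hi]
    simpa using (hX i).linear_comb ih hf (c i) 1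

lemma isStochIntegral_functional (hf : IsDensity α f)
    (hrepr : ∀ n k, IsStochIntegral α P Z f (fun θ => Pi.single k (ex n θ)) (block T ξ n k))
    (a : Fin (N + 1) → Fin T → ℂ) :
    IsStochIntegral α P Z f (polyA a) (functional a ξ) := by
  have h := IsStochIntegral.sum hf (Finset.univ : Finset (Fin (N + 1) × Fin T))
    (fun i => a i.1 i.2) (fun i => hrepr ((i.1 : ℕ) : ℤ) i.2)
  convert h using 1
  · ext θ l
    simp [polyA, Fintype.sum_prod_type, Pi.single_apply, mul_comm]
  · ext ω
    simp [functional, Fintype.sum_prod_type, block]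

/-- Division with remainder of the time index by $T$: the index lies in $\{0,\dots,T(N+1)-1\}$
exactly when its block number lies in $\{0,\dots,N\}$. -/
lemma exists_expSpan_of_mem_span (hf : IsDensity α f) (hT : 1 ≤ T)
    (hrepr : ∀ n k, IsStochIntegral α P Z f (fun θ => Pi.single k (ex n θ)) (block T ξ n k))
    {ζ : Ω → ℂ} (hζ : ζ ∈ Submodule.span ℂ (ξ '' (Set.Ico 0 ((T : ℤ) * (N + 1)))ᶜ)) :
    ∃ p ∈ expSpan T N, IsStochIntegral α P Z f p ζ := by
  refine Submodule.span_induction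
    (p := fun ζ _ => ∃ p ∈ expSpan T N, IsStochIntegral α P Z f p ζ) ?_ ?_ ?_ ?_ hζ
  · rintro _ ⟨m, hm, rfl⟩
    have hT0 : (0 : ℤ) < T := by exact_mod_cast hT
    have h1 := Int.emod_nonneg m hT0.ne'
    have h2 := Int.emod_lt_of_pos m hT0
    have h3 := Int.mul_ediv_add_emod m T
    refine ⟨_, Submodule.subset_span ⟨m / T, ⟨(m % T).toNat, by omega⟩, ?_, rfl⟩, ?_⟩
    · rintro ⟨h4, h5⟩
      refine hm ⟨by nlinarith, ?_⟩
      have : m / T ≤ N := by omega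
      nlinarith
    · convert hrepr (m / T) ⟨(m % T).toNat, by omega⟩ using 1
      rw [block]
      congr 1
      rw [Int.toNat_of_nonneg h1, mul_comm, h3]
  · exact ⟨0, Submodule.zero_mem _, isStochIntegral_zero hf⟩
  · rintro X Y - - ⟨p, hp, hpX⟩ ⟨q, hq, hqY⟩
    exact ⟨p + q, Submodule.add_mem _ hp hq, by simpa using hpX.linear_comb hqY hf 1 1⟩
  · rintro c X - ⟨p, hp, hpX⟩
    exact ⟨c • p, Submodule.smul_mem _ c hp, by simpa using hpX.linear_comb hpX hf c 0⟩

lemma exists_mem_span_of_expSpan (hf : IsDensity α f)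
    (hrepr : ∀ n k, IsStochIntegral α P Z f (fun θ => Pi.single k (ex n θ)) (block T ξ n k))
    {p : ℝ → Fin T → ℂ} (hp : p ∈ expSpan T N) :
    ∃ ζ ∈ Submodule.span ℂ (ξ '' (Set.Ico 0 ((T : ℤ) * (N + 1)))ᶜ),
      IsStochIntegral α P Z f p ζ := by
  refine Submodule.span_induction
    (p := fun p _ => ∃ ζ ∈ Submodule.span ℂ (ξ '' (Set.Ico 0 ((T : ℤ) * (N + 1)))ᶜ),
      IsStochIntegral α P Z f p ζ) ?_ ?_ ?_ ?_ hp
  · rintro _ ⟨j, k, hj, rfl⟩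
    refine ⟨_, Submodule.subset_span ⟨j * T + (k : ℕ), ?_, rfl⟩, hrepr j k⟩
    have hk : ((k : ℕ) : ℤ) < T := by exact_mod_cast k.2
    have hk0 : 0 ≤ ((k : ℕ) : ℤ) := by positivity
    rintro ⟨h1, h2⟩
    refine hj ⟨?_, ?_⟩ <;> by_contra! h
    · nlinarith [show j + 1 ≤ 0 by omega]
    · nlinarith
  · exact ⟨0, Submodule.zero_mem _, isStochIntegral_zero hf⟩
  · rintro p q - - ⟨X, hX, hpX⟩ ⟨Y, hY, hqY⟩
    exact ⟨X + Y, Submodule.add_mem _ hX hY, by simpa using hpX.linear_comb hqY hf 1 1⟩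
  · rintro c p - ⟨X, hX, hpX⟩
    exact ⟨c • X, Submodule.smul_mem _ c hX, by simpa using hpX.linear_comb hpX hf c 0⟩

lemma IsDensity.tendsto_lalpha_sub (hf : IsDensity α f) {h : ℝ → Fin T → ℂ}
    {q : ℕ → ℝ → Fin T → ℂ} (hh : MemLalpha α f h) (hq : ∀ n, MemLalpha α f (q n))
    (hlim : Tendsto (fun n => lalpha α f (h - q n)) atTop (𝓝 0)) :
    Tendsto (fun i : ℕ × ℕ => lalpha α f (q i.1 - q i.2)) atTop (𝓝 0) := by
  rw [← hf.tendsto_lnorm_iff] at hlim ⊢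
  rw [← prod_atTop_atTop_eq]
  have h1 := (hlim.comp tendsto_snd).add (hlim.comp (tendsto_fst (f := atTop) (g := atTop)))
  rw [add_zero] at h1
  refine tendsto_of_tendsto_of_tendsto_of_le_of_le tendsto_const_nhds h1 (fun _ => zero_le)
    fun i => ?_
  have h2 := hf.lnorm_sub_le (hh.1.sub (hq i.2).1) (hh.1.sub (hq i.1).1)
  rwa [sub_sub_sub_cancel_left] at h2

/-- The stochastic integrals of the functions in `L_N^α(f)` exist and are observed. -/
lemma exists_mem_observed (hf : IsDensity α f) (hZ : HasSpectralDensity α P Z f)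
    (hrepr : ∀ n k, IsStochIntegral α P Z f (fun θ => Pi.single k (ex n θ)) (block T ξ n k))
    {h : ℝ → Fin T → ℂ} (hh : MemLN α N f h) :
    ∃ Y ∈ observed α T N P ξ, IsStochIntegral α P Z f h Y := by
  have hα := hf.one_lt
  have hα0 : 0 < α := by linarith
  obtain ⟨q, hq, hlim⟩ := hh.exists_seq
  choose ζ hζ hqζ using fun n => exists_mem_span_of_expSpan hf hrepr (hq n)
  obtain ⟨ns, Y, hns, hY⟩ := exists_subseq_tendstoInMeasure (P := P) (X := ζ)
    (fun n => ((hqζ n).hasScale hf hZ).aemeasurable) (by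
      intro ε hε
      obtain ⟨δ, hδ, H⟩ := exists_scale_le_measure_le (P := P) hα0 hε
      have hev := (tendsto_order.mp (hf.tendsto_lalpha_sub hh.1
        (fun n => hf.memLalpha_expSpan (hq n)) hlim)).2 _ (ENNReal.ofReal_pos.mpr hδ)
      obtain ⟨⟨n₁, n₂⟩, hn⟩ := eventually_atTop.mp hev
      refine ⟨max n₁ n₂, fun m hm n hn' => ?_⟩
      refine H (ζ m - ζ n) _ (((hqζ m).sub (hqζ n) hf).hasScale hf hZ) ?_
      exact ENNReal.toReal_le_of_le_ofReal hδ.le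
        (hn (m, n) ⟨(le_max_left _ _).trans hm, (le_max_right _ _).trans hn'⟩).le)
  have hint : IsStochIntegral α P Z f h Y :=
    IsStochIntegral.of_tendsto hf (fun k => hqζ (ns k)) hh.1 (hlim.comp hns.tendsto_atTop) hY
  refine ⟨Y, fun ε hε => ?_, hint⟩
  have hev := (tendsto_order.mp (hf.tendsto_lnorm_iff.mpr hlim)).2 _ (ENNReal.ofReal_pos.mpr hε)
  obtain ⟨n, hn⟩ := hev.exists
  have hs := (hint.sub (hqζ n) hf).hasScale hf hZ
  refine ⟨ζ n, hζ n, hs.isSaS hα0, ?_⟩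
  rw [hs.saNorm_eq hα, ENNReal.toReal_rpow]
  exact (ENNReal.lt_ofReal_iff_toReal_lt
    (hf.lnorm_lt_top (hf.memLalpha_sub hh.1 (hf.memLalpha_expSpan (hq n))).2).ne).mp hn

/-- The observed variables are stochastic integrals of functions in `L_N^α(f)`. -/
lemma exists_memLN (hf : IsDensity α f) (hT : 1 ≤ T) (hZ : HasSpectralDensity α P Z f)
    (hrepr : ∀ n k, IsStochIntegral α P Z f (fun θ => Pi.single k (ex n θ)) (block T ξ n k))
    {Y : Ω → ℂ} (hY : Y ∈ observed α T N P ξ) :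
    ∃ h, MemLN α N f h ∧ IsStochIntegral α P Z f h Y := by
  have hα := hf.one_lt
  have hα0 : 0 < α := by linarith
  choose ζ hζ hS hlt using fun n : ℕ => hY (1 / ((n : ℝ) + 1)) (by positivity)
  choose p hp hpζ using fun n => exists_expSpan_of_mem_span hf hT hrepr (hζ n)
  choose M hM using fun n => (hS n).exists_hasScale hα0
  have hMlim : Tendsto M atTop (𝓝 0) := by
    have h1 : Tendsto (fun n : ℕ => (1 / ((n : ℝ) + 1)) ^ α) atTop (𝓝 0) := by
      have := tendsto_one_div_add_atTop_nhds_zero_nat (𝕜 := ℝ).rpow_const (p := α)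
        (Or.inr hα0.le)
      rwa [Real.zero_rpow hα0.ne'] at this
    refine squeeze_zero (fun n => (hM n).nonneg) (fun n => ?_) h1
    rw [← (hM n).saNorm_rpow hα]
    refine Real.rpow_le_rpow ?_ (hlt n).le hα0.le
    rw [(hM n).saNorm_eq hα]
    exact Real.rpow_nonneg (hM n).nonneg _
  -- Only the individual differences $Y-\zeta_n$ are known to be stable, so the argument passes
  -- through convergence in probability. It makes $\zeta_m-\zeta_n$ small in probability; these are
  -- stochastic integrals, so their scales, hence the norms of $p_m-p_n$, are small too.
  have hconv : TendstoInMeasure P ζ atTop Y := by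
    have h1 : TendstoInMeasure P (fun n => Y - ζ n) atTop 0 :=
      tendstoInMeasure_of_hasScale hα0 (M := M) (fun n => by simpa using hM n) hMlim
    rw [tendstoInMeasure_iff_norm] at h1 ⊢
    simpa [norm_sub_rev] using h1
  obtain ⟨h, hh, hlim⟩ := hf.exists_tendsto_of_cauchy (p := p)
    (fun n => hf.memLalpha_expSpan (hp n)) (by
      intro ε hε
      obtain ⟨r, hr0, hr⟩ : ∃ r : ℝ, 0 < r ∧ ENNReal.ofReal r ≤ ε := by
        obtain ⟨r, hr0, hr⟩ := ENNReal.lt_iff_exists_nnreal_btwn.mp hε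
        exact ⟨r, by exact_mod_cast hr0, by simpa using hr.le⟩
      obtain ⟨δ, hδ, H⟩ := exists_measure_le_scale_le (P := P) hα0 hr0
      have hev := (tendstoInMeasure_iff_measureReal_norm.mp hconv (δ / 2) (half_pos hδ)
        |>.eventually_le_const (half_pos hδ))
      obtain ⟨n₀, hn₀⟩ := eventually_atTop.mp hev
      refine ⟨n₀, fun m hm n hn => ?_⟩
      have h1 := H (ζ m - ζ n) _ (((hpζ m).sub (hpζ n) hf).hasScale hf hZ) (by
        refine (measureReal_mono (s₂ := {ω | δ / 2 ≤ ‖ζ m ω - Y ω‖} ∪ {ω | δ / 2 ≤ ‖ζ n ω - Y ω‖})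
          fun ω hω => ?_).trans ((measureReal_union_le _ _).trans
            ((add_le_add (hn₀ m hm) (hn₀ n hn)).trans_eq (add_halves δ)))
        rw [Set.mem_ofPred_eq, Pi.sub_apply] at hω
        rw [Set.mem_union, Set.mem_ofPred_eq, Set.mem_ofPred_eq]
        by_contra! hc
        have := norm_sub_le_norm_sub_add_norm_sub (ζ m ω) (Y ω) (ζ n ω)
        rw [norm_sub_rev (Y ω)] at this
        linarith)
      have hfin := (hf.memLalpha_sub (hf.memLalpha_expSpan (hp m)) (hf.memLalpha_expSpan (hp n))).2
      rw [← ENNReal.ofReal_toReal hfin.ne]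
      exact (ENNReal.ofReal_le_ofReal h1).trans hr)
  exact ⟨h, memLN_of_tendsto hh hp hlim, IsStochIntegral.of_tendsto hf hpζ hh hlim hconv⟩

lemma modular_of_subsingleton [Subsingleton (Fin T)] (hα : 1 < α)
    (F : Matrix (Fin T) (Fin T) ℂ) (v : Fin T → ℂ) (k : Fin T) :
    modular α F v = ‖v k‖ ^ α * (F k k).re := by
  rw [modular, form, dotProduct, Fintype.sum_subsingleton _ k, Matrix.mulVec, dotProduct,
    Fintype.sum_subsingleton _ k, vpow, mul_left_comm, mul_spow_self hα, mul_comm,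
    Complex.re_ofReal_mul]

end StableInterp
end

/-! ### The interpolation theorem. -/

open StableInterp

theorem mainTheorem4 {Ω : Type*} [MeasurableSpace Ω] (P : Measure Ω) [IsProbabilityMeasure P]
    (α : ℝ) (hα1 : 1 < α) (hα2 : α ≤ 2) (T N : ℕ) (hT : 1 ≤ T)
    (ξ : ℤ → Ω → ℂ) (Z : ℝ → Ω → Fin T → ℂ) (f : ℝ → Matrix (Fin T) (Fin T) ℂ)
    (hξ : StableInterp.IsPeriodicallyHarmonizable α T P ξ Z f)
    (hf : StableInterp.Minimality α f)
    (a : Fin (N + 1) → Fin T → ℂ) :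
    (∃! c : Fin (N + 1) → Fin T → ℂ, StableInterp.SolvesSystem α f a c) ∧
    ∀ c : Fin (N + 1) → Fin T → ℂ, StableInterp.SolvesSystem α f a c →
      StableInterp.MemLN α N f (StableInterp.specChar α f a c) ∧
      ∃ Y : Ω → ℂ,
        StableInterp.IsStochIntegral α P Z f (StableInterp.specChar α f a c) Y ∧
        StableInterp.IsOptimal α T N P ξ (StableInterp.functional a ξ) Y ∧
        (∀ Y' : Ω → ℂ, StableInterp.IsOptimal α T N P ξ (StableInterp.functional a ξ) Y' →
          Y' =ᵐ[P] Y) ∧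
        IntegrableOn (fun θ => StableInterp.errChar α f c θ ⬝ᵥ
          (f θ *ᵥ StableInterp.vpow (StableInterp.errChar α f c θ) (α - 1)))
          (Set.Ioc (-Real.pi) Real.pi) ∧
        ((StableInterp.saNorm α P (StableInterp.functional a ξ - Y) ^ α : ℝ) : ℂ)
          = ∫ θ in Set.Ioc (-Real.pi) Real.pi, StableInterp.errChar α f c θ ⬝ᵥ
              (f θ *ᵥ StableInterp.vpow (StableInterp.errChar α f c θ) (α - 1)) ∧
        (T = 1 → ∀ k : Fin T,
          StableInterp.saNorm α P (StableInterp.functional a ξ - Y) ^ α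
            = ∫ θ in Set.Ioc (-Real.pi) Real.pi,
                ‖StableInterp.errChar α f c θ k‖ ^ α * (f θ k k).re) := by
  have hα0 : 0 < α := by linarith
  have hZ := hξ.2.process
  have hrepr := hξ.2.repr
  have hd := hZ.isDensity hα1 hα2 hf
  obtain ⟨c₀, hc₀, hLN, he, hmin⟩ := hd.exists_solvesSystem a
  refine ⟨⟨c₀, hc₀, fun c hc => hd.solvesSystem_unique hc hc₀⟩, fun c hc => ?_⟩
  -- Any solution is the one built from the best approximation, so it inherits membership in
  -- $L_N^\alpha(f)$ and optimality.
  obtain rfl := hd.solvesSystem_unique hc₀ hc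
  refine ⟨hLN, ?_⟩
  obtain ⟨Y, hY, hYint⟩ := exists_mem_observed hd hZ hrepr hLN
  have hA := isStochIntegral_functional hd hrepr a
  have hsub : polyA a - specChar α f a c₀ = errChar α f c₀ := by
    ext1 θ
    rw [Pi.sub_apply, specChar, sub_sub_cancel]
  have hscale : HasScale α P (functional a ξ - Y) (lalpha α f (errChar α f c₀)).toReal := by
    have := (hA.sub hYint hd).hasScale hd hZ
    rwa [hsub] at this
  have hform : (fun θ => form α (f θ) (errChar α f c₀ θ) (errChar α f c₀ θ))
      =ᵐ[freq] fun θ => (modular α (f θ) (errChar α f c₀ θ) : ℂ) := by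
    filter_upwards [hd.alphaForm] with θ hθ using hθ.form_self hα1 _
  have herr := hscale.saNorm_rpow hα1
  rw [hd.toReal_lalpha he.1] at herr
  refine ⟨Y, hYint, ⟨hY, fun η hη => ?_⟩, fun Y' hY' => ?_,
    (hd.integrable_modular he).ofReal.congr hform.symm, ?_, fun hT1 k => ?_⟩
  · obtain ⟨h, hh, hint⟩ := exists_memLN hd hT hZ hrepr hη
    rw [hscale.saNorm_eq hα1, ((hA.sub hint hd).hasScale hd hZ).saNorm_eq hα1]
    exact Real.rpow_le_rpow ENNReal.toReal_nonneg
      (ENNReal.toReal_mono (hA.sub hint hd).1.2.ne (hmin h hh)) (by positivity)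
  · obtain ⟨h, hh, hint⟩ := exists_memLN hd hT hZ hrepr hY'.1
    have hle := hY'.2 Y hY
    have hs := (hA.sub hint hd).hasScale hd hZ
    rw [hscale.saNorm_eq hα1, hs.saNorm_eq hα1, Real.rpow_le_rpow_iff ENNReal.toReal_nonneg
      ENNReal.toReal_nonneg (by positivity), ENNReal.toReal_le_toReal (hA.sub hint hd).1.2.ne
      he.2.ne] at hle
    -- A second optimal estimate is the integral of another best approximation. The two integrands
    -- are at distance $0$, so the difference of the estimates has scale $0$ and vanishes almost
    -- surely.
    have h0 := hd.lalpha_sub_eq_zero hA.1 hLN (by rwa [hsub]) hh (by rwa [hsub])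
    have hs0 := (hint.sub hYint hd).hasScale hd hZ
    rw [h0, ENNReal.toReal_zero] at hs0
    filter_upwards [hs0.ae_eq_zero hα0] with ω hω
    exact sub_eq_zero.mp hω
  · rw [herr, ← integral_complex_ofReal]
    exact integral_congr_ae hform.symm
  · have : Subsingleton (Fin T) := by subst hT1; infer_instance
    rw [herr]
    exact integral_congr_ae (Eventually.of_forall fun θ =>
      modular_of_subsingleton hα1 _ _ k)
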